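/- Theorem. Let $X,Y,Z$ be the vertices of a non-degenerate triangle in the plane, let $F$ be a point of the triangle $XYZ$, and let $A$ be a finite set of points of the triangle $XYZ$, none of which is $X$, $Y$, $Z$ or $F$. Assume that $\{X,Y,Z,F\}\cup A$ is in general position, i.e. no three distinct points of it are collinear. Put $P_1=X$, $P_2=Y$, $P_3=Z$, with indices read cyclically, so that $P_4=P_1$. For $i=1,2,3$ let $c_i$ be the number of points of $A$ in the triangle $FP_iP_{i+1}$, and assume $c_1,c_2,c_3>0$. Then the points of $A$ can be listed, each exactly once, as $$(A_{1,1},\dots,A_{1,c_1},\,A_{2,1},\dots,A_{2,c_2},\,A_{3,1},\dots,A_{3,c_3})$$ such that, writing $L_i$ for the polyline $P_iA_{i,1}\cdots A_{i,c_i}P_{i+1}$: 1. for each $i$, the polyline $L_i$ is contained in the triangle $FP_iP_{i+1}$; 2. the concatenation $L_1L_2L_3$ is a closed polyline without self-intersections, i.e. a simple polygon; 3. the region bounded by this polygon has a triangulation (a decomposition into triangles that meet along common faces, whose vertices are exactly the vertices of the polygon) in which no diagonal, i.e. no edge of the triangulation that is not a side of the polygon, has both its endpoints among the vertices $P_i,A_{i,1},\dots,A_{i,c_i},P_{i+1}$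 of one and the same $L_i$. -/

import Mathlib

/-- The Euclidean plane. -/
abbrev Plane : Type := EuclideanSpace ℝ (Fin 2)

/-- A set of points of the plane is in general position if no three distinct points of it are
collinear. -/
def InGeneralPosition (S : Set Plane) : Prop :=
  ∀ p ∈ S, ∀ q ∈ S, ∀ r ∈ S, p ≠ q → q ≠ r → p ≠ r → ¬ Collinear ℝ {p, q, r}

/-- The point set covered by the polyline through the points of the list `l`, in the
given order: the union of the segments between consecutive entries of `l`. -/
def polylineCarrier (l : List Plane) : Set Plane :=
  {x | ∃ p q : Plane, [p, q] <:+: l ∧ x ∈ segment ℝ p q}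

/-- The closed polyline (polygon) whose cyclic sequence of vertices is the list `l`. -/
def closedPolyline (l : List Plane) : Polygon Plane l.length :=
  ⟨l.get⟩

namespace Polygon

variable {n : ℕ}

/-- A polygon is simple (non-self-intersecting) if walking once around it, each side being traversed
from its first endpoint (included) to its last endpoint (excluded), never visits a point twice. -/
def IsSimple (p : Polygon Plane n) : Prop :=
  ∀ i j : Fin n, ∀ s ∈ Set.Ico (0 : ℝ) 1, ∀ t ∈ Set.Ico (0 : ℝ) 1,
    p.edgePath ℝ i s = p.edgePath ℝ j t → i = j ∧ s = t

/-- The open region enclosed by a polygon: the points off its boundary that lie in a bounded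
connected component of the complement of the boundary. -/
def inside (p : Polygon Plane n) : Set Plane :=
  {x | x ∉ p.boundary ℝ ∧ Bornology.IsBounded (connectedComponentIn (p.boundary ℝ)ᶜ x)}

/-- The closed region bounded by a polygon. -/
def region (p : Polygon Plane n) : Set Plane :=
  p.boundary ℝ ∪ p.inside

/-- `K` is a triangulation of the region bounded by the polygon `p`: a geometric simplicial complex
whose vertices are exactly the vertices of `p` and which covers exactly the closed region. -/
def IsTriangulation (p : Polygon Plane n) (K : Geometry.SimplicialComplex ℝ Plane) : Prop :=
  K.vertices = Set.range p.vertices ∧ K.space = p.region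

/-- The segment between `a` and `b` is a side of the polygon `p`. -/
def IsSide (p : Polygon Plane n) (a b : Plane) : Prop :=
  ∃ i : Fin n, s(a, b) = s(p i, p (finRotate n i))

/-- The segment between `a` and `b` is a diagonal used in the triangulation `K` of `p`: an edge of
`K` that is not a side of `p`. -/
def IsDiagonalOf (p : Polygon Plane n) (K : Geometry.SimplicialComplex ℝ Plane)
    (a b : Plane) : Prop :=
  a ≠ b ∧ (∃ e ∈ K.faces, (e : Set Plane) = {a, b}) ∧ ¬ p.IsSide a b

end Polygon

/-!
The point `F` is interior to `X Y Z`; call `A`, `B`, `C` the groups of points in `F Y Z`, `F Z X`,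
`F X Y`. It suffices to find a triangle `a b c` with one vertex in each group (or, in a degenerate
case, with a vertex of `X Y Z` in place of a point of an adjacent group), such that the remaining
points fall into three corner regions, at `X`, `Y` and `Z`, that meet only in `a`, `b` and `c`.
The corner at `X` then contains only points of `B` and `C`, separated by the line `F X`. Inserting
the triangles of a zigzag strip one at a time, with every new edge running from one of these two
groups to the other, joins the central triangle to `X`; no diagonal ever joins two points of one
chain.

For the central triangle, call a segment a front if it runs between two of the groups and separates
all of the third group from `F`. If there is a front, push one as far away from `F` as possible and
choose as third vertex the first point met by rotating a ray about one of its endpoints. If there is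
none, a triangle around `F` that contains no further point must have a vertex in each group.
-/

/-- Twice the signed area of the triangle `a b c`, computed from the coordinates `i` and `i + 1`;
the choice of `i` selects the orientation of the plane, so that an argument carried out for every
`i` is invariant under reflections. -/
def orient (i : Fin 2) (a b c : Plane) : ℝ :=
  (b i - a i) * (c (i + 1) - a (i + 1)) - (b (i + 1) - a (i + 1)) * (c i - a i)

section Orient

variable {i : Fin 2} {a b c : Plane}

theorem Plane.ext_coord (i : Fin 2) (h₀ : a i = b i) (h₁ : a (i + 1) = b (i + 1)) : a = b := by
  ext j
  fin_cases i <;> fin_cases j <;> simp_all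

theorem orient_rotate (i : Fin 2) (a b c : Plane) : orient i a b c = orient i b c a := by
  unfold orient; ring

theorem orient_swap (i : Fin 2) (a b c : Plane) : orient i a b c = -orient i b a c := by
  unfold orient; ring

theorem orient_swap_right (i : Fin 2) (a b c : Plane) : orient i a b c = -orient i a c b := by
  unfold orient; ring

theorem orient_add_one (i : Fin 2) (a b c : Plane) : orient (i + 1) a b c = -orient i a b c := by
  have h : i + 1 + 1 = i := by fin_cases i <;> rfl
  unfold orient
  rw [h]
  ring

@[simp] theorem orient_left (i : Fin 2) (a b : Plane) : orient i a b a = 0 := by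
  unfold orient; ring

@[simp] theorem orient_right (i : Fin 2) (a b : Plane) : orient i a b b = 0 := by
  unfold orient; ring

@[simp] theorem orient_self (i : Fin 2) (a b : Plane) : orient i a a b = 0 := by
  unfold orient; ring

theorem orient_add_orient_add_orient (i : Fin 2) (a b c d : Plane) :
    orient i d a b + orient i d b c + orient i d c a = orient i a b c := by
  unfold orient; ring

theorem orient_plucker (i : Fin 2) (p u v w z : Plane) :
    orient i p u v * orient i p w z + orient i p v w * orient i p u z
      + orient i p w u * orient i p v z = 0 := by
  unfold orient; ring

theorem orient_smul_add_smul (i : Fin 2) (a b x y : Plane) {s t : ℝ} (h : s + t = 1) :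
    orient i a b (s • x + t • y) = s * orient i a b x + t * orient i a b y := by
  obtain rfl : s = 1 - t := by linarith
  simp only [orient, PiLp.add_apply, PiLp.smul_apply, smul_eq_mul]
  ring

theorem continuous_orient (i : Fin 2) (a b : Plane) : Continuous (orient i a b) := by
  unfold orient; fun_prop

theorem isOpen_orient_pos (i : Fin 2) (a b : Plane) : IsOpen {x | 0 < orient i a b x} :=
  isOpen_lt continuous_const (continuous_orient i a b)

theorem convex_orient_nonneg (i : Fin 2) (a b : Plane) : Convex ℝ {x | 0 ≤ orient i a b x} := by
  intro x hx y hy s t hs ht hst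
  rw [Set.mem_ofPred_eq] at hx hy ⊢
  rw [orient_smul_add_smul i a b x y hst]
  positivity

theorem convex_orient_pos_union (i : Fin 2) (a b : Plane) {S : Set Plane} (hS : Convex ℝ S)
    (hS₀ : ∀ z ∈ S, orient i a b z = 0) : Convex ℝ ({z | 0 < orient i a b z} ∪ S) := by
  refine convex_iff_forall_pos.2 fun x hx y hy s t hs ht hst => ?_
  have nonneg : ∀ z ∈ {z | 0 < orient i a b z} ∪ S, 0 ≤ orient i a b z := by
    rintro z (hz | hz)
    exacts [le_of_lt hz, (hS₀ z hz).ge]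
  have hx₀ := nonneg x hx
  have hy₀ := nonneg y hy
  rw [Set.mem_union, Set.mem_ofPred_eq, orient_smul_add_smul i a b x y hst]
  rcases hx with hx | hx
  · rw [Set.mem_ofPred_eq] at hx
    exact Or.inl (by positivity)
  rcases hy with hy | hy
  · rw [Set.mem_ofPred_eq] at hy
    exact Or.inl (by positivity)
  · exact Or.inr (hS hx hy hs.le ht.le hst)

theorem convex_orient_pos (i : Fin 2) (a b : Plane) : Convex ℝ {x | 0 < orient i a b x} := by
  simpa only [Set.union_empty] using
    convex_orient_pos_union i a b convex_empty fun z hz => absurd hz (Set.notMem_empty z)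

theorem convex_orient_neg (i : Fin 2) (a b : Plane) : Convex ℝ {x | orient i a b x < 0} := by
  simpa only [orient_swap i b a, neg_pos] using convex_orient_pos i b a

theorem orient_eq_zero_of_mem_segment {z : Plane} (h : z ∈ segment ℝ a b) :
    orient i a b z = 0 := by
  obtain ⟨s, t, -, -, hst, rfl⟩ := h
  simp only [orient_smul_add_smul i a b a b hst, orient_left, orient_right, mul_zero, add_zero]

theorem orient_nonpos_of_mem_convexHull {x : Plane} {G : Set Plane}
    (hG : ∀ z ∈ G, orient i a b z ≤ 0) (hx : x ∈ convexHull ℝ G) : orient i a b x ≤ 0 := by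
  have hx' : 0 ≤ orient i b a x :=
    convexHull_min (fun z hz => by simpa only [Set.mem_ofPred_eq, orient_swap i b a,
      Left.nonneg_neg_iff] using hG z hz) (convex_orient_nonneg i b a) hx
  rwa [orient_swap, Left.neg_nonpos_iff]

theorem mem_of_mem_convexHull_of_orient_nonpos {x : Plane} {G S : Set Plane}
    (hS : Convex ℝ S) (hS₀ : ∀ z ∈ S, orient i a b z = 0)
    (hG : ∀ z ∈ G, 0 < orient i a b z ∨ z ∈ S) (hx : x ∈ convexHull ℝ G)
    (hx₀ : orient i a b x ≤ 0) : x ∈ S :=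
  (convexHull_min hG (convex_orient_pos_union i a b hS hS₀) hx).resolve_left (not_lt.2 hx₀)

theorem eq_barycentric (d : Plane) (h : orient i a b c ≠ 0) :
    d = (orient i b c d / orient i a b c) • a + (orient i c a d / orient i a b c) • b
      + (orient i a b d / orient i a b c) • c := by
  apply Plane.ext_coord i <;>
    simp only [PiLp.add_apply, PiLp.smul_apply, smul_eq_mul] <;> field_simp <;>
    unfold orient <;> ring

theorem mem_triangle_iff {x : Plane} (h : 0 < orient i a b c) :
    x ∈ convexHull ℝ {a, b, c} ↔
      0 ≤ orient i a b x ∧ 0 ≤ orient i b c x ∧ 0 ≤ orient i c a x := by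
  constructor
  · have side : ∀ p q, (∀ z ∈ ({a, b, c} : Set Plane), 0 ≤ orient i p q z) →
        x ∈ convexHull ℝ {a, b, c} → 0 ≤ orient i p q x :=
      fun p q hpq => (convexHull_min hpq (convex_orient_nonneg i p q) ·)
    have hbc : 0 < orient i b c a := by rwa [← orient_rotate]
    have hca : 0 < orient i c a b := by rwa [orient_rotate]
    refine fun hx => ⟨side a b ?_ hx, side b c ?_ hx, side c a ?_ hx⟩ <;>
      rintro z (rfl | rfl | rfl) <;> simp [h.le, hbc.le, hca.le]
  · rintro ⟨hab, hbc, hca⟩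
    have hsum : orient i b c x + orient i c a x + orient i a b x = orient i a b c := by
      unfold orient; ring
    have hmem := (convex_convexHull ℝ {a, b, c}).sum_mem (t := Finset.univ)
      (w := ![orient i b c x / orient i a b c, orient i c a x / orient i a b c,
        orient i a b x / orient i a b c]) (z := ![a, b, c])
      (fun j _ => by fin_cases j <;> simp only [Fin.reduceFinMk, Matrix.cons_val] <;> positivity)
      (by simp only [Fin.sum_univ_three, Matrix.cons_val]
          rw [← add_div, ← add_div, hsum, div_self h.ne'])
      (fun j _ => subset_convexHull ℝ _ (by fin_cases j <;> simp))
    simpa only [Fin.sum_univ_three, Matrix.cons_val, ← eq_barycentric x h.ne'] using hmem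

theorem collinear_iff_orient_eq_zero (i : Fin 2) (a b c : Plane) :
    Collinear ℝ {a, b, c} ↔ orient i a b c = 0 := by
  rw [collinear_iff_of_mem (p₀ := a) (by simp)]
  constructor
  · rintro ⟨v, hv⟩
    obtain ⟨r, rfl⟩ := hv b (by simp)
    obtain ⟨s, rfl⟩ := hv c (by simp)
    simp only [orient, vadd_eq_add, PiLp.add_apply, PiLp.smul_apply, smul_eq_mul]
    ring
  · intro h
    rcases eq_or_ne b a with rfl | hab
    · refine ⟨c - b, ?_⟩
      rintro p (rfl | rfl | rfl)
      exacts [⟨0, by simp⟩, ⟨0, by simp⟩, ⟨1, by simp⟩]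
    · have hpos : 0 < (b i - a i) ^ 2 + (b (i + 1) - a (i + 1)) ^ 2 := by
        by_contra! hle
        refine hab (Plane.ext_coord i ?_ ?_) <;> nlinarith
      refine ⟨b - a, ?_⟩
      rintro p (rfl | rfl | rfl)
      · exact ⟨0, by simp⟩
      · exact ⟨1, by simp⟩
      · -- the coefficient of the orthogonal projection of `p - a` onto `b - a`
        refine ⟨((b i - a i) * (p i - a i) + (b (i + 1) - a (i + 1)) * (p (i + 1) - a (i + 1))) /
          ((b i - a i) ^ 2 + (b (i + 1) - a (i + 1)) ^ 2), ?_⟩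
        unfold orient at h
        apply Plane.ext_coord i <;>
          simp only [PiLp.add_apply, PiLp.smul_apply, PiLp.sub_apply, vadd_eq_add, smul_eq_mul] <;>
          field_simp
        · linear_combination (-(b (i + 1) - a (i + 1))) * h
        · linear_combination (b i - a i) * h

theorem affineIndependent_iff_orient_ne_zero (i : Fin 2) (a b c : Plane) :
    AffineIndependent ℝ ![a, b, c] ↔ orient i a b c ≠ 0 := by
  rw [affineIndependent_iff_not_collinear_set, collinear_iff_orient_eq_zero i]

theorem exists_mem_segments_of_crossing {d : Plane} (hc : 0 < orient i a b c)
    (hd : orient i a b d ≤ 0) (ha : orient i c d a ≤ 0) (hb : 0 ≤ orient i c d b) :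
    ∃ x, x ∈ segment ℝ a b ∧ x ∈ segment ℝ c d := by
  have hsub : orient i a b c - orient i a b d = orient i c d b - orient i c d a := by
    unfold orient; ring
  have hpos : 0 < orient i a b c - orient i a b d := by linarith
  have hpos' : 0 < orient i c d b - orient i c d a := hsub ▸ hpos
  refine ⟨(orient i c d b / (orient i c d b - orient i c d a)) • a
      + (-orient i c d a / (orient i c d b - orient i c d a)) • b,
    ⟨_, _, by positivity, div_nonneg (by linarith) hpos'.le, ?_, rfl⟩,
    -orient i a b d / (orient i a b c - orient i a b d),
    orient i a b c / (orient i a b c - orient i a b d),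
    div_nonneg (by linarith) hpos.le, by positivity, ?_, ?_⟩
  · rw [← add_div, ← sub_eq_add_neg, div_self hpos'.ne']
  · rw [← add_div, neg_add_eq_sub, div_self hpos.ne']
  · rw [hsub]
    apply Plane.ext_coord i <;>
      simp only [PiLp.add_apply, PiLp.smul_apply, smul_eq_mul] <;> field_simp <;>
      unfold orient <;> ring

theorem eq_of_mem_segments {x : Plane} (h : orient i a b c ≠ 0) (hab : x ∈ segment ℝ a b)
    (hbc : x ∈ segment ℝ b c) : x = b := by
  have hx := orient_eq_zero_of_mem_segment (i := i) hbc
  obtain ⟨s, t, -, -, hst, rfl⟩ := hab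
  rw [orient_smul_add_smul _ _ _ _ _ hst, orient_left, ← orient_rotate, mul_zero, add_zero,
    mul_eq_zero, or_iff_left h] at hx
  subst hx
  rw [zero_add] at hst
  rw [hst, zero_smul, one_smul, zero_add]

theorem insert_pair_rotate (a b c : Plane) : ({a, b, c} : Set Plane) = {b, c, a} := by
  rw [Set.insert_comm, Set.pair_comm a c]

theorem segment_subset_triangle (a b c : Plane) : segment ℝ a b ⊆ convexHull ℝ {a, b, c} :=
  segment_subset_convexHull (by simp) (by simp)

theorem mem_segment_of_mem_triangle {x : Plane} (h : 0 < orient i a b c)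
    (hx : x ∈ convexHull ℝ {a, b, c}) (hab : orient i a b x ≤ 0) : x ∈ segment ℝ a b := by
  refine mem_of_mem_convexHull_of_orient_nonpos (convex_segment a b)
    (fun z hz => orient_eq_zero_of_mem_segment hz) ?_ hx hab
  rintro z (rfl | rfl | rfl)
  exacts [Or.inr (left_mem_segment _ _ _), Or.inr (right_mem_segment _ _ _), Or.inl h]

end Orient

section Topology

theorem isPreconnected_diff_of_subset {E : Type*} [TopologicalSpace E] {C N T : Set E}
    (hC : IsPreconnected C) (hT : IsClosed T) (hN : IsOpen N) (hNC : N ⊆ C) (hCTN : C ∩ T ⊆ N)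
    (hNT : IsPreconnected (N \ T)) : IsPreconnected (C \ T) := by
  rw [isPreconnected_iff_subset_of_disjoint]
  intro P Q hP hQ hPQ hdisj
  wlog hNP : N \ T ⊆ P generalizing P Q
  · have hNQ : N \ T ⊆ Q := ((isPreconnected_iff_subset_of_disjoint.1 hNT) P Q hP hQ
      ((Set.sdiff_subset_sdiff_left hNC).trans hPQ)
      (Set.subset_eq_empty (Set.inter_subset_inter_left _ (Set.sdiff_subset_sdiff_left hNC))
        hdisj)).resolve_left hNP
    exact (this Q P hQ hP (by rwa [Set.union_comm]) (by rwa [Set.inter_comm Q]) hNQ).symm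
  have not_both : ∀ x ∈ C, x ∉ T → x ∈ P → x ∉ Q := fun x hxC hxT hxP hxQ =>
    hdisj.subset ⟨⟨hxC, hxT⟩, hxP, hxQ⟩
  rcases (isPreconnected_iff_subset_of_disjoint.1 hC) (P \ T ∪ N) (Q \ T)
    ((hP.sdiff hT).union hN) (hQ.sdiff hT) (by
      intro x hx
      by_cases hxT : x ∈ T
      · exact Or.inl (Or.inr (hCTN ⟨hx, hxT⟩))
      · exact (hPQ ⟨hx, hxT⟩).imp (fun hxP => Or.inl ⟨hxP, hxT⟩) fun hxQ => ⟨hxQ, hxT⟩)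
    (by
      refine Set.eq_empty_of_forall_notMem fun x hx => ?_
      obtain ⟨hxC, hxPN, hxQ, hxT⟩ := hx
      exact not_both x hxC hxT (hxPN.elim And.left fun hxN => hNP ⟨hxN, hxT⟩) hxQ) with h | h
  · exact Or.inl fun x hx => (h hx.1).elim And.left fun hxN => hNP ⟨hxN, hx.2⟩
  · exact Or.inr fun x hx => (h hx.1).1

/-- The compact set `M` fills the closed curve with carrier `D`: its frontier lies on `D ⊆ M` and
its complement is connected. -/
structure Fills (M D : Set Plane) : Prop where
  isCompact : IsCompact M
  subset : D ⊆ M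
  frontier_subset : frontier M ⊆ D
  isPreconnected_compl : IsPreconnected Mᶜ

theorem Fills.eq_union_bounded_components {M D : Set Plane} (h : Fills M D) :
    M = D ∪ {x | x ∉ D ∧ Bornology.IsBounded (connectedComponentIn Dᶜ x)} := by
  have mem_interior : ∀ x ∈ M, x ∉ D → x ∈ interior M := fun x hxM hxD =>
    not_not.1 fun hxi => hxD (h.frontier_subset ⟨subset_closure hxM, hxi⟩)
  refine Set.Subset.antisymm (fun x hxM => ?_) (Set.union_subset h.subset ?_)
  · by_cases hxD : x ∈ D
    · exact Or.inl hxD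
    refine Or.inr ⟨hxD, h.isCompact.isBounded.subset ?_⟩
    have hcover : connectedComponentIn Dᶜ x ⊆ interior M ∪ Mᶜ := fun z hz =>
      or_iff_not_imp_right.2 fun hzM =>
        mem_interior z (not_not.1 hzM) (connectedComponentIn_subset _ _ hz)
    have hsub : connectedComponentIn Dᶜ x ⊆ interior M :=
      isPreconnected_connectedComponentIn.subset_left_of_subset_union isOpen_interior
        h.isCompact.isClosed.isOpen_compl (disjoint_compl_right.mono_left interior_subset) hcover
        ⟨x, mem_connectedComponentIn hxD, mem_interior x hxM hxD⟩
    exact hsub.trans interior_subset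
  · rintro x ⟨-, hbdd⟩
    by_contra hxM
    have hsub : Mᶜ ⊆ connectedComponentIn Dᶜ x :=
      h.isPreconnected_compl.subset_connectedComponentIn hxM (Set.compl_subset_compl.2 h.subset)
    have huniv := (hbdd.subset hsub).union h.isCompact.isBounded
    rw [Set.compl_union_self] at huniv
    exact NormedSpace.unbounded_univ ℝ Plane huniv

variable {i : Fin 2} {u v w p x : Plane} {M : Set Plane}

theorem isCompact_triangle (a b c : Plane) : IsCompact (convexHull ℝ {a, b, c}) :=
  (Set.toFinite {a, b, c}).isCompact_convexHull ℝ

theorem frontier_triangle_subset (h : 0 < orient i u v p) :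
    frontier (convexHull ℝ {u, v, p}) ⊆ segment ℝ u v ∪ segment ℝ v p ∪ segment ℝ p u := by
  intro x hx
  have hxT := (isCompact_triangle u v p).isClosed.frontier_subset hx
  have hvp : 0 < orient i v p u := by rwa [← orient_rotate]
  have hpu : 0 < orient i p u v := by rwa [orient_rotate]
  by_contra! hn
  simp only [Set.mem_union, not_or] at hn
  obtain ⟨⟨hn₁, hn₂⟩, hn₃⟩ := hn
  have h₁ : 0 < orient i u v x := not_le.1 fun hle => hn₁ (mem_segment_of_mem_triangle h hxT hle)
  have h₂ : 0 < orient i v p x := not_le.1 fun hle =>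
    hn₂ (mem_segment_of_mem_triangle hvp (by rwa [← insert_pair_rotate]) hle)
  have h₃ : 0 < orient i p u x := not_le.1 fun hle =>
    hn₃ (mem_segment_of_mem_triangle hpu (by rwa [insert_pair_rotate]) hle)
  refine hx.2 (mem_interior.2 ⟨_, fun z hz => ?_, ((isOpen_orient_pos i u v).inter
    (isOpen_orient_pos i v p)).inter (isOpen_orient_pos i p u), ⟨h₁, h₂⟩, h₃⟩)
  exact (mem_triangle_iff h).2 ⟨hz.1.1.le, hz.1.2.le, hz.2.le⟩

theorem mem_interior_union_triangles (hp : 0 < orient i u v p) (hw : orient i u v w < 0)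
    (hx : x ∈ segment ℝ u v) (hxu : x ≠ u) (hxv : x ≠ v) :
    x ∈ interior (convexHull ℝ {u, v, p} ∪ convexHull ℝ {v, u, w}) := by
  have hw' : 0 < orient i v u w := by rwa [orient_swap, neg_pos]
  obtain ⟨s, t, hs, ht, hst, rfl⟩ := mem_openSegment_of_ne_left_right hxu.symm hxv.symm hx
  refine mem_interior.2 ⟨_, ?_, ((isOpen_orient_pos i v p).inter (isOpen_orient_pos i p u)).inter
    ((isOpen_orient_pos i u w).inter (isOpen_orient_pos i w v)), ?_⟩
  · rintro z ⟨⟨hvp, hpu⟩, huw, hwv⟩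
    rcases le_total 0 (orient i u v z) with hz | hz
    · exact Or.inl ((mem_triangle_iff hp).2 ⟨hz, hvp.le, hpu.le⟩)
    · refine Or.inr ((mem_triangle_iff hw').2 ⟨?_, huw.le, hwv.le⟩)
      rwa [orient_swap, Left.nonneg_neg_iff]
  · have hvpu : 0 < orient i v p u := by rwa [← orient_rotate]
    have hpuv : 0 < orient i p u v := by rwa [orient_rotate]
    have huwv : 0 < orient i u w v := by rwa [← orient_rotate]
    have hwvu : 0 < orient i w v u := by rwa [orient_rotate]
    simp only [Set.mem_inter_iff, Set.mem_ofPred_eq, orient_smul_add_smul _ _ _ _ _ hst,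
      orient_left, orient_right, mul_zero, add_zero, zero_add]
    exact ⟨⟨by positivity, by positivity⟩, by positivity, by positivity⟩

theorem orient_smul_sub_sub (i : Fin 2) (a b u v p : Plane) :
    orient i a b ((3 : ℝ) • p - u - v) = 3 * orient i a b p - orient i a b u - orient i a b v := by
  simp only [orient, PiLp.sub_apply, PiLp.smul_apply, smul_eq_mul]
  ring

theorem mem_closure_opposite_cone (h : 0 < orient i u v p) :
    p ∈ closure ({x | orient i v p x < 0} ∩ {x | orient i p u x < 0}) := by
  have hvp : 0 < orient i v p u := by rwa [← orient_rotate]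
  have hpu : 0 < orient i p u v := by rwa [orient_rotate]
  refine closure_mono ?_ (segment_subset_closure_openSegment
    (left_mem_segment ℝ p ((3 : ℝ) • p - u - v)))
  rintro _ ⟨s, t, -, ht, hst, rfl⟩
  simp only [Set.mem_inter_iff, Set.mem_ofPred_eq, orient_smul_add_smul _ _ _ _ _ hst,
    orient_smul_sub_sub, orient_left, orient_right]
  constructor <;> nlinarith

theorem isPreconnected_compl_triangle (h : 0 < orient i u v p) :
    IsPreconnected (convexHull ℝ {u, v, p})ᶜ := by
  have hvp : 0 < orient i v p u := by rwa [← orient_rotate]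
  have heq : (convexHull ℝ {u, v, p})ᶜ =
      {x | orient i u v x < 0} ∪ ({x | orient i v p x < 0} ∪ {x | orient i p u x < 0}) := by
    ext x
    simp only [Set.mem_compl_iff, mem_triangle_iff h, not_and_or, not_le, Set.mem_union,
      Set.mem_ofPred_eq]
  have meet₁ := closure_nonempty_iff.1 ⟨p, mem_closure_opposite_cone h⟩
  have meet₂ := closure_nonempty_iff.1 ⟨u, mem_closure_opposite_cone hvp⟩
  rw [heq]
  refine (convex_orient_neg i u v).isPreconnected.union'
    (meet₂.mono fun x hx => ⟨hx.2, Or.inr hx.1⟩)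
    ((convex_orient_neg i v p).isPreconnected.union' meet₁ (convex_orient_neg i p u).isPreconnected)

theorem isPreconnected_diff_triangle (h : 0 < orient i u v p) {V : Set Plane} (hV : IsOpen V)
    (hVc : Convex ℝ V) (hpV : p ∈ V) (hVpos : V ⊆ {x | 0 < orient i u v x}) :
    IsPreconnected (V \ convexHull ℝ {u, v, p}) := by
  have heq : V \ convexHull ℝ {u, v, p} =
      V ∩ {x | orient i v p x < 0} ∪ V ∩ {x | orient i p u x < 0} := by
    ext x
    simp only [Set.mem_sdiff, mem_triangle_iff h, not_and_or, not_le, Set.mem_union,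
      Set.mem_inter_iff, Set.mem_ofPred_eq, ← and_or_left]
    exact and_congr_right fun hx => or_iff_right (hVpos hx).le.not_gt
  rw [heq]
  refine (hVc.inter (convex_orient_neg i v p)).isPreconnected.union' ?_
    (hVc.inter (convex_orient_neg i p u)).isPreconnected
  exact (mem_closure_iff.1 (mem_closure_opposite_cone h) V hV hpV).mono
    fun x hx => ⟨⟨hx.1, hx.2.1⟩, hx.1, hx.2.2⟩

theorem exists_convex_nhds_of_mem_triangle {y : Plane} (hM : IsClosed M)
    (h : 0 < orient i u v p) (huv : segment ℝ u v ⊆ M)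
    (hinter : M ∩ convexHull ℝ {u, v, p} ⊆ segment ℝ u v) (hy : y ∈ convexHull ℝ {u, v, p})
    (hyM : y ∉ M) :
    ∃ V ⊆ Mᶜ ∩ {x | 0 < orient i u v x}, IsOpen V ∧ Convex ℝ V ∧ p ∈ V ∧ y ∈ V := by
  have hy₀ : 0 < orient i u v y :=
    not_le.1 fun hle => hyM (huv (mem_segment_of_mem_triangle h hy hle))
  have hseg : segment ℝ y p ⊆ Mᶜ ∩ {x | 0 < orient i u v x} := fun z hz => by
    have hz₀ : 0 < orient i u v z := (convex_orient_pos i u v).segment_subset hy₀ h hz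
    have hzT : z ∈ convexHull ℝ {u, v, p} :=
      (convex_convexHull ℝ _).segment_subset hy (subset_convexHull ℝ _ (by simp)) hz
    exact ⟨fun hzM => hz₀.ne' (orient_eq_zero_of_mem_segment (hinter ⟨hzM, hzT⟩)), hz₀⟩
  have hcompact : IsCompact (segment ℝ y p) :=
    convexHull_pair (𝕜 := ℝ) y p ▸ (Set.toFinite {y, p}).isCompact_convexHull ℝ
  obtain ⟨δ, hδ, hsub⟩ := hcompact.exists_thickening_subset_open
    (hM.isOpen_compl.inter (isOpen_orient_pos i u v)) hseg
  exact ⟨_, hsub, Metric.isOpen_thickening, (convex_segment y p).thickening δ,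
    Metric.self_subset_thickening hδ _ (right_mem_segment ℝ y p),
    Metric.self_subset_thickening hδ _ (left_mem_segment ℝ y p)⟩

/- The triangle lies in the union of the convex open sets `V` around its tip `p` that avoid `M` and
stay beyond `u v`. It does not disconnect that union, since what it leaves of each `V` is connected
and reaches `p`. -/
theorem isPreconnected_compl_union_triangle (hM : IsClosed M) (hMc : IsPreconnected Mᶜ)
    (h : 0 < orient i u v p) (huv : segment ℝ u v ⊆ M)
    (hinter : M ∩ convexHull ℝ {u, v, p} ⊆ segment ℝ u v) :
    IsPreconnected (M ∪ convexHull ℝ {u, v, p})ᶜ := by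
  set 𝒱 : Set (Set Plane) :=
    {V | V ⊆ Mᶜ ∩ {x | 0 < orient i u v x} ∧ IsOpen V ∧ Convex ℝ V ∧ p ∈ V}
  have hpre : IsPreconnected (⋃₀ 𝒱 \ convexHull ℝ {u, v, p}) := by
    rw [Set.sUnion_eq_iUnion, Set.iUnion_sdiff]
    refine IsPreconnected.iUnion_of_reflTransGen (fun V => isPreconnected_diff_triangle h V.2.2.1
      V.2.2.2.1 V.2.2.2.2 (V.2.1.trans Set.inter_subset_right)) fun V V' => ?_
    refine Relation.ReflTransGen.single ((mem_closure_iff.1 (mem_closure_opposite_cone h)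
      (V ∩ V' : Set Plane) (V.2.2.1.inter V'.2.2.1) ⟨V.2.2.2.2, V'.2.2.2.2⟩).mono fun x hx => ?_)
    have hxT : x ∉ convexHull ℝ {u, v, p} :=
      fun hxT => ((mem_triangle_iff h).1 hxT).2.1.not_gt hx.2.1
    exact ⟨⟨hx.1.1, hxT⟩, hx.1.2, hxT⟩
  rw [Set.compl_union, ← Set.sdiff_eq]
  refine isPreconnected_diff_of_subset hMc (isCompact_triangle u v p).isClosed
    (isOpen_sUnion fun V hV => hV.2.1)
    (Set.sUnion_subset fun V hV => hV.1.trans Set.inter_subset_left) ?_ hpre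
  rintro y ⟨hyM, hyT⟩
  obtain ⟨V, hsub, hVo, hVc, hpV, hyV⟩ :=
    exists_convex_nhds_of_mem_triangle hM h huv hinter hyT hyM
  exact ⟨V, ⟨hsub, hVo, hVc, hpV⟩, hyV⟩

theorem Fills.triangle (h : 0 < orient i u v p) : Fills (convexHull ℝ {u, v, p})
    (segment ℝ u v ∪ segment ℝ v p ∪ segment ℝ p u) where
  isCompact := isCompact_triangle u v p
  subset := by
    refine Set.union_subset (Set.union_subset ?_ ?_) ?_ <;>
      exact segment_subset_convexHull (by simp) (by simp)
  frontier_subset := frontier_triangle_subset h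
  isPreconnected_compl := isPreconnected_compl_triangle h

theorem Fills.union_triangle {D D' : Set Plane} (hM : Fills M D) (hp : 0 < orient i u v p)
    (hw : orient i u v w < 0) (hwM : convexHull ℝ {v, u, w} ⊆ M)
    (hinter : M ∩ convexHull ℝ {u, v, p} ⊆ segment ℝ u v)
    (hD : D ⊆ segment ℝ u v ∪ D') (hD' : D' ⊆ M ∪ convexHull ℝ {u, v, p})
    (hup : segment ℝ p u ⊆ D') (hvp : segment ℝ v p ⊆ D') :
    Fills (M ∪ convexHull ℝ {u, v, p}) D' where
  isCompact := hM.isCompact.union (isCompact_triangle u v p)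
  subset := hD'
  frontier_subset := by
    intro x hx
    by_contra hxD'
    have hxuv : x ∈ segment ℝ u v := by
      rcases frontier_union_subset _ _ hx with ⟨hxM, -⟩ | ⟨-, hxT⟩
      · exact (hD (hM.frontier_subset hxM)).resolve_right hxD'
      · rcases frontier_triangle_subset hp hxT with (hx' | hx') | hx'
        exacts [hx', absurd (hvp hx') hxD', absurd (hup hx') hxD']
    refine hx.2 (interior_mono (Set.union_subset Set.subset_union_right
      (hwM.trans Set.subset_union_left)) (mem_interior_union_triangles hp hw hxuv ?_ ?_))
    · rintro rfl
      exact hxD' (hup (right_mem_segment _ _ _))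
    · rintro rfl
      exact hxD' (hvp (left_mem_segment _ _ _))
  isPreconnected_compl := isPreconnected_compl_union_triangle hM.isCompact.isClosed
    hM.isPreconnected_compl hp ((segment_subset_convexHull (by simp) (by simp)).trans hwM) hinter

end Topology

section SimplicialComplex

open Geometry

variable {𝕜 E : Type*} [Field 𝕜] [LinearOrder 𝕜] [IsStrictOrderedRing 𝕜] [AddCommGroup E]
  [Module 𝕜 E] {K : SimplicialComplex 𝕜 E} {t : Finset E}

/-- The simplicial complex obtained from `K` by adding the simplex with vertex set `t` together with
all its faces. -/
def insertSimplex (K : SimplicialComplex 𝕜 E) (t : Finset E)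
    (ht : AffineIndependent 𝕜 ((↑) : t → E))
    (hglue : ∀ s ∈ K.faces, convexHull 𝕜 (s : Set E) ∩ convexHull 𝕜 t ⊆
      convexHull 𝕜 (s ∩ t : Set E)) : SimplicialComplex 𝕜 E :=
  have glue_faces : ∀ s ∈ K.faces, ∀ s' ⊆ t,
      convexHull 𝕜 (s : Set E) ∩ convexHull 𝕜 s' ⊆ convexHull 𝕜 (s ∩ s' : Set E) := by
    classical
    rintro s hs s' hs' x ⟨hxs, hxs'⟩
    have hxst := hglue s hs ⟨hxs, convexHull_mono hs' hxs'⟩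
    have hinter := ht.convexHull_inter (t₁ := s ∩ t) Finset.inter_subset_right hs'
    rw [Finset.coe_inter] at hinter
    exact convexHull_mono (Set.inter_subset_inter_left _ Set.inter_subset_left)
      (hinter.superset ⟨hxst, hxs'⟩)
  { faces := K.faces ∪ {s | s.Nonempty ∧ s ⊆ t}
    isRelLowerSet_faces := by
      rintro s (hs | ⟨hne, hs⟩)
      · exact ⟨K.nonempty_of_mem_faces hs, fun s' hle hne => Or.inl (K.down_closed hs hle hne)⟩
      · exact ⟨hne, fun s' hle hne' => Or.inr ⟨hne', hle.trans hs⟩⟩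
    indep := by
      rintro s (hs | ⟨-, hs⟩)
      exacts [K.indep hs, ht.mono (s := (s : Set E)) hs]
    inter_subset_convexHull := by
      rintro s s' (hs | ⟨-, hs⟩) (hs' | ⟨-, hs'⟩)
      · exact K.inter_subset_convexHull hs hs'
      · exact glue_faces s hs s' hs'
      · rw [Set.inter_comm, Set.inter_comm (s : Set E)]
        exact glue_faces s' hs' s hs
      · exact (ht.convexHull_inter hs hs').superset }

theorem space_insertSimplex (ht hglue) (hne : t.Nonempty) :
    (insertSimplex K t ht hglue).space = K.space ∪ convexHull 𝕜 t := by
  ext x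
  simp only [SimplicialComplex.mem_space_iff, Set.mem_union, insertSimplex, Set.mem_ofPred_eq]
  constructor
  · rintro ⟨s, hs | ⟨-, hs⟩, hx⟩
    exacts [Or.inl ⟨s, hs, hx⟩, Or.inr (convexHull_mono hs hx)]
  · rintro (⟨s, hs, hx⟩ | hx)
    exacts [⟨s, Or.inl hs, hx⟩, ⟨t, Or.inr ⟨hne, subset_rfl⟩, hx⟩]

theorem vertices_insertSimplex (ht hglue) :
    (insertSimplex K t ht hglue).vertices = K.vertices ∪ t := by
  ext x
  simp [SimplicialComplex.mem_vertices, insertSimplex]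

theorem exists_union_triangle {K : SimplicialComplex ℝ Plane} {i : Fin 2} {a b c : Plane}
    (h : orient i a b c ≠ 0)
    (hglue : ∀ s ∈ K.faces, convexHull ℝ (s : Set Plane) ∩ convexHull ℝ {a, b, c} ⊆
      convexHull ℝ (s ∩ {a, b, c} : Set Plane)) :
    ∃ K' : SimplicialComplex ℝ Plane,
      K'.faces = K.faces ∪ {s | s.Nonempty ∧ (s : Set Plane) ⊆ {a, b, c}} ∧
      K'.space = K.space ∪ convexHull ℝ {a, b, c} ∧ K'.vertices = K.vertices ∪ {a, b, c} := by
  classical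
  have hcoe : (({a, b, c} : Finset Plane) : Set Plane) = {a, b, c} := by simp
  have hindep : AffineIndependent ℝ ((↑) : ({a, b, c} : Finset Plane) → Plane) :=
    ((affineIndependent_iff_orient_ne_zero i a b c).2 h).range.mono (fun x hx => by
      simpa only [Matrix.range_cons, Matrix.range_empty, Set.union_empty, hcoe,
        Set.singleton_union] using hx)
  refine ⟨insertSimplex K {a, b, c} hindep (by rwa [hcoe]), ?_, ?_, ?_⟩
  · simp only [insertSimplex, ← Finset.coe_subset, hcoe]
  · rw [space_insertSimplex _ _ (by simp), hcoe]
  · rw [vertices_insertSimplex, hcoe]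

end SimplicialComplex

section PolygonTiling

open Geometry

variable {i : Fin 2} {u v p a b : Plane} {l l' t : List Plane} {D : Set (Sym2 Plane)}
  {K : SimplicialComplex ℝ Plane}

/-- The directed sides of the closed polyline with vertex list `l`, the last one leading back to the
head of `l`. -/
def sides (l : List Plane) : List (Plane × Plane) :=
  l.zip (l.rotate 1)

/-- A directed side without its endpoint, as in `Polygon.IsSimple`. -/
def halfOpenSide (e : Plane × Plane) : Set Plane :=
  segment ℝ e.1 e.2 \ {e.2}

/-- `K` triangulates the region bounded by the simple closed polyline with vertex list `l`, run
through in the positive direction for the orientation `i`, and all edges of `K` other than its sides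
belong to `D`. Here `D` is a set of admissible diagonals. -/
structure IsPolygonTiling (i : Fin 2) (D : Set (Sym2 Plane)) (l : List Plane)
    (K : SimplicialComplex ℝ Plane) : Prop where
  nodup : l.Nodup
  vertices_eq : K.vertices = {x | x ∈ l}
  edge : ∀ a b, a ≠ b → (∃ s ∈ K.faces, (s : Set Plane) = {a, b}) →
    (∃ e ∈ sides l, s(a, b) = s(e.1, e.2)) ∨ s(a, b) ∈ D
  exists_face : ∀ e ∈ sides l, ∃ s ∈ K.faces, ∃ w,
    (s : Set Plane) = {e.1, e.2, w} ∧ 0 < orient i e.1 e.2 w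
  pairwiseDisjoint : {e | e ∈ sides l}.PairwiseDisjoint halfOpenSide
  fills : Fills K.space (⋃ e ∈ sides l, segment ℝ e.1 e.2)

theorem sides_cons_cons (u v : Plane) (t : List Plane) :
    sides (u :: v :: t) = (u, v) :: (v :: t).zip (t ++ [u]) := by
  simp only [sides, List.rotate_cons_succ, List.rotate_zero, List.cons_append, List.zip_cons_cons]

theorem sides_rotate (l : List Plane) (n : ℕ) : sides (l.rotate n) = (sides l).rotate n := by
  rw [sides, sides, List.zip_eq_zipWith, List.zip_eq_zipWith,
    List.zipWith_rotate_distrib _ _ _ _ (by simp), List.rotate_rotate, List.rotate_rotate, add_comm]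

theorem mem_sides_iff {e : Plane × Plane} : e ∈ sides l ↔
    ∃ k : Fin l.length, e = (closedPolyline l k, closedPolyline l (finRotate _ k)) := by
  have getElem_rotate : ∀ k : Fin l.length, ∀ hk : (k : ℕ) < (l.rotate 1).length,
      (l.rotate 1)[(k : ℕ)] = closedPolyline l (finRotate _ k) := fun k hk => by
    have hval : (finRotate l.length k : ℕ) = (k + 1) % l.length := by
      have : NeZero l.length := ⟨k.pos.ne'⟩
      rw [finRotate_apply, Fin.val_add, Fin.val_one', Nat.add_mod_mod]
    simp only [List.getElem_rotate, ← hval]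
    rfl
  simp only [sides, List.mem_iff_getElem, List.getElem_zip, List.length_zip, List.length_rotate,
    min_self]
  constructor
  · rintro ⟨k, hk, rfl⟩
    exact ⟨⟨k, hk⟩, Prod.ext rfl (getElem_rotate ⟨k, hk⟩ (by simpa using hk))⟩
  · rintro ⟨k, rfl⟩
    exact ⟨k, k.2, Prod.ext rfl (getElem_rotate k (by simp))⟩

theorem sym2_eq_of_subset_triple {α : Type*} {x y a b c : α} (hxy : x ≠ y)
    (h : ({x, y} : Set α) ⊆ {a, b, c}) :
    s(x, y) = s(a, b) ∨ s(x, y) = s(b, c) ∨ s(x, y) = s(c, a) := by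
  simp only [Set.insert_subset_iff, Set.singleton_subset_iff, Set.mem_insert_iff,
    Set.mem_singleton_iff] at h
  obtain ⟨rfl | rfl | rfl, rfl | rfl | rfl⟩ := h <;> simp_all [Sym2.eq_swap]

theorem disjoint_halfOpenSide (h : orient i u v p ≠ 0) :
    Disjoint (halfOpenSide (u, v)) (halfOpenSide (v, p)) :=
  Set.disjoint_left.2 fun _ hx hx' => hx.2 (eq_of_mem_segments h hx.1 hx'.1)

theorem boundary_closedPolyline (l : List Plane) :
    (closedPolyline l).boundary ℝ = ⋃ e ∈ sides l, segment ℝ e.1 e.2 := by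
  ext x
  simp only [Polygon.boundary, Polygon.edgeSet, affineSegment_eq_segment, Set.mem_iUnion,
    mem_sides_iff, exists_prop]
  exact ⟨fun ⟨k, hk⟩ => ⟨_, ⟨k, rfl⟩, hk⟩, fun ⟨_, ⟨k, rfl⟩, hk⟩ => ⟨k, hk⟩⟩

namespace IsPolygonTiling

theorem isRotated (h : IsPolygonTiling i D l K) (hl : l ~r l') : IsPolygonTiling i D l' K := by
  obtain ⟨n, rfl⟩ := hl
  have hperm : (sides (l.rotate n)).Perm (sides l) := sides_rotate l n ▸ List.rotate_perm _ _
  have hmem : ∀ e, e ∈ sides (l.rotate n) ↔ e ∈ sides l := fun e => hperm.mem_iff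
  constructor
  · exact List.nodup_rotate.2 h.nodup
  · simpa only [List.mem_rotate] using h.vertices_eq
  · exact fun a b hab hf => (h.edge a b hab hf).imp_left fun ⟨e, he, hab⟩ => ⟨e, (hmem e).2 he, hab⟩
  · exact fun e he => h.exists_face e ((hmem e).1 he)
  · simpa only [hmem] using h.pairwiseDisjoint
  · simpa only [hmem] using h.fills

theorem segment_subset (h : IsPolygonTiling i D l K) {e : Plane × Plane} (he : e ∈ sides l) :
    segment ℝ e.1 e.2 ⊆ K.space :=
  (Set.subset_biUnion_of_mem (u := fun e : Plane × Plane => segment ℝ e.1 e.2) he).trans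
    h.fills.subset

theorem isSimple (h : IsPolygonTiling i D l K) : (closedPolyline l).IsSimple := by
  have ne_next : ∀ k, closedPolyline l k ≠ closedPolyline l (finRotate _ k) := fun k hk => by
    obtain ⟨-, -, w, -, hw⟩ := h.exists_face _ (mem_sides_iff.2 ⟨k, rfl⟩)
    simp only [← hk, orient_self, lt_irrefl] at hw
  have mem_side : ∀ k, ∀ s ∈ Set.Ico (0 : ℝ) 1, (closedPolyline l).edgePath ℝ k s ∈
      halfOpenSide (closedPolyline l k, closedPolyline l (finRotate _ k)) := by
    refine fun k s hs => ⟨?_, fun hend => ?_⟩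
    · rw [← affineSegment_eq_segment]
      exact ⟨s, ⟨hs.1, hs.2.le⟩, rfl⟩
    · exact (AffineMap.lineMap_eq_right_iff.1 hend).elim (ne_next k) hs.2.ne
  intro j k s hs t ht heq
  have hjk : j = k := by
    by_contra hne
    have hdisj := h.pairwiseDisjoint (mem_sides_iff.2 ⟨j, rfl⟩) (mem_sides_iff.2 ⟨k, rfl⟩)
      fun hpair => hne (List.nodup_iff_injective_get.1 h.nodup (Prod.ext_iff.1 hpair).1)
    exact Set.disjoint_left.1 hdisj (mem_side j s hs) (heq ▸ mem_side k t ht)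
  subst hjk
  exact ⟨rfl, AffineMap.lineMap_injective ℝ (ne_next j) heq⟩

theorem isTriangulation (h : IsPolygonTiling i D l K) : (closedPolyline l).IsTriangulation K := by
  refine ⟨?_, ?_⟩
  · rw [h.vertices_eq]
    exact Set.ext fun x => List.mem_iff_get
  · rw [Polygon.region, Polygon.inside, boundary_closedPolyline]
    exact h.fills.eq_union_bounded_components

theorem mem_of_isDiagonalOf (h : IsPolygonTiling i D l K)
    (hd : (closedPolyline l).IsDiagonalOf K a b) : s(a, b) ∈ D := by
  obtain ⟨hne, hface, hside⟩ := hd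
  refine (h.edge a b hne hface).resolve_left ?_
  rintro ⟨e, he, hab⟩
  obtain ⟨k, rfl⟩ := mem_sides_iff.1 he
  exact hside ⟨k, hab⟩

theorem exists_triangle (h : 0 < orient i a b p) :
    ∃ K, IsPolygonTiling i D [a, b, p] K ∧ K.space = convexHull ℝ {a, b, p} := by
  have hbpa : 0 < orient i b p a := by rwa [← orient_rotate]
  have hpab : 0 < orient i p a b := by rwa [← orient_rotate]
  have hab : a ≠ b := by rintro rfl; simp at h
  have hbp : b ≠ p := by rintro rfl; simp at h
  have hpa : p ≠ a := by rintro rfl; simp at h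
  have hsides : sides [a, b, p] = [(a, b), (b, p), (p, a)] := rfl
  obtain ⟨K, hfaces, hspace, hvertices⟩ :=
    exists_union_triangle (K := ⊥) h.ne' fun s hs => absurd hs (Set.notMem_empty s)
  have hbot : (⊥ : SimplicialComplex ℝ Plane).vertices = ∅ := rfl
  simp only [SimplicialComplex.faces_bot, SimplicialComplex.space_bot, Set.empty_union, hbot]
    at hfaces hspace hvertices
  refine ⟨K, ⟨by simp [hab, hbp, hpa.symm], by simp [hvertices, Set.ext_iff], ?_, ?_, ?_, ?_⟩,
    hspace⟩
  · rintro x y hxy ⟨s, hs, hsxy⟩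
    rw [hfaces] at hs
    simpa [hsides] using Or.inl (sym2_eq_of_subset_triple hxy (hsxy ▸ hs.2))
  · obtain ⟨s, hs⟩ : ∃ s ∈ K.faces, (s : Set Plane) = {a, b, p} := by
      classical
      exact ⟨{a, b, p}, by simp [hfaces], by simp⟩
    simp only [hsides, List.mem_cons, List.not_mem_nil, or_false, forall_eq_or_imp, forall_eq]
    exact ⟨⟨s, hs.1, p, hs.2, h⟩, ⟨s, hs.1, a, hs.2.trans (insert_pair_rotate a b p), hbpa⟩,
      ⟨s, hs.1, b, hs.2.trans (insert_pair_rotate p a b).symm, hpab⟩⟩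
  · have hab_bp := disjoint_halfOpenSide h.ne'
    have hbp_pa := disjoint_halfOpenSide hbpa.ne'
    have hpa_ab := disjoint_halfOpenSide hpab.ne'
    rintro e he e' he' hne
    simp only [hsides, List.mem_cons, List.not_mem_nil, or_false, Set.mem_ofPred_eq] at he he'
    rcases he with rfl | rfl | rfl <;> rcases he' with rfl | rfl | rfl <;>
      first | exact absurd rfl hne | assumption | exact Disjoint.symm (by assumption)
  · simpa [hsides, hspace, Set.union_assoc] using Fills.triangle h

end IsPolygonTiling

section InsertVertex

theorem eq_left_of_mem_segment_of_mem {M : Set Plane} (hp : 0 < orient i v u p)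
    (hinter : M ∩ convexHull ℝ {v, u, p} ⊆ segment ℝ v u) {x : Plane} (hx : x ∈ segment ℝ u p)
    (hxM : x ∈ M) : x = u :=
  eq_of_mem_segments hp.ne'
    (hinter ⟨hxM, insert_pair_rotate v u p ▸ segment_subset_triangle u p v hx⟩) hx

theorem eq_right_of_mem_segment_of_mem {M : Set Plane} (hp : 0 < orient i v u p)
    (hinter : M ∩ convexHull ℝ {v, u, p} ⊆ segment ℝ v u) {x : Plane} (hx : x ∈ segment ℝ p v)
    (hxM : x ∈ M) : x = v :=
  eq_of_mem_segments (i := i) (by rw [← orient_rotate, ← orient_rotate]; exact hp.ne') hx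
    (hinter ⟨hxM, insert_pair_rotate p v u ▸ segment_subset_triangle p v u hx⟩)

theorem convexHull_inter_triangle_subset {s : Finset Plane} (hs : s ∈ K.faces)
    (huv : ∃ f ∈ K.faces, (f : Set Plane) = {v, u})
    (hinter : K.space ∩ convexHull ℝ {v, u, p} ⊆ segment ℝ v u) :
    convexHull ℝ (s : Set Plane) ∩ convexHull ℝ {v, u, p} ⊆
      convexHull ℝ (s ∩ {v, u, p} : Set Plane) := by
  obtain ⟨f, hf, hfuv⟩ := huv
  rintro x ⟨hxs, hxp⟩
  have hxf : x ∈ convexHull ℝ (f : Set Plane) := by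
    rw [hfuv, convexHull_pair]
    exact hinter ⟨SimplicialComplex.convexHull_subset_space hs hxs, hxp⟩
  have hf_sub : (f : Set Plane) ⊆ {v, u, p} := by
    rw [hfuv]
    exact Set.insert_subset_insert (Set.singleton_subset_iff.2 (Set.mem_insert u {p}))
  exact convexHull_mono (Set.inter_subset_inter_right _ hf_sub)
    (K.inter_subset_convexHull hs hf ⟨hxs, hxf⟩)

theorem sides_insert (u p v : Plane) (t : List Plane) :
    sides (u :: p :: v :: t) = (u, p) :: (p, v) :: (v :: t).zip (t ++ [u]) := by
  rw [sides_cons_cons, List.cons_append, List.zip_cons_cons]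

namespace IsPolygonTiling

theorem exists_face_head (h : IsPolygonTiling i D (u :: v :: t) K) :
    ∃ w, 0 < orient i u v w ∧ convexHull ℝ {u, v, w} ⊆ K.space ∧
      ∃ f ∈ K.faces, (f : Set Plane) = {v, u} := by
  classical
  obtain ⟨s, hs, w, hsw, hw⟩ := h.exists_face (u, v) (by simp [sides_cons_cons])
  have hsub : ({v, u} : Finset Plane) ⊆ s := by
    rw [← Finset.coe_subset, hsw]
    simp [Set.insert_subset_iff]
  exact ⟨w, hw, hsw ▸ SimplicialComplex.convexHull_subset_space hs, {v, u},
    K.down_closed hs hsub (Finset.insert_nonempty _ _), by simp⟩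

theorem edge_insert {K' : SimplicialComplex ℝ Plane} (h : IsPolygonTiling i D (u :: v :: t) K)
    (hfaces : K'.faces = K.faces ∪ {s | s.Nonempty ∧ (s : Set Plane) ⊆ {v, u, p}})
    (hD : s(u, v) ∈ D) (hab : a ≠ b) (hf : ∃ s ∈ K'.faces, (s : Set Plane) = {a, b}) :
    (∃ e ∈ sides (u :: p :: v :: t), s(a, b) = s(e.1, e.2)) ∨ s(a, b) ∈ D := by
  obtain ⟨s, hs, hsab⟩ := hf
  simp only [sides_insert, List.mem_cons, exists_eq_or_imp]
  rw [hfaces] at hs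
  rcases hs with hs | ⟨-, hs⟩
  · rcases h.edge a b hab ⟨s, hs, hsab⟩ with ⟨e, he, heab⟩ | hmem
    · rw [sides_cons_cons, List.mem_cons] at he
      rcases he with rfl | he
      · exact Or.inr (heab ▸ hD)
      · exact Or.inl (Or.inr (Or.inr ⟨e, he, heab⟩))
    · exact Or.inr hmem
  · rcases sym2_eq_of_subset_triple hab (hsab ▸ hs) with heq | heq | heq
    · exact Or.inr (by rwa [heq, Sym2.eq_swap])
    · exact Or.inl (Or.inl heq)
    · exact Or.inl (Or.inr (Or.inl heq))

theorem pairwiseDisjoint_insert (h : IsPolygonTiling i D (u :: v :: t) K)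
    (hp : 0 < orient i v u p) (hinter : K.space ∩ convexHull ℝ {v, u, p} ⊆ segment ℝ v u) :
    {e | e ∈ sides (u :: p :: v :: t)}.PairwiseDisjoint halfOpenSide := by
  have head_notMem : ∀ e ∈ (v :: t).zip (t ++ [u]), e ≠ (u, v) := by
    rintro e he rfl
    exact (List.nodup_cons.1 h.nodup).1 (List.of_mem_zip he).1
  have hmem : ∀ e ∈ (v :: t).zip (t ++ [u]), e ∈ sides (u :: v :: t) := fun e he => by
    rw [sides_cons_cons]
    exact List.mem_cons_of_mem _ he
  have hset : {e | e ∈ sides (u :: p :: v :: t)} =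
      insert (u, p) (insert (p, v) {e | e ∈ (v :: t).zip (t ++ [u])}) := by
    ext e
    simp only [sides_insert, List.mem_cons, Set.mem_insert_iff, Set.mem_ofPred_eq]
  rw [hset]
  refine (Set.PairwiseDisjoint.insert ?_ fun e he _ => ?_).insert ?_
  · exact h.pairwiseDisjoint.subset hmem
  · refine Set.disjoint_left.2 fun x hx hxe => hx.2 ?_
    exact eq_right_of_mem_segment_of_mem hp hinter hx.1 (h.segment_subset (hmem e he) hxe.1)
  · rintro e (rfl | he) -
    · exact disjoint_halfOpenSide (i := i) (by rw [← orient_rotate]; exact hp.ne')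
    · refine Set.disjoint_left.2 fun x hx hxe => ?_
      obtain rfl := eq_left_of_mem_segment_of_mem hp hinter hx.1
        (h.segment_subset (hmem e he) hxe.1)
      have huv : x ≠ v := by rintro rfl; simp at hp
      exact Set.disjoint_left.1 (h.pairwiseDisjoint (hmem e he)
        (by simp [sides_cons_cons]) (head_notMem e he)) hxe ⟨left_mem_segment ℝ x v, huv⟩

theorem fills_insert (h : IsPolygonTiling i D (u :: v :: t) K)
    (hp : 0 < orient i v u p) (hinter : K.space ∩ convexHull ℝ {v, u, p} ⊆ segment ℝ v u) :
    Fills (K.space ∪ convexHull ℝ {v, u, p})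
      (⋃ e ∈ sides (u :: p :: v :: t), segment ℝ e.1 e.2) := by
  obtain ⟨w, hw, hwK, -⟩ := h.exists_face_head
  have hold : ⋃ e ∈ sides (u :: v :: t), segment ℝ e.1 e.2 =
      segment ℝ u v ∪ ⋃ e ∈ (v :: t).zip (t ++ [u]), segment ℝ e.1 e.2 := by
    simp only [sides_cons_cons, List.mem_cons, Set.iUnion_iUnion_eq_or_left]
  have hnew : ⋃ e ∈ sides (u :: p :: v :: t), segment ℝ e.1 e.2 =
      segment ℝ u p ∪ (segment ℝ p v ∪ ⋃ e ∈ (v :: t).zip (t ++ [u]), segment ℝ e.1 e.2) := by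
    simp only [sides_insert, List.mem_cons, Set.iUnion_iUnion_eq_or_left]
  have hup : segment ℝ u p ⊆ convexHull ℝ {v, u, p} := by
    rw [insert_pair_rotate]
    exact segment_subset_triangle u p v
  have hpv : segment ℝ p v ⊆ convexHull ℝ {v, u, p} := by
    rw [← insert_pair_rotate]
    exact segment_subset_triangle p v u
  rw [hnew]
  refine h.fills.union_triangle hp (w := w) ?_ hwK hinter ?_ ?_ ?_ ?_
  · rw [orient_swap]
    exact neg_neg_of_pos hw
  · rw [hold, segment_symm]
    exact Set.union_subset_union_right _ (Set.subset_union_right.trans Set.subset_union_right)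
  · refine Set.union_subset (hup.trans Set.subset_union_right) (Set.union_subset
      (hpv.trans Set.subset_union_right) (Set.Subset.trans ?_ Set.subset_union_left))
    exact (Set.subset_union_right.trans hold.superset).trans h.fills.subset
  · exact Set.subset_union_left.trans Set.subset_union_right
  · exact Set.subset_union_left

theorem exists_face_insert {K' : SimplicialComplex ℝ Plane}
    (h : IsPolygonTiling i D (u :: v :: t) K) (hp : 0 < orient i v u p)
    (hfaces : K'.faces = K.faces ∪ {s | s.Nonempty ∧ (s : Set Plane) ⊆ {v, u, p}}) :
    ∀ e ∈ sides (u :: p :: v :: t), ∃ s ∈ K'.faces, ∃ w,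
      (s : Set Plane) = {e.1, e.2, w} ∧ 0 < orient i e.1 e.2 w := by
  obtain ⟨s, hs, hsT⟩ : ∃ s ∈ K'.faces, (s : Set Plane) = {v, u, p} := by
    classical
    exact ⟨{v, u, p}, by simp [hfaces], by simp⟩
  simp only [sides_insert, List.mem_cons, forall_eq_or_imp]
  refine ⟨⟨s, hs, v, ?_, ?_⟩, ⟨s, hs, u, ?_, ?_⟩, fun e he => ?_⟩
  · rw [hsT, insert_pair_rotate]
  · rwa [← orient_rotate]
  · rw [hsT, ← insert_pair_rotate]
  · rwa [orient_rotate]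
  · obtain ⟨f, hf, hface⟩ := h.exists_face e (by simp [sides_cons_cons, he])
    exact ⟨f, hfaces ▸ Or.inl hf, hface⟩

theorem exists_insert_vertex (h : IsPolygonTiling i D (u :: v :: t) K)
    (hp : 0 < orient i v u p) (hinter : K.space ∩ convexHull ℝ {v, u, p} ⊆ segment ℝ v u)
    (hD : s(u, v) ∈ D) :
    ∃ K', IsPolygonTiling i D (u :: p :: v :: t) K' ∧
      K'.space = K.space ∪ convexHull ℝ {v, u, p} := by
  obtain ⟨-, -, -, hedge⟩ := h.exists_face_head
  obtain ⟨K', hfaces, hspace, hvertices⟩ := exists_union_triangle hp.ne' fun s hs =>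
    convexHull_inter_triangle_subset hs hedge hinter
  have hpK : p ∉ K.space := fun hpK => by
    have := eq_left_of_mem_segment_of_mem hp hinter (right_mem_segment ℝ u p) hpK
    simp [this] at hp
  have hpl : p ∉ u :: v :: t := fun hpl =>
    hpK (SimplicialComplex.vertices_subset_space (h.vertices_eq ▸ hpl))
  refine ⟨K', ⟨?_, ?_, fun a b => h.edge_insert hfaces hD, h.exists_face_insert hp hfaces,
    h.pairwiseDisjoint_insert hp hinter, hspace ▸ h.fills_insert hp hinter⟩, hspace⟩
  · exact (List.Perm.swap u p (v :: t)).nodup_iff.1 (List.nodup_cons.2 ⟨hpl, h.nodup⟩)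
  · rw [hvertices, h.vertices_eq]
    ext x
    simp only [Set.mem_union, Set.mem_ofPred_eq, List.mem_cons, Set.mem_insert_iff,
      Set.mem_singleton_iff]
    tauto

end IsPolygonTiling

end InsertVertex

end PolygonTiling

section GeneralPosition

variable {S T : Set Plane} {a b c : Plane}

theorem InGeneralPosition.mono (hT : InGeneralPosition T) (hST : S ⊆ T) : InGeneralPosition S :=
  fun p hp q hq r hr => hT p (hST hp) q (hST hq) r (hST hr)

theorem InGeneralPosition.orient_ne_zero (hS : InGeneralPosition S) (i : Fin 2) (ha : a ∈ S)
    (hb : b ∈ S) (hc : c ∈ S) (hab : a ≠ b) (hbc : b ≠ c) (hac : a ≠ c) : orient i a b c ≠ 0 :=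
  fun h => hS a ha b hb c hc hab hbc hac ((collinear_iff_orient_eq_zero i a b c).2 h)

end GeneralPosition

section FirstHit

variable {i : Fin 2} {q r : Plane} {W : Finset Plane}

theorem exists_first_hit_left (hW : W.Nonempty) (hpos : ∀ s ∈ W, 0 < orient i q r s)
    (hgen : InGeneralPosition (insert q W)) : ∃ p ∈ W, ∀ s ∈ W, s ≠ p → 0 < orient i q p s := by
  have ne_left : ∀ s ∈ W, q ≠ s := by
    rintro s hs rfl
    simpa using hpos q hs
  obtain ⟨e, he⟩ := hW
  obtain ⟨p, hp, hmin⟩ := W.exists_min_image (fun s => orient i q e s / orient i q r s) ⟨e, he⟩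
  refine ⟨p, hp, fun s hs hsp => lt_of_le_of_ne ?_ (hgen.orient_ne_zero i (Or.inl rfl)
    (Or.inr hp) (Or.inr hs) (ne_left p hp) hsp.symm (ne_left s hs)).symm⟩
  have hle := hmin s hs
  rw [div_le_div_iff₀ (hpos p hp) (hpos s hs)] at hle
  have hplucker := orient_plucker i q e r s p
  rw [orient_swap_right i q s p, orient_swap_right i q s e, orient_swap_right i q e r] at hplucker
  exact nonneg_of_mul_nonneg_left (b := orient i q r e) (by linarith) (hpos e he)

theorem exists_first_hit_right (hW : W.Nonempty) (hpos : ∀ s ∈ W, 0 < orient i q r s)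
    (hgen : InGeneralPosition (insert r W)) : ∃ p ∈ W, ∀ s ∈ W, s ≠ p → 0 < orient i p r s := by
  have reflect : ∀ x s, orient (i + 1) r x s = orient i x r s := fun x s => by
    rw [orient_add_one, ← orient_swap]
  simpa only [reflect] using exists_first_hit_left (i := i + 1) (q := r) (r := q) hW
    (fun s hs => (reflect q s).symm ▸ hpos s hs) hgen

end FirstHit

section Strip

open Geometry

variable {i : Fin 2} {F Q p q r : Plane} {t : List Plane} {W : Finset Plane} {D : Set (Sym2 Plane)}
  {K : SimplicialComplex ℝ Plane}

/-- The points of `W` and the apex `Q` lie beyond the edge `q r`, and the line `F Q` separates them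
into a group on the side of `q` and a group on the side of `r`, such that every triangle formed by
the apex and one point of each group has the same orientation. Such points can be attached to the
edge by triangles whose sides each join the two groups or two consecutive points around `Q`. -/
structure IsStrip (i : Fin 2) (F Q q r : Plane) (W : Finset Plane) : Prop where
  beyond : ∀ s ∈ insert Q W, 0 < orient i q r s
  left_pos : 0 < orient i F Q q
  right_neg : orient i F Q r < 0
  side_ne_zero : ∀ s ∈ W, orient i F Q s ≠ 0
  apex : ∀ x ∈ insert q W, ∀ z ∈ insert r W, 0 < orient i F Q x → orient i F Q z < 0 →
    0 < orient i x z Q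
  general : InGeneralPosition ({q, r, Q} ∪ W)

namespace IsStrip

theorem apex_notMem (h : IsStrip i F Q q r W) : Q ∉ W := fun hQ =>
  h.side_ne_zero Q hQ (by simp)

theorem erase_right (h : IsStrip i F Q q r W) (hp : p ∈ W) (hpF : orient i F Q p < 0)
    (hit : ∀ s ∈ insert Q W, s ≠ p → 0 < orient i q p s) : IsStrip i F Q q p (W.erase p) where
  beyond s hs := by
    have hQp : Q ≠ p := fun hQp => h.apex_notMem (hQp ▸ hp)
    rw [← Finset.erase_insert_of_ne hQp] at hs
    exact hit s (Finset.mem_of_mem_erase hs) (Finset.ne_of_mem_erase hs)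
  left_pos := h.left_pos
  right_neg := hpF
  side_ne_zero s hs := h.side_ne_zero s (Finset.mem_of_mem_erase hs)
  apex x hx z hz := by
    rw [Finset.insert_erase hp] at hz
    exact h.apex x (Finset.insert_subset_insert q (Finset.erase_subset p W) hx) z
      (Finset.mem_insert_of_mem hz)
  general := h.general.mono <| by
    rintro s ((rfl | rfl | rfl) | hs)
    exacts [by simp, Or.inr hp, by simp, Or.inr (Finset.mem_of_mem_erase hs)]

theorem erase_left (h : IsStrip i F Q q r W) (hp : p ∈ W) (hpF : 0 < orient i F Q p)
    (hit : ∀ s ∈ insert Q W, s ≠ p → 0 < orient i p r s) : IsStrip i F Q p r (W.erase p) where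
  beyond s hs := by
    have hQp : Q ≠ p := fun hQp => h.apex_notMem (hQp ▸ hp)
    rw [← Finset.erase_insert_of_ne hQp] at hs
    exact hit s (Finset.mem_of_mem_erase hs) (Finset.ne_of_mem_erase hs)
  left_pos := hpF
  right_neg := h.right_neg
  side_ne_zero s hs := h.side_ne_zero s (Finset.mem_of_mem_erase hs)
  apex x hx z hz := by
    rw [Finset.insert_erase hp] at hx
    exact h.apex x (Finset.mem_insert_of_mem hx) z
      (Finset.insert_subset_insert r (Finset.erase_subset p W) hz)
  general := h.general.mono <| by
    rintro s ((rfl | rfl | rfl) | hs)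
    exacts [Or.inr hp, by simp, by simp, Or.inr (Finset.mem_of_mem_erase hs)]

theorem pos_of_hit_apex (h : IsStrip i F Q q r W) (hit : ∀ s ∈ W, 0 < orient i q Q s) {s : Plane}
    (hs : s ∈ W) : 0 < orient i F Q s := by
  by_contra! hsF
  have hapex := h.apex q (Finset.mem_insert_self q W) s (Finset.mem_insert_of_mem hs) h.left_pos
    (hsF.lt_of_ne (h.side_ne_zero s hs))
  rw [orient_swap_right] at hapex
  linarith [hit s hs]

theorem neg_of_hit_apex (h : IsStrip i F Q q r W) (hit : ∀ s ∈ W, 0 < orient i Q r s) {s : Plane}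
    (hs : s ∈ W) : orient i F Q s < 0 := by
  by_contra! hsF
  have hapex := h.apex s (Finset.mem_insert_of_mem hs) r (Finset.mem_insert_self r W)
    (hsF.lt_of_ne (h.side_ne_zero s hs).symm) h.right_neg
  rw [← orient_rotate, orient_swap_right] at hapex
  linarith [hit s hs]

theorem not_hits_cross {p' : Plane} (h : IsStrip i F Q q r W) (hp : p ∈ W) (hp' : p' ∈ W)
    (hpF : 0 < orient i F Q p) (hpF' : orient i F Q p' < 0) (hit : 0 < orient i q p p')
    (hit' : 0 < orient i p' r p) : False := by
  have hqrp := h.beyond p (Finset.mem_insert_of_mem hp)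
  have hqrp' := h.beyond p' (Finset.mem_insert_of_mem hp')
  obtain ⟨x, hx, hx'⟩ := exists_mem_segments_of_crossing hit
    (by rw [orient_swap_right]; linarith)
    (by rw [← orient_rotate, orient_swap_right]; linarith) hit'.le
  have hxF := (convex_orient_pos i F Q).segment_subset h.left_pos hpF hx
  have hxF' := (convex_orient_neg i F Q).segment_subset hpF' h.right_neg hx'
  exact lt_asymm (a := (0 : ℝ)) hxF hxF'

theorem exists_hit (h : IsStrip i F Q q r W) (hW : W.Nonempty) :
    (∃ p ∈ W, orient i F Q p < 0 ∧ ∀ s ∈ insert Q W, s ≠ p → 0 < orient i q p s) ∨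
      ∃ p ∈ W, 0 < orient i F Q p ∧ ∀ s ∈ insert Q W, s ≠ p → 0 < orient i p r s := by
  have hsub : ∀ e, e = q ∨ e = r →
      (insert e ↑(insert Q W) : Set Plane) ⊆ {q, r, Q} ∪ W := by
    rw [Finset.coe_insert]
    rintro e (rfl | rfl) s (rfl | rfl | hs) <;> simp_all
  obtain ⟨p, hp, hit⟩ := exists_first_hit_left (Finset.insert_nonempty Q W) h.beyond
    (h.general.mono (hsub q (Or.inl rfl)))
  obtain ⟨p', hp', hit'⟩ := exists_first_hit_right (Finset.insert_nonempty Q W) h.beyond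
    (h.general.mono (hsub r (Or.inr rfl)))
  have ne_apex : ∀ s ∈ W, s ≠ Q := fun s hs hsQ => h.apex_notMem (hsQ ▸ hs)
  have pos_of_eq : p = Q → ∀ s ∈ W, 0 < orient i F Q s := fun hpQ s hs =>
    h.pos_of_hit_apex (fun s hs => hpQ ▸ hit s (Finset.mem_insert_of_mem hs)
      (hpQ ▸ ne_apex s hs)) hs
  have neg_of_eq : p' = Q → ∀ s ∈ W, orient i F Q s < 0 := fun hpQ s hs =>
    h.neg_of_hit_apex (fun s hs => hpQ ▸ hit' s (Finset.mem_insert_of_mem hs)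
      (hpQ ▸ ne_apex s hs)) hs
  obtain ⟨s, hs⟩ := hW
  by_contra! hnot
  have hp_pos : p ≠ Q → p ∈ W ∧ 0 < orient i F Q p := fun hpQ => by
    have hpW := (Finset.mem_insert.1 hp).resolve_left hpQ
    refine ⟨hpW, lt_of_not_ge fun hpF => ?_⟩
    obtain ⟨s, hs, hsp, hle⟩ := hnot.1 p hpW (hpF.lt_of_ne (h.side_ne_zero p hpW))
    exact hle.not_gt (hit s hs hsp)
  have hp'_neg : p' ≠ Q → p' ∈ W ∧ orient i F Q p' < 0 := fun hpQ => by
    have hpW := (Finset.mem_insert.1 hp').resolve_left hpQ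
    refine ⟨hpW, lt_of_not_ge fun hpF => ?_⟩
    obtain ⟨s, hs, hsp, hle⟩ := hnot.2 p' hpW (hpF.lt_of_ne (h.side_ne_zero p' hpW).symm)
    exact hle.not_gt (hit' s hs hsp)
  by_cases hpQ : p = Q <;> by_cases hpQ' : p' = Q
  · exact lt_asymm (pos_of_eq hpQ s hs) (neg_of_eq hpQ' s hs)
  · exact lt_asymm (pos_of_eq hpQ p' (hp'_neg hpQ').1) (hp'_neg hpQ').2
  · exact lt_asymm (hp_pos hpQ).2 (neg_of_eq hpQ' p (hp_pos hpQ).1)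
  · obtain ⟨hpW, hpF⟩ := hp_pos hpQ
    obtain ⟨hpW', hpF'⟩ := hp'_neg hpQ'
    have hne : p ≠ p' := by rintro rfl; exact lt_asymm hpF hpF'
    exact h.not_hits_cross hpW hpW' hpF hpF' (hit p' hp' hne.symm) (hit' p hp hne)

end IsStrip

theorem union_triangle_inter_convexHull_subset {M G G' : Set Plane} {q' r' : Plane}
    (hinter : M ∩ convexHull ℝ G ⊆ segment ℝ q r) (hG : G' ⊆ G)
    (hT : ∀ z ∈ ({q, r, p} : Set Plane), orient i q' r' z ≤ 0)
    (hG' : ∀ z ∈ G', z ≠ q' → z ≠ r' → 0 < orient i q' r' z) :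
    (M ∪ convexHull ℝ {q, r, p}) ∩ convexHull ℝ G' ⊆ segment ℝ q' r' := by
  rintro x ⟨hx, hxG⟩
  refine mem_of_mem_convexHull_of_orient_nonpos (i := i) (a := q') (b := r')
    (convex_segment q' r') (fun z hz => orient_eq_zero_of_mem_segment hz) ?_ hxG ?_
  · intro z hz
    by_cases hzq : z = q'
    · exact Or.inr (hzq ▸ left_mem_segment ℝ q' r')
    by_cases hzr : z = r'
    · exact Or.inr (hzr ▸ right_mem_segment ℝ q' r')
    exact Or.inl (hG' z hz hzq hzr)
  · refine orient_nonpos_of_mem_convexHull hT (hx.elim (fun hxM => ?_) id)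
    exact segment_subset_triangle q r p (hinter ⟨hxM, convexHull_mono hG hxG⟩)

namespace IsStrip

theorem exists_insert_vertex (h : IsStrip i F Q q r W)
    (hK : IsPolygonTiling i D (r :: q :: t) K) (hD : s(q, r) ∈ D)
    (hinter : K.space ∩ convexHull ℝ ({q, r, Q} ∪ W) ⊆ segment ℝ q r) (hp : p ∈ insert Q W) :
    ∃ K', IsPolygonTiling i D (r :: p :: q :: t) K' ∧
      K'.space = K.space ∪ convexHull ℝ {q, r, p} ∧
      convexHull ℝ {q, r, p} ⊆ convexHull ℝ ({q, r, Q} ∪ W) := by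
  have hsub : ({q, r, p} : Set Plane) ⊆ {q, r, Q} ∪ W := by
    rintro s (rfl | rfl | rfl)
    exacts [by simp, by simp, (Finset.mem_insert.1 hp).elim (fun hs => by simp [hs]) Or.inr]
  obtain ⟨K', hK', hspace⟩ := hK.exists_insert_vertex (h.beyond p hp)
    (fun x hx => hinter ⟨hx.1, convexHull_mono hsub hx.2⟩) (by rwa [Sym2.eq_swap])
  exact ⟨K', hK', hspace, convexHull_mono hsub⟩

theorem union_erase_subset {q' r' : Plane} (hq' : q' ∈ ({q, r, Q} ∪ W : Set Plane))
    (hr' : r' ∈ ({q, r, Q} ∪ W : Set Plane)) :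
    {q', r', Q} ∪ ((W.erase p : Finset Plane) : Set Plane) ⊆ {q, r, Q} ∪ W := by
  rintro s ((rfl | rfl | rfl) | hs)
  exacts [hq', hr', by simp, Or.inr (Finset.mem_of_mem_erase hs)]

theorem inter_erase_right_subset {M : Set Plane} (h : IsStrip i F Q q r W) (hp : p ∈ W)
    (hit : ∀ s ∈ insert Q W, s ≠ p → 0 < orient i q p s)
    (hinter : M ∩ convexHull ℝ ({q, r, Q} ∪ W) ⊆ segment ℝ q r) :
    (M ∪ convexHull ℝ {q, r, p}) ∩ convexHull ℝ ({q, p, Q} ∪ ((W.erase p : Finset Plane) : Set _))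
      ⊆ segment ℝ q p := by
  have hr : orient i q p r ≤ 0 := by
    rw [orient_swap_right]
    linarith [h.beyond p (Finset.mem_insert_of_mem hp)]
  refine union_triangle_inter_convexHull_subset (i := i) hinter
    (union_erase_subset (by simp) (Or.inr hp)) ?_ ?_
  · rintro z (rfl | rfl | rfl)
    exacts [by simp, hr, by simp]
  · rintro s ((rfl | rfl | rfl) | hs) hsq hsp
    exacts [absurd rfl hsq, absurd rfl hsp, hit s (by simp) hsp,
      hit s (Finset.mem_insert_of_mem (Finset.mem_of_mem_erase hs)) hsp]

theorem inter_erase_left_subset {M : Set Plane} (h : IsStrip i F Q q r W) (hp : p ∈ W)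
    (hit : ∀ s ∈ insert Q W, s ≠ p → 0 < orient i p r s)
    (hinter : M ∩ convexHull ℝ ({q, r, Q} ∪ W) ⊆ segment ℝ q r) :
    (M ∪ convexHull ℝ {q, r, p}) ∩ convexHull ℝ ({p, r, Q} ∪ ((W.erase p : Finset Plane) : Set _))
      ⊆ segment ℝ p r := by
  have hq : orient i p r q ≤ 0 := by
    rw [orient_rotate, orient_swap]
    linarith [h.beyond p (Finset.mem_insert_of_mem hp), orient_rotate i r q p]
  refine union_triangle_inter_convexHull_subset (i := i) hinter
    (union_erase_subset (Or.inr hp) (by simp)) ?_ ?_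
  · rintro z (rfl | rfl | rfl)
    exacts [hq, by simp, by simp]
  · rintro s ((rfl | rfl | rfl) | hs) hsp hsr
    exacts [absurd rfl hsp, absurd rfl hsr, hit s (by simp) hsp,
      hit s (Finset.mem_insert_of_mem (Finset.mem_of_mem_erase hs)) hsp]

theorem exists_tiling (h : IsStrip i F Q q r W) (hK : IsPolygonTiling i D (r :: q :: t) K)
    (hD : ∀ x ∈ insert q W, ∀ z ∈ insert r W, 0 < orient i F Q x → orient i F Q z < 0 →
      s(x, z) ∈ D)
    (hinter : K.space ∩ convexHull ℝ ({q, r, Q} ∪ W) ⊆ segment ℝ q r) :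
    ∃ v u K', (∀ x, x ∈ v ↔ x ∈ W ∧ orient i F Q x < 0) ∧
      (∀ x, x ∈ u ↔ x ∈ W ∧ 0 < orient i F Q x) ∧
      IsPolygonTiling i D (r :: v ++ Q :: u ++ q :: t) K' ∧
      K'.space ⊆ K.space ∪ convexHull ℝ ({q, r, Q} ∪ W) := by
  induction W using Finset.strongInduction generalizing q r t K with
  | H W ih => ?_
  have insert_vertex := fun p => h.exists_insert_vertex (p := p) hK
    (hD q (Finset.mem_insert_self q W) r (Finset.mem_insert_self r W) h.left_pos h.right_neg) hinter
  rcases W.eq_empty_or_nonempty with rfl | hW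
  · obtain ⟨K', hK', hspace, hT⟩ := insert_vertex Q (Finset.mem_insert_self Q ∅)
    exact ⟨[], [], K', by simp, by simp, hK', hspace ▸ Set.union_subset_union_right _ hT⟩
  rcases h.exists_hit hW with ⟨p, hp, hpF, hit⟩ | ⟨p, hp, hpF, hit⟩
  all_goals
    obtain ⟨K₁, hK₁, hspace₁, hT⟩ := insert_vertex p (Finset.mem_insert_of_mem hp)
    have hK₁_sub := hspace₁ ▸ Set.union_subset_union_right K.space hT
  · obtain ⟨v, u, K', hv, hu, hK', hspace⟩ := ih (W.erase p) (Finset.erase_ssubset hp)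
      (h.erase_right hp hpF hit) (hK₁.isRotated ⟨1, rfl⟩)
      (fun x hx z hz => hD x (Finset.insert_subset_insert q (Finset.erase_subset p W) hx) z
        (Finset.mem_insert_of_mem (Finset.insert_erase hp ▸ hz)))
      (hspace₁ ▸ h.inter_erase_right_subset hp hit hinter)
    refine ⟨p :: v, u, K', fun x => ?_, fun x => ?_, hK'.isRotated ?_, hspace.trans ?_⟩
    · by_cases hx : x = p <;> simp [hx, hv, hp, hpF]
    · by_cases hx : x = p <;> simp [hx, hu, hpF.le]
    · simpa using List.isRotated_append (l := p :: v ++ Q :: u ++ q :: t) (l' := [r])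
    · exact Set.union_subset hK₁_sub ((convexHull_mono (union_erase_subset (by simp)
        (Or.inr hp))).trans Set.subset_union_right)
  · obtain ⟨v, u, K', hv, hu, hK', hspace⟩ := ih (W.erase p) (Finset.erase_ssubset hp)
      (h.erase_left hp hpF hit) hK₁
      (fun x hx z hz => hD x (Finset.mem_insert_of_mem (Finset.insert_erase hp ▸ hx)) z
        (Finset.insert_subset_insert r (Finset.erase_subset p W) hz))
      (hspace₁ ▸ h.inter_erase_left_subset hp hit hinter)
    refine ⟨v, u ++ [p], K', fun x => ?_, fun x => ?_, by simpa using hK', hspace.trans ?_⟩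
    · by_cases hx : x = p <;> simp [hx, hv, hpF.le]
    · by_cases hx : x = p <;> simp [hx, hu, hp, hpF]
    · exact Set.union_subset hK₁_sub ((convexHull_mono (union_erase_subset (Or.inr hp)
        (by simp))).trans Set.subset_union_right)

end IsStrip

end Strip

section Identities

theorem orient_affine (i : Fin 2) (g h a b c d : Plane) :
    orient i g h d * orient i a b c = orient i b c d * orient i g h a +
      orient i c a d * orient i g h b + orient i a b d * orient i g h c := by
  unfold orient; ring

theorem orient_three_lines (i : Fin 2) (F b c s w : Plane) :
    orient i w b s * orient i F c w =
      orient i w b c * orient i F s w + orient i F w b * orient i c w s := by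
  unfold orient; ring

end Identities

/-- The point `s` lies in the interior of the positively oriented triangle `F P Q`. -/
structure IsInside (i : Fin 2) (F P Q s : Plane) : Prop where
  left : 0 < orient i F P s
  right : 0 < orient i F s Q
  side : 0 < orient i P Q s

theorem IsInside.reflect {i : Fin 2} {F P Q s : Plane} (h : IsInside i F P Q s) :
    IsInside (i + 1) F Q P s where
  left := by rw [orient_add_one, ← orient_swap_right]; exact h.right
  right := by rw [orient_add_one, ← orient_swap_right]; exact h.left
  side := by rw [orient_add_one, ← orient_swap]; exact h.side

/-- The points `A`, `B`, `C` in the subtriangles `F Y Z`, `F Z X`, `F X Y` of a positively oriented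
triangle `X Y Z` with interior point `F`. Each group is named after the vertex it is opposite to. -/
structure TriangleConfig (i : Fin 2) (F X Y Z : Plane) (A B C : Finset Plane) : Prop where
  pos_XY : 0 < orient i F X Y
  pos_YZ : 0 < orient i F Y Z
  pos_ZX : 0 < orient i F Z X
  inside_A : ∀ s ∈ A, IsInside i F Y Z s
  inside_B : ∀ s ∈ B, IsInside i F Z X s
  inside_C : ∀ s ∈ C, IsInside i F X Y s
  general : InGeneralPosition ({F, X, Y, Z} ∪ (A ∪ B ∪ C))

namespace TriangleConfig

variable {i : Fin 2} {F X Y Z b c s : Plane} {A B C : Finset Plane}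

theorem rotate (h : TriangleConfig i F X Y Z A B C) : TriangleConfig i F Y Z X B C A where
  pos_XY := h.pos_YZ
  pos_YZ := h.pos_ZX
  pos_ZX := h.pos_XY
  inside_A := h.inside_B
  inside_B := h.inside_C
  inside_C := h.inside_A
  general := h.general.mono <| by
    rintro s ((rfl | rfl | rfl | rfl) | ((hs | hs) | hs)) <;> simp [*]

theorem reflect (h : TriangleConfig i F X Y Z A B C) : TriangleConfig (i + 1) F X Z Y A C B where
  pos_XY := by rw [orient_add_one, ← orient_swap_right]; exact h.pos_ZX
  pos_YZ := by rw [orient_add_one, ← orient_swap_right]; exact h.pos_YZ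
  pos_ZX := by rw [orient_add_one, ← orient_swap_right]; exact h.pos_XY
  inside_A s hs := (h.inside_A s hs).reflect
  inside_B s hs := (h.inside_C s hs).reflect
  inside_C s hs := (h.inside_B s hs).reflect
  general := h.general.mono <| by
    rintro s ((rfl | rfl | rfl | rfl) | ((hs | hs) | hs)) <;> simp [*]

theorem X_left (h : TriangleConfig i F X Y Z A B C) (hc : c ∈ insert Y C) : 0 < orient i F X c := by
  rcases Finset.mem_insert.1 hc with rfl | hc
  exacts [h.pos_XY, (h.inside_C c hc).left]

theorem right_Y (h : TriangleConfig i F X Y Z A B C) (hc : c ∈ insert Y C) :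
    0 ≤ orient i F c Y := by
  rcases Finset.mem_insert.1 hc with rfl | hc
  exacts [(orient_right i F c).ge, (h.inside_C c hc).right.le]

theorem right_X (h : TriangleConfig i F X Y Z A B C) (hb : b ∈ insert Z B) :
    0 < orient i F b X := by
  rw [orient_swap_right, ← orient_add_one]
  exact h.reflect.X_left hb

theorem Z_left (h : TriangleConfig i F X Y Z A B C) (hb : b ∈ insert Z B) :
    0 ≤ orient i F Z b := by
  rw [orient_swap_right, ← orient_add_one]
  exact h.reflect.right_Y hb

theorem notMem_C_of_mem_A (h : TriangleConfig i F X Y Z A B C) (hs : s ∈ A) : s ∉ insert Y C :=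
  fun hsC => by
    have hY := h.right_Y hsC
    rw [orient_swap_right] at hY
    linarith [(h.inside_A s hs).left]

theorem notMem_B_of_mem_A (h : TriangleConfig i F X Y Z A B C) (hs : s ∈ A) : s ∉ insert Z B :=
  h.reflect.notMem_C_of_mem_A hs

theorem notMem_C_of_mem_B (h : TriangleConfig i F X Y Z A B C) (hs : s ∈ insert Z B) :
    s ∉ insert Y C := fun hsC => by
  have hX := h.X_left hsC
  rw [orient_swap_right] at hX
  linarith [h.right_X hs]

theorem orient_corner (h : TriangleConfig i F X Y Z A B C) (hc : c ∈ insert Y C)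
    (hb : b ∈ insert Z B) : 0 < orient i X c b := by
  have hXYZ : 0 < orient i X Y Z := by
    have := orient_add_orient_add_orient i X Y Z F
    linarith [h.pos_XY, h.pos_YZ, h.pos_ZX]
  have hXYc : 0 ≤ orient i X Y c := by
    rcases Finset.mem_insert.1 hc with rfl | hc
    exacts [(orient_right i X c).ge, (h.inside_C c hc).side.le]
  have hXbZ : 0 ≤ orient i X b Z := by
    rcases Finset.mem_insert.1 hb with rfl | hb
    exacts [(orient_right i X b).ge, by simpa only [orient_rotate i Z X] using
      (h.inside_B b hb).side.le]
  have hXFZ : 0 < orient i X F Z := by rw [orient_rotate]; exact h.pos_ZX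
  have hXcF : 0 < orient i X c F := by rw [← orient_rotate]; exact h.X_left hc
  have hXFb : 0 < orient i X F b := by rw [orient_rotate]; exact h.right_X hb
  have hXcZ : 0 < orient i X c Z := by
    have plucker := orient_plucker i X Y F Z c
    rw [orient_swap_right i X F c, orient_swap_right i X Z Y, orient_swap_right i X Z c] at plucker
    rw [← orient_rotate i F X Y] at plucker
    by_contra hcon
    nlinarith [mul_pos hXcF hXYZ, mul_nonneg hXYc hXFZ.le, h.pos_XY]
  have plucker := orient_plucker i X c F Z b
  rw [orient_swap_right i X Z b, orient_swap_right i X Z c] at plucker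
  by_contra hcon
  nlinarith [mul_pos hXcZ hXFb, mul_nonneg hXcF.le hXbZ]

end TriangleConfig

/-- A segment from a point of `C ∪ {Y}` to a point of `B ∪ {Z}` that separates `A` from `F`. -/
structure IsFront (i : Fin 2) (F Y Z : Plane) (A B C : Finset Plane) (c b : Plane) : Prop where
  mem_c : c ∈ insert Y C
  mem_b : b ∈ insert Z B
  pos : 0 < orient i F c b
  beyond : ∀ s ∈ A, orient i c b s < 0

namespace IsFront

variable {i : Fin 2} {F X Y Z b c m s w : Plane} {A A' B C : Finset Plane}

theorem reflect (hf : IsFront i F Y Z A B C c b) : IsFront (i + 1) F Z Y A C B b c where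
  mem_c := hf.mem_b
  mem_b := hf.mem_c
  pos := by rw [orient_add_one, ← orient_swap_right]; exact hf.pos
  beyond s hs := by rw [orient_add_one, ← orient_swap]; exact hf.beyond s hs

theorem of_reflect (hf : IsFront (i + 1) F Z Y A C B b c) : IsFront i F Y Z A B C c b where
  mem_c := hf.mem_b
  mem_b := hf.mem_c
  pos := by rw [orient_swap_right, ← orient_add_one]; exact hf.pos
  beyond s hs := by rw [orient_swap, ← orient_add_one]; exact hf.beyond s hs

theorem ne (hf : IsFront i F Y Z A B C c b) : c ≠ b := by
  rintro rfl
  simpa only [orient_right, lt_irrefl] using hf.pos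

theorem pos_X (h : TriangleConfig i F X Y Z A B C) (hf : IsFront i F Y Z A B C c b) :
    0 < orient i c b X := by
  have := orient_add_orient_add_orient i c b X F
  linarith [h.X_left hf.mem_c, h.right_X hf.mem_b, hf.pos]

theorem neg_Y (h : TriangleConfig i F X Y Z A B C) (hf : IsFront i F Y Z A B C c b) (hc : c ≠ Y) :
    orient i c b Y < 0 := by
  obtain ⟨-, right, side⟩ := h.inside_C c ((Finset.mem_insert.1 hf.mem_c).resolve_left hc)
  have affine := orient_affine i c b F X Y c
  rw [orient_left, zero_mul, ← orient_rotate i F c b, ← orient_rotate i c Y F,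
    ← orient_rotate i F c Y] at affine
  by_contra hcon
  nlinarith [mul_pos side hf.pos, mul_pos right (hf.pos_X h), h.X_left hf.mem_c]

theorem neg_Z (h : TriangleConfig i F X Y Z A B C) (hf : IsFront i F Y Z A B C c b) (hb : b ≠ Z) :
    orient i c b Z < 0 := by
  rw [orient_swap, ← orient_add_one]
  exact hf.reflect.neg_Y h.reflect hb

theorem pos_of_mem_C (h : TriangleConfig i F X Y Z A B C) (hf : IsFront i F Y Z A B C Y b)
    (hs : s ∈ C) : 0 < orient i Y b s := by
  obtain ⟨-, right, side⟩ := h.inside_C s hs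
  have affine := orient_affine i Y b F X Y s
  rw [orient_left, ← orient_rotate i F Y b,
    ← orient_rotate i F s Y |>.trans (orient_rotate i s Y F)] at affine
  by_contra hcon
  nlinarith [mul_pos side hf.pos, mul_pos right (hf.pos_X h), h.pos_XY]

theorem pos_Y_b (h : TriangleConfig i F X Y Z A B C) (hf : IsFront i F Y Z A' B C c b) :
    0 < orient i F Y b := by
  have plucker := orient_plucker i F c b X Y
  rw [orient_swap_right i F b Y] at plucker
  by_contra hcon
  nlinarith [mul_pos hf.pos h.pos_XY, mul_nonneg (h.right_X hf.mem_b).le (h.right_Y hf.mem_c),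
    h.X_left hf.mem_c]

theorem pos_b_of_mem_A (h : TriangleConfig i F X Y Z A B C) (hf : IsFront i F Y Z A' B C c b)
    (hs : s ∈ A) : 0 < orient i F s b := by
  obtain ⟨left, right, -⟩ := h.inside_A s hs
  have plucker := orient_plucker i F Y s Z b
  rw [orient_swap_right i F Z Y] at plucker
  by_contra hcon
  nlinarith [mul_pos right (hf.pos_Y_b h), mul_nonneg left.le (h.Z_left hf.mem_b), h.pos_YZ]

theorem pos_c_of_mem_A (h : TriangleConfig i F X Y Z A B C) (hf : IsFront i F Y Z A' B C c b)
    (hs : s ∈ A) : 0 < orient i F c s := by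
  rw [orient_swap_right, ← orient_add_one]
  exact hf.reflect.pos_b_of_mem_A h.reflect hs

theorem pos_b_of_beyond (h : TriangleConfig i F X Y Z A B C) (hf : IsFront i F Y Z A B C c b)
    (hs : s ∈ insert Y C) (hbeyond : orient i c b s < 0) : 0 < orient i F s b := by
  have hadd := orient_add_orient_add_orient i c b s F
  rw [orient_swap_right i F b s, orient_swap_right i F s c] at hadd
  have plucker := orient_plucker i F c b X s
  rw [orient_swap_right i F b s] at plucker
  by_contra hcon
  have hcs : 0 < orient i F c s := by linarith [hf.pos]
  nlinarith [mul_pos hf.pos (h.X_left hs), mul_pos (h.right_X hf.mem_b) hcs, h.X_left hf.mem_c]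

theorem pos_of_mem_C_of_mem_A (h : TriangleConfig i F X Y Z A B C)
    (hf : IsFront i F Y Z A B C c b) (hs : s ∈ C) (hbeyond : orient i c b s < 0) (hw : w ∈ A) :
    0 < orient i F s w := by
  obtain ⟨w_left, w_right, -⟩ := h.inside_A w hw
  obtain ⟨s_left, s_right, -⟩ := h.inside_C s hs
  have hsb := hf.pos_b_of_beyond h (Finset.mem_insert_of_mem hs) hbeyond
  have hsZ : 0 < orient i F s Z := by
    have plucker := orient_plucker i F s b X Z
    rw [orient_swap_right i F X Z, orient_swap_right i F b Z] at plucker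
    by_contra hcon
    nlinarith [mul_pos hsb h.pos_ZX, mul_nonneg s_left.le (h.Z_left hf.mem_b),
      h.right_X hf.mem_b]
  have plucker := orient_plucker i F Y s Z w
  rw [orient_swap_right i F Y s, orient_swap_right i F Z w, orient_swap_right i F Z Y] at plucker
  by_contra hcon
  nlinarith [mul_pos s_right w_right, mul_pos hsZ w_left, h.pos_YZ]

theorem pos_of_mem_A_of_mem_B (h : TriangleConfig i F X Y Z A B C)
    (hf : IsFront i F Y Z A B C c b) (hs : s ∈ B) (hbeyond : orient i c b s < 0) (hw : w ∈ A) :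
    0 < orient i F w s := by
  rw [orient_swap_right, ← orient_add_one]
  refine hf.reflect.pos_of_mem_C_of_mem_A h.reflect hs ?_ hw
  rwa [orient_add_one, ← orient_swap]

/-- The inequality compares the fractions `orient i F c b / (orient i F c m + orient i F m b)` of
the ray from `F` through `m` cut off by the fronts `c b` and `w b`. -/
theorem advance (h : TriangleConfig i F X Y Z A B C) (hf : IsFront i F Y Z A B C c b) (hm : m ∈ A)
    (hw : w ∈ insert Y C) (hbeyond : orient i c b w < 0) (hA : ∀ s ∈ A, 0 < orient i b w s) :
    IsFront i F Y Z A B C w b ∧ orient i F c b * (orient i F w m + orient i F m b) <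
      orient i F w b * (orient i F c m + orient i F m b) := by
  refine ⟨⟨hw, hf.mem_b, hf.pos_b_of_beyond h hw hbeyond, fun s hs => ?_⟩, ?_⟩
  · rw [orient_swap]; linarith [hA s hs]
  · have plucker := orient_plucker i F c w b m
    rw [orient_swap_right i F b c, orient_swap_right i F b m] at plucker
    have hadd := orient_add_orient_add_orient i c b w F
    rw [orient_swap_right i F b w, orient_swap_right i F w c] at hadd
    nlinarith [mul_pos (hf.pos_b_of_mem_A h hm) (neg_pos.2 hbeyond)]

theorem exists_maximal (hf : IsFront i F Y Z A B C c b) (hm : m ∈ A) :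
    ∃ c b, IsFront i F Y Z A B C c b ∧ ∀ c' b', IsFront i F Y Z A B C c' b' →
      orient i F c' b' * (orient i F c m + orient i F m b) ≤
        orient i F c b * (orient i F c' m + orient i F m b') := by
  classical
  have hpos : ∀ c b, IsFront i F Y Z A B C c b → 0 < orient i F c m + orient i F m b := by
    intro c b hf
    have hadd := orient_add_orient_add_orient i c b m F
    rw [orient_swap_right i F b m, orient_swap_right i F m c] at hadd
    linarith [hf.beyond m hm, hf.pos]
  have mem_fronts : ∀ c b, IsFront i F Y Z A B C c b →
      (c, b) ∈ (insert Y C ×ˢ insert Z B).filter (fun e => IsFront i F Y Z A B C e.1 e.2) :=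
    fun c b hf => Finset.mem_filter.2 ⟨Finset.mk_mem_product hf.mem_c hf.mem_b, hf⟩
  obtain ⟨⟨c₀, b₀⟩, h₀, hmax⟩ := Finset.exists_max_image _
    (fun e : Plane × Plane => orient i F e.1 e.2 / (orient i F e.1 m + orient i F m e.2))
    ⟨(c, b), mem_fronts c b hf⟩
  have hf₀ := (Finset.mem_filter.1 h₀).2
  exact ⟨c₀, b₀, hf₀, fun c' b' hf' => (div_le_div_iff₀ (hpos c' b' hf') (hpos c₀ b₀ hf₀)).1
    (hmax (c', b') (mem_fronts c' b' hf'))⟩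

end IsFront

section CentralTriangle

variable {i : Fin 2} {F X Y Z a b c s w : Plane} {A B C KX KY KZ : Finset Plane}

theorem inter_convexHull_subset_singleton {g h x : Plane} {G H : Set Plane}
    (hx : orient i g h x = 0) (hG : ∀ z ∈ G, 0 < orient i g h z ∨ z = x)
    (hH : ∀ z ∈ H, orient i g h z ≤ 0) : convexHull ℝ G ∩ convexHull ℝ H ⊆ {x} :=
  fun _ hz => mem_of_mem_convexHull_of_orient_nonpos (convex_singleton x)
    (by rintro z rfl; exact hx) hG hz.1 (orient_nonpos_of_mem_convexHull hH hz.2)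

theorem forall_mem_corner {q r Q : Plane} {K : Finset Plane} {P : Plane → Prop} (hq : P q)
    (hr : P r) (hK : ∀ s ∈ insert Q K, P s) : ∀ s ∈ ({q, r, Q} ∪ K : Set Plane), P s := by
  rintro s ((rfl | rfl | rfl) | hs)
  exacts [hq, hr, hK s (Finset.mem_insert_self s K), hK s (Finset.mem_insert_of_mem hs)]

/-- A triangle `a b c` around which all other points fall into three corner regions `KX`, `KY`,
`KZ`, attached to the sides of `a b c` that face `X`, `Y`, `Z`. One of the corners `Y` and `Z` may
degenerate: then the vertex `c` respectively `b` is that corner. -/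
structure CentralTriangle (i : Fin 2) (X Y Z : Plane) (A B C : Finset Plane) (a b c : Plane)
    (KX KY KZ : Finset Plane) : Prop where
  mem_a : a ∈ A
  mem_b : b ∈ insert Z B
  mem_c : c ∈ insert Y C
  not_both : ¬(b = Z ∧ c = Y)
  pos : 0 < orient i c a b
  subset_X : KX ⊆ B ∪ C
  subset_Y : KY ⊆ C ∪ A
  subset_Z : KZ ⊆ A ∪ B
  cover : ∀ s ∈ A ∪ B ∪ C, s = a ∨ s = b ∨ s = c ∨ s ∈ KX ∨ s ∈ KY ∨ s ∈ KZ
  beyond_X : ∀ s ∈ insert X KX, 0 < orient i c b s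
  beyond_Y : c ≠ Y → ∀ s ∈ insert Y KY, 0 < orient i a c s
  beyond_Z : b ≠ Z → ∀ s ∈ insert Z KZ, 0 < orient i b a s
  empty_Y : c = Y → KY = ∅
  empty_Z : b = Z → KZ = ∅
  inter_XY : convexHull ℝ ({c, b, X} ∪ KX) ∩ convexHull ℝ ({a, c, Y} ∪ KY) ⊆ {c}
  inter_YZ : convexHull ℝ ({a, c, Y} ∪ KY) ∩ convexHull ℝ ({b, a, Z} ∪ KZ) ⊆ {a}
  inter_ZX : convexHull ℝ ({b, a, Z} ∪ KZ) ∩ convexHull ℝ ({c, b, X} ∪ KX) ⊆ {b}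

theorem CentralTriangle.of_reflect
    (h : CentralTriangle (i + 1) X Z Y A C B a c b KX KZ KY) :
    CentralTriangle i X Y Z A B C a b c KX KY KZ where
  mem_a := h.mem_a
  mem_b := h.mem_c
  mem_c := h.mem_b
  not_both hbc := h.not_both hbc.symm
  pos := by rw [orient_rotate, orient_swap, ← orient_add_one]; exact h.pos
  subset_X := Finset.union_comm B C ▸ h.subset_X
  subset_Y := Finset.union_comm C A ▸ h.subset_Z
  subset_Z := Finset.union_comm A B ▸ h.subset_Y
  cover s hs := by
    have := h.cover s (by rwa [Finset.union_right_comm])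
    tauto
  beyond_X s hs := by rw [orient_swap, ← orient_add_one]; exact h.beyond_X s hs
  beyond_Y hc s hs := by rw [orient_swap, ← orient_add_one]; exact h.beyond_Z hc s hs
  beyond_Z hb s hs := by rw [orient_swap, ← orient_add_one]; exact h.beyond_Y hb s hs
  empty_Y := h.empty_Z
  empty_Z := h.empty_Y
  inter_XY := by
    rw [Set.insert_comm c, Set.insert_comm a, Set.inter_comm]; exact h.inter_ZX
  inter_YZ := by
    rw [Set.insert_comm a, Set.insert_comm b, Set.inter_comm]; exact h.inter_YZ
  inter_ZX := by
    rw [Set.insert_comm b, Set.insert_comm c, Set.inter_comm]; exact h.inter_XY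

namespace IsFront

theorem eq_or_beyond_or_near (h : TriangleConfig i F X Y Z A B C) (hf : IsFront i F Y Z A B C c b)
    (hs : s ∈ A ∪ B ∪ C) :
    s = b ∨ s = c ∨ orient i c b s < 0 ∨ s ∈ {s ∈ B ∪ C | 0 < orient i c b s} := by
  rw [or_iff_not_imp_left, or_iff_not_imp_left]
  intro hsb hsc
  have mem_points : ∀ {x}, x = Y ∨ x = Z ∨ x ∈ A ∪ B ∪ C →
      x ∈ ({F, X, Y, Z} ∪ (A ∪ B ∪ C) : Set Plane) := by
    rintro x (rfl | rfl | hx)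
    · simp
    · simp
    · exact Or.inr (by simpa only [Finset.coe_union] using Finset.mem_coe.2 hx)
  have hc : c = Y ∨ c = Z ∨ c ∈ A ∪ B ∪ C := (Finset.mem_insert.1 hf.mem_c).imp_right
    fun hc => Or.inr (Finset.mem_union_right _ hc)
  have hb : b = Y ∨ b = Z ∨ b ∈ A ∪ B ∪ C := Or.inr ((Finset.mem_insert.1 hf.mem_b).imp_right
    fun hb => Finset.mem_union_left _ (Finset.mem_union_right _ hb))
  refine (h.general.orient_ne_zero i (mem_points hc) (mem_points hb)
    (mem_points (Or.inr (Or.inr hs))) hf.ne (Ne.symm hsb) (Ne.symm hsc)).lt_or_gt.imp_right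
    fun hpos => Finset.mem_filter.2 ⟨?_, hpos⟩
  rw [Finset.union_assoc] at hs
  exact (Finset.mem_union.1 hs).resolve_left fun hsA => lt_asymm hpos (hf.beyond s hsA)

theorem exists_centralTriangle_of_corners (h : TriangleConfig i F X Y Z A B C)
    (hf : IsFront i F Y Z A B C c b) (hbc : ¬(b = Z ∧ c = Y)) (hw : w ∈ A)
    (hKY : KY ⊆ C ∪ A) (hKZ : KZ ⊆ A ∪ B)
    (hcover : ∀ s ∈ A ∪ B ∪ C, orient i c b s < 0 → s = w ∨ s ∈ KY ∨ s ∈ KZ)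
    (hfar : ∀ s ∈ KY ∪ KZ, orient i c b s < 0)
    (hY : c ≠ Y → ∀ s ∈ insert Y KY, 0 < orient i w c s)
    (hZ : b ≠ Z → ∀ s ∈ insert Z KZ, 0 < orient i b w s)
    (hY₀ : c = Y → KY = ∅) (hZ₀ : b = Z → KZ = ∅)
    (hinter : convexHull ℝ ({w, c, Y} ∪ KY) ∩ convexHull ℝ ({b, w, Z} ∪ KZ) ⊆ {w}) :
    ∃ KX, CentralTriangle i X Y Z A B C w b c KX KY KZ := by
  have far_pos : ∀ s, orient i c b s < 0 → 0 < orient i b c s := fun s hs => by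
    rw [orient_swap]; linarith
  have far_Y : ∀ s ∈ ({w, c, Y} ∪ KY : Set Plane), 0 < orient i b c s ∨ s = c :=
    forall_mem_corner (Or.inl (far_pos w (hf.beyond w hw))) (Or.inr rfl) <|
      (Finset.forall_mem_insert ..).2
        ⟨or_iff_not_imp_right.2 fun hcY => far_pos Y (hf.neg_Y h (Ne.symm hcY)),
          fun s hs => Or.inl (far_pos s (hfar s (Finset.mem_union_left _ hs)))⟩
  have far_Z : ∀ s ∈ ({b, w, Z} ∪ KZ : Set Plane), 0 < orient i b c s ∨ s = b :=
    forall_mem_corner (Or.inr rfl) (Or.inl (far_pos w (hf.beyond w hw))) <|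
      (Finset.forall_mem_insert ..).2
        ⟨or_iff_not_imp_right.2 fun hbZ => far_pos Z (hf.neg_Z h (Ne.symm hbZ)),
          fun s hs => Or.inl (far_pos s (hfar s (Finset.mem_union_right _ hs)))⟩
  have near_X : ∀ s ∈ insert X {s ∈ B ∪ C | 0 < orient i c b s}, 0 < orient i c b s :=
    (Finset.forall_mem_insert ..).2 ⟨hf.pos_X h, fun s hs => (Finset.mem_filter.1 hs).2⟩
  have nonpos_X : ∀ s ∈ ({c, b, X} ∪ ↑{s ∈ B ∪ C | 0 < orient i c b s} : Set Plane),
      orient i b c s ≤ 0 :=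
    forall_mem_corner (by simp) (by simp) fun s hs => by
      rw [orient_swap]; linarith [near_X s hs]
  refine ⟨{s ∈ B ∪ C | 0 < orient i c b s}, hw, hf.mem_b, hf.mem_c, hbc,
    by rw [← orient_rotate]; exact far_pos w (hf.beyond w hw), Finset.filter_subset _ _, hKY, hKZ,
    fun s hs => ?_, near_X, hY, hZ, hY₀, hZ₀, ?_, hinter,
    inter_convexHull_subset_singleton (i := i) (by simp) far_Z nonpos_X⟩
  · rcases hf.eq_or_beyond_or_near h hs with hsb | hsc | hneg | hsX
    · exact Or.inr (Or.inl hsb)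
    · exact Or.inr (Or.inr (Or.inl hsc))
    · exact (hcover s hs hneg).imp_right fun hs => Or.inr (Or.inr (Or.inr hs))
    · exact Or.inr (Or.inr (Or.inr (Or.inl hsX)))
  · rw [Set.inter_comm]
    exact inter_convexHull_subset_singleton (i := i) (by simp) far_Y nonpos_X

end IsFront

end CentralTriangle

section MaximalFront

variable {i : Fin 2} {F X Y Z b c s w : Plane} {A B C : Finset Plane}

theorem orient_pos_of_ray_right (htri : 0 < orient i w b c) (hcw : 0 < orient i F c w)
    (hwb : 0 < orient i F w b) (hsw : 0 < orient i F s w)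
    (hs : s ≠ w → 0 < orient i b w s ∨ 0 < orient i w c s) : 0 < orient i w c s := by
  have hsw' : s ≠ w := by rintro rfl; simp only [orient_right, lt_irrefl] at hsw
  refine (hs hsw').elim (fun hs => ?_) id
  have hlines := orient_three_lines i F b c s w
  rw [orient_swap i w b s, orient_swap i c w s] at hlines
  by_contra hcon
  nlinarith [mul_pos htri hsw, mul_pos hs hcw]

theorem orient_pos_of_ray_left (htri : 0 < orient i w b c) (hcw : 0 < orient i F c w)
    (hwb : 0 < orient i F w b) (hws : 0 < orient i F w s)
    (hs : s ≠ w → 0 < orient i b w s ∨ 0 < orient i w c s) : 0 < orient i b w s := by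
  have hsw' : s ≠ w := by rintro rfl; simp only [orient_right, lt_irrefl] at hws
  refine (hs hsw').elim id fun hs => ?_
  have hlines := orient_three_lines i F c b s w
  rw [orient_swap_right i w c b, orient_swap_right i F s w, orient_swap_right i F w c,
    orient_swap_right i F b w] at hlines
  by_contra hcon
  nlinarith [mul_pos htri hws, mul_pos hs hwb]

theorem TriangleConfig.orient_F_ne_zero_of_mem_A (h : TriangleConfig i F X Y Z A B C)
    (hs : s ∈ A) (hw : w ∈ A) (hsw : s ≠ w) : orient i F s w ≠ 0 := by
  have F_ne : ∀ {x}, x ∈ A → F ≠ x := by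
    rintro x hx rfl
    simpa only [orient_left, lt_irrefl] using (h.inside_A F hx).left
  exact h.general.orient_ne_zero i (by simp) (by simp [hs]) (by simp [hw]) (F_ne hs) hsw (F_ne hw)

namespace IsFront

theorem mem_sector_of_beyond (h : TriangleConfig i F X Y Z A B C)
    (hf : IsFront i F Y Z A B C c b) (hs : s ∈ A ∪ B ∪ C) (hbeyond : orient i c b s < 0)
    (hw : w ∈ A) :
    s = w ∨ s ∈ C ∪ A ∧ 0 < orient i F s w ∨ s ∈ A ∪ B ∧ 0 < orient i F w s := by
  simp only [Finset.mem_union] at hs ⊢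
  rcases hs with (hs | hs) | hs
  · by_cases hsw : s = w
    · exact Or.inl hsw
    rcases (h.orient_F_ne_zero_of_mem_A hs hw hsw).lt_or_gt with hneg | hpos
    · rw [orient_swap_right, Left.neg_neg_iff] at hneg
      exact Or.inr (Or.inr ⟨Or.inl hs, hneg⟩)
    · exact Or.inr (Or.inl ⟨Or.inr hs, hpos⟩)
  · exact Or.inr (Or.inr ⟨Or.inr hs, hf.pos_of_mem_A_of_mem_B h hs hbeyond hw⟩)
  · exact Or.inr (Or.inl ⟨Or.inl hs, hf.pos_of_mem_C_of_mem_A h hs hbeyond hw⟩)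

theorem exists_centralTriangle_of_ne (h : TriangleConfig i F X Y Z A B C)
    (hf : IsFront i F Y Z A B C c b) (hcY : c ≠ Y) (hbZ : b ≠ Z) (hw : w ∈ A)
    (hempty : ∀ s ∈ insert Y (C ∪ A) ∪ insert Z (A ∪ B), orient i c b s < 0 → s ≠ w →
      0 < orient i b w s ∨ 0 < orient i w c s) :
    ∃ KX KY KZ, CentralTriangle i X Y Z A B C w b c KX KY KZ := by
  have hcw := hf.pos_c_of_mem_A h hw
  have hwb := hf.pos_b_of_mem_A h hw
  have htri : 0 < orient i w b c := by
    rw [orient_rotate, orient_swap]; linarith [hf.beyond w hw]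
  let KY := {s ∈ C ∪ A | orient i c b s < 0 ∧ 0 < orient i F s w}
  let KZ := {s ∈ A ∪ B | orient i c b s < 0 ∧ 0 < orient i F w s}
  have sector_Y : ∀ s ∈ insert Y KY, orient i c b s < 0 ∧ 0 < orient i F s w :=
    (Finset.forall_mem_insert ..).2
      ⟨⟨hf.neg_Y h hcY, (h.inside_A w hw).left⟩, fun s hs => (Finset.mem_filter.1 hs).2⟩
  have sector_Z : ∀ s ∈ insert Z KZ, orient i c b s < 0 ∧ 0 < orient i F w s :=
    (Finset.forall_mem_insert ..).2
      ⟨⟨hf.neg_Z h hbZ, (h.inside_A w hw).right⟩, fun s hs => (Finset.mem_filter.1 hs).2⟩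
  have beyond_Y : ∀ s ∈ insert Y KY, 0 < orient i w c s := fun s hs =>
    orient_pos_of_ray_right htri hcw hwb (sector_Y s hs).2 (hempty s (Finset.mem_union_left _
      (Finset.insert_subset_insert Y (Finset.filter_subset _ _) hs)) (sector_Y s hs).1)
  have beyond_Z : ∀ s ∈ insert Z KZ, 0 < orient i b w s := fun s hs =>
    orient_pos_of_ray_left htri hcw hwb (sector_Z s hs).2 (hempty s (Finset.mem_union_right _
      (Finset.insert_subset_insert Z (Finset.filter_subset _ _) hs)) (sector_Z s hs).1)
  have hinter : convexHull ℝ ({w, c, Y} ∪ KY) ∩ convexHull ℝ ({b, w, Z} ∪ KZ) ⊆ {w} := by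
    refine inter_convexHull_subset_singleton (i := i) (g := w) (h := F) (by simp)
      (forall_mem_corner (Or.inr rfl) (Or.inl ?_) fun s hs => Or.inl ?_)
      (forall_mem_corner ?_ (by simp) fun s hs => ?_)
    · rwa [orient_rotate]
    · rw [orient_rotate]; exact (sector_Y s hs).2
    · rw [orient_swap]; linarith
    · rw [orient_swap]; linarith [(sector_Z s hs).2]
  refine (hf.exists_centralTriangle_of_corners h (fun hbc => hcY hbc.2) hw
    (Finset.filter_subset _ _) (Finset.filter_subset _ _) (fun s hs hbeyond => ?_)
    (fun s hs => ?_) (fun _ => beyond_Y) (fun _ => beyond_Z) (absurd · hcY) (absurd · hbZ)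
    hinter).imp fun KX hK => ⟨KY, KZ, hK⟩
  · exact (hf.mem_sector_of_beyond h hs hbeyond hw).imp_right <| Or.imp
      (fun hs => Finset.mem_filter.2 ⟨hs.1, hbeyond, hs.2⟩)
      (fun hs => Finset.mem_filter.2 ⟨hs.1, hbeyond, hs.2⟩)
  · rcases Finset.mem_union.1 hs with hs | hs
    exacts [(sector_Y s (Finset.mem_insert_of_mem hs)).1,
      (sector_Z s (Finset.mem_insert_of_mem hs)).1]

theorem exists_centralTriangle_of_eq (h : TriangleConfig i F X Y Z A B C)
    (hf : IsFront i F Y Z A B C Y b) (hbZ : b ≠ Z) (hw : w ∈ A)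
    (hempty : ∀ s ∈ insert Z (A ∪ B), orient i Y b s < 0 → s ≠ w → 0 < orient i b w s) :
    ∃ KX KY KZ, CentralTriangle i X Y Z A B C w b Y KX KY KZ := by
  have htri : 0 < orient i w b Y := by
    rw [orient_rotate, orient_swap]; linarith [hf.beyond w hw]
  let KZ := {s ∈ A ∪ B | orient i Y b s < 0 ∧ s ≠ w}
  have beyond_Z : ∀ s ∈ insert Z KZ, 0 < orient i b w s := by
    refine (Finset.forall_mem_insert ..).2 ⟨hempty Z (Finset.mem_insert_self Z _)
      (hf.neg_Z h hbZ) ?_, fun s hs => ?_⟩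
    · rintro rfl
      simpa only [orient_right, lt_irrefl] using (h.inside_A Z hw).right
    · obtain ⟨hs, hbeyond, hsw⟩ := Finset.mem_filter.1 hs
      exact hempty s (Finset.mem_insert_of_mem hs) hbeyond hsw
  have hinter : convexHull ℝ ({w, Y, Y} ∪ ↑(∅ : Finset Plane)) ∩
      convexHull ℝ ({b, w, Z} ∪ KZ) ⊆ {w} := by
    refine inter_convexHull_subset_singleton (i := i) (g := w) (h := b) (by simp)
      (forall_mem_corner (Or.inr rfl) (Or.inl htri) fun s hs => Or.inl ?_)
      (forall_mem_corner (by simp) (by simp) fun s hs => ?_)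
    · obtain rfl : s = Y := by simpa using hs
      exact htri
    · rw [orient_swap]; linarith [beyond_Z s hs]
  refine (hf.exists_centralTriangle_of_corners h (fun hbc => hbZ hbc.1) hw
    (Finset.empty_subset _) (Finset.filter_subset _ _) (fun s hs hbeyond => ?_)
    (fun s hs => ?_) (absurd rfl) (fun _ => beyond_Z) (fun _ => rfl) (absurd · hbZ)
    hinter).imp fun KX hK => ⟨∅, KZ, hK⟩
  · rcases Finset.mem_union.1 hs with hs | hs
    · exact or_iff_not_imp_left.2 fun hsw => Or.inr (Finset.mem_filter.2 ⟨hs, hbeyond, hsw⟩)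
    · exact absurd hbeyond (lt_asymm (hf.pos_of_mem_C h hs))
  · rw [Finset.empty_union] at hs
    exact (Finset.mem_filter.1 hs).2.1

end IsFront

end MaximalFront

/-- A front which cannot be moved away from `F`, measured by the fraction of the ray from `F`
through `m` that it cuts off. -/
structure IsMaximalFront (i : Fin 2) (F Y Z : Plane) (A B C : Finset Plane) (m c b : Plane) : Prop
    extends IsFront i F Y Z A B C c b where
  maximal : ∀ c' b', IsFront i F Y Z A B C c' b' →
    orient i F c' b' * (orient i F c m + orient i F m b) ≤
      orient i F c b * (orient i F c' m + orient i F m b')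

/-- The points that can become the third vertex of a triangle erected on the front `c b`. -/
noncomputable def beyondFront (i : Fin 2) (Y Z : Plane) (A B C : Finset Plane) (c b : Plane) :
    Finset Plane :=
  {s ∈ insert Y (C ∪ A) ∪ insert Z (A ∪ B) | orient i c b s < 0}

/-- The ray from `b` through `c`, rotated about `b` into the region beyond the front `c b`, meets
`w` first. -/
structure IsFirstHit (i : Fin 2) (Y Z : Plane) (A B C : Finset Plane) (c b w : Plane) : Prop where
  mem : w ∈ beyondFront i Y Z A B C c b
  first : ∀ s ∈ beyondFront i Y Z A B C c b, s ≠ w → 0 < orient i b w s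

section FirstHit

variable {i : Fin 2} {F X Y Z b c m s w₁ w₂ : Plane} {A B C : Finset Plane}

theorem beyondFront_reflect (i : Fin 2) (Y Z : Plane) (A B C : Finset Plane) (c b : Plane) :
    beyondFront (i + 1) Z Y A C B b c = beyondFront i Y Z A B C c b := by
  simp only [beyondFront, orient_add_one, ← orient_swap]
  rw [Finset.union_comm (insert Z _), Finset.union_comm B, Finset.union_comm A C]

theorem pos_of_mem_beyondFront (hs : s ∈ beyondFront i Y Z A B C c b) : 0 < orient i b c s := by
  rw [orient_swap]
  linarith [(Finset.mem_filter.1 hs).2]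

theorem IsFront.mem_beyondFront_of_mem_A (hf : IsFront i F Y Z A B C c b) (hs : s ∈ A) :
    s ∈ beyondFront i Y Z A B C c b :=
  Finset.mem_filter.2 ⟨by simp [hs], hf.beyond s hs⟩

theorem IsFront.exists_isFirstHit (h : TriangleConfig i F X Y Z A B C)
    (hf : IsFront i F Y Z A B C c b) (hA : A.Nonempty) : ∃ w, IsFirstHit i Y Z A B C c b w := by
  obtain ⟨w, hw, hfirst⟩ := exists_first_hit_left
    (hA.mono fun s hs => hf.mem_beyondFront_of_mem_A hs) (fun s hs => pos_of_mem_beyondFront hs)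
    (h.general.mono <| by
      have hb := hf.mem_b
      rintro s (rfl | hs)
      · simp only [Finset.mem_insert, Set.mem_union, Set.mem_insert_iff, Set.mem_singleton_iff,
          SetLike.mem_coe] at hb ⊢
        tauto
      · have hmem := (Finset.mem_filter.1 hs).1
        simp only [Finset.mem_union, Finset.mem_insert, Set.mem_union, Set.mem_insert_iff,
          Set.mem_singleton_iff, SetLike.mem_coe] at hmem ⊢
        tauto)
  exact ⟨w, hw, hfirst⟩

namespace IsMaximalFront

theorem reflect (hf : IsMaximalFront i F Y Z A B C m c b) :
    IsMaximalFront (i + 1) F Z Y A C B m b c where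
  toIsFront := hf.toIsFront.reflect
  maximal b' c' hf' := by
    simp only [orient_add_one, ← orient_swap_right]
    rw [add_comm (orient i F m b), add_comm (orient i F m b')]
    exact hf.maximal c' b' hf'.of_reflect

theorem isFirstHit_notMem_C (h : TriangleConfig i F X Y Z A B C)
    (hf : IsMaximalFront i F Y Z A B C m c b) (hm : m ∈ A)
    (hw : IsFirstHit i Y Z A B C c b w₁) : w₁ ∉ insert Y C := fun hwC => by
  obtain ⟨hf', hlt⟩ := hf.advance h hm hwC (Finset.mem_filter.1 hw.mem).2 fun s hs =>
    hw.first s (hf.mem_beyondFront_of_mem_A hs) (by rintro rfl; exact h.notMem_C_of_mem_A hs hwC)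
  exact (hf.maximal w₁ b hf').not_gt hlt

theorem isFirstHit_mem (h : TriangleConfig i F X Y Z A B C)
    (hf : IsMaximalFront i F Y Z A B C m c b) (hm : m ∈ A)
    (hw : IsFirstHit i Y Z A B C c b w₁) : w₁ ∈ A ∨ w₁ ∈ insert Z B := by
  have hmem := (Finset.mem_filter.1 hw.mem).1
  have hwC := hf.isFirstHit_notMem_C h hm hw
  simp only [Finset.mem_union, Finset.mem_insert] at hmem hwC ⊢
  tauto

end IsMaximalFront

theorem IsFirstHit.exists_mem_segments (hw₁ : IsFirstHit i Y Z A B C c b w₁)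
    (hw₂ : IsFirstHit (i + 1) Z Y A C B b c w₂) (hne : w₁ ≠ w₂) :
    ∃ x, x ∈ segment ℝ b w₁ ∧ x ∈ segment ℝ w₂ c := by
  have hmem := hw₂.mem
  have hfirst := hw₂.first
  rw [beyondFront_reflect] at hmem hfirst
  refine exists_mem_segments_of_crossing (i := i) (hw₁.first w₂ hmem hne.symm) ?_ ?_ ?_
  · rw [orient_swap_right]; linarith [pos_of_mem_beyondFront hw₁.mem]
  · rw [← orient_rotate, orient_swap_right]; linarith [pos_of_mem_beyondFront hmem]
  · have := hfirst w₁ hw₁.mem hne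
    rw [orient_add_one, ← orient_swap] at this
    exact this.le

theorem TriangleConfig.not_mem_segments_of_mem_B_of_mem_C (h : TriangleConfig i F X Y Z A B C)
    (hb : b ∈ insert Z B) (hw₁ : w₁ ∈ insert Z B) (hc : c ∈ insert Y C) (hw₂ : w₂ ∈ insert Y C) :
    ¬∃ x, x ∈ segment ℝ b w₁ ∧ x ∈ segment ℝ w₂ c := by
  rintro ⟨x, hx₁, hx₂⟩
  have neg_B : ∀ s ∈ insert Z B, orient i F X s < 0 := fun s hs => by
    rw [orient_swap_right]; linarith [h.right_X hs]
  exact lt_asymm (a := (0 : ℝ))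
    ((convex_orient_pos i F X).segment_subset (h.X_left hw₂) (h.X_left hc) hx₂)
    ((convex_orient_neg i F X).segment_subset (neg_B b hb) (neg_B w₁ hw₁) hx₁)

theorem TriangleConfig.not_mem_segments_of_mem_B_of_mem_A (h : TriangleConfig i F X Y Z A B C)
    (hb : b ∈ insert Z B) (hw₁ : w₁ ∈ insert Z B) (hw₂ : w₂ ∈ A) :
    ¬∃ x, x ∈ segment ℝ b w₁ ∧ x ∈ segment ℝ w₂ Y := by
  rintro ⟨x, hx₁, hx₂⟩
  exact not_lt_of_ge (a := (0 : ℝ))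
    ((convex_orient_nonneg i F Z).segment_subset (h.Z_left hb) (h.Z_left hw₁) hx₁)
    ((convex_orient_neg i F Z).segment_subset
      (show orient i F Z w₂ < 0 by rw [orient_swap_right]; linarith [(h.inside_A w₂ hw₂).right])
      (show orient i F Z Y < 0 by rw [orient_swap_right]; linarith [h.pos_YZ]) hx₂)

namespace IsMaximalFront

theorem isFirstHit_mem_or_mem (h : TriangleConfig i F X Y Z A B C)
    (hf : IsMaximalFront i F Y Z A B C m c b) (hm : m ∈ A)
    (hw₁ : IsFirstHit i Y Z A B C c b w₁) (hw₂ : IsFirstHit (i + 1) Z Y A C B b c w₂) :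
    w₁ ∈ A ∨ w₂ ∈ A := by
  refine (hf.isFirstHit_mem h hm hw₁).imp_right fun hw₁B => ?_
  refine (hf.reflect.isFirstHit_mem h.reflect hm hw₂).resolve_right fun hw₂C => ?_
  exact h.not_mem_segments_of_mem_B_of_mem_C hf.mem_b hw₁B hf.mem_c hw₂C
    (hw₁.exists_mem_segments hw₂ fun hw => h.notMem_C_of_mem_B hw₁B (hw ▸ hw₂C))

theorem isFirstHit_mem_of_eq (h : TriangleConfig i F X Y Z A B C)
    (hf : IsMaximalFront i F Y Z A B C m Y b) (hm : m ∈ A)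
    (hw₁ : IsFirstHit i Y Z A B C Y b w₁) (hw₂ : IsFirstHit (i + 1) Z Y A C B b Y w₂) :
    w₁ ∈ A := by
  by_contra hw₁A
  have hw₁B := (hf.isFirstHit_mem h hm hw₁).resolve_left hw₁A
  have hw₂A := (hf.isFirstHit_mem_or_mem h hm hw₁ hw₂).resolve_left hw₁A
  exact h.not_mem_segments_of_mem_B_of_mem_A hf.mem_b hw₁B hw₂A
    (hw₁.exists_mem_segments hw₂ fun hw => hw₁A (hw ▸ hw₂A))

end IsMaximalFront

namespace IsFront

theorem exists_centralTriangle_of_eq_Y (h : TriangleConfig i F X Y Z A B C)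
    (hf : IsMaximalFront i F Y Z A B C m Y b) (hm : m ∈ A) :
    ∃ a KX KY KZ, CentralTriangle i X Y Z A B C a b Y KX KY KZ := by
  obtain ⟨w₁, hw₁⟩ := hf.exists_isFirstHit h ⟨m, hm⟩
  obtain ⟨w₂, hw₂⟩ := hf.reflect.exists_isFirstHit h.reflect ⟨m, hm⟩
  have hbZ : b ≠ Z := by
    rintro rfl
    exact lt_asymm (hf.beyond m hm) (h.inside_A m hm).side
  exact ⟨w₁, hf.exists_centralTriangle_of_eq h hbZ (hf.isFirstHit_mem_of_eq h hm hw₁ hw₂)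
    fun s hs hbeyond => hw₁.first s (Finset.mem_filter.2 ⟨Finset.mem_union_right _ hs, hbeyond⟩)⟩

theorem exists_centralTriangle (h : TriangleConfig i F X Y Z A B C)
    (hf : IsFront i F Y Z A B C c b) (hA : A.Nonempty) :
    ∃ a b c KX KY KZ, CentralTriangle i X Y Z A B C a b c KX KY KZ := by
  obtain ⟨m, hm⟩ := hA
  obtain ⟨c, b, hf, hmax⟩ := hf.exists_maximal hm
  replace hf : IsMaximalFront i F Y Z A B C m c b := ⟨hf, hmax⟩
  rcases eq_or_ne c Y with rfl | hcY
  · obtain ⟨a, hcentral⟩ := exists_centralTriangle_of_eq_Y h hf hm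
    exact ⟨a, b, c, hcentral⟩
  rcases eq_or_ne b Z with rfl | hbZ
  · obtain ⟨a, KX, KZ, KY, hcentral⟩ := exists_centralTriangle_of_eq_Y h.reflect hf.reflect hm
    exact ⟨a, b, c, KX, KY, KZ, hcentral.of_reflect⟩
  obtain ⟨w₁, hw₁⟩ := hf.exists_isFirstHit h ⟨m, hm⟩
  obtain ⟨w₂, hw₂⟩ := hf.reflect.exists_isFirstHit h.reflect ⟨m, hm⟩
  rcases hf.isFirstHit_mem_or_mem h hm hw₁ hw₂ with hw | hw
  · exact ⟨w₁, b, c, hf.exists_centralTriangle_of_ne h hcY hbZ hw fun s hs hbeyond hsw =>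
      Or.inl (hw₁.first s (Finset.mem_filter.2 ⟨hs, hbeyond⟩) hsw)⟩
  · refine ⟨w₂, b, c, hf.exists_centralTriangle_of_ne h hcY hbZ hw fun s hs hbeyond hsw =>
      Or.inr ?_⟩
    rw [orient_swap, ← orient_add_one]
    refine hw₂.first s ?_ hsw
    rw [beyondFront_reflect]
    exact Finset.mem_filter.2 ⟨hs, hbeyond⟩

end IsFront

end FirstHit

section EmptyTriangle

variable {i : Fin 2} {F a b c p q r s x y z : Plane} {S : Finset Plane}

/-- The point `F` lies in the interior of the positively oriented triangle `p q r`. -/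
structure IsAround (i : Fin 2) (F p q r : Plane) : Prop where
  pos_pq : 0 < orient i F p q
  pos_qr : 0 < orient i F q r
  pos_rp : 0 < orient i F r p

namespace IsAround

theorem rotate (h : IsAround i F p q r) : IsAround i F q r p := ⟨h.pos_qr, h.pos_rp, h.pos_pq⟩

theorem pos (h : IsAround i F p q r) : 0 < orient i p q r := by
  rw [← orient_add_orient_add_orient i p q r F]
  linarith [h.pos_pq, h.pos_qr, h.pos_rp]

theorem exists_neg_of_ne_zero (h : IsAround i F p q r) (hp : orient i F p s ≠ 0)
    (hq : orient i F q s ≠ 0) (hr : orient i F r s ≠ 0) :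
    (orient i F p s < 0 ∧ 0 < orient i F q s) ∨ (orient i F q s < 0 ∧ 0 < orient i F r s) ∨
      (orient i F r s < 0 ∧ 0 < orient i F p s) := by
  obtain ⟨hpq, hqr, hrp⟩ := h
  have plucker := orient_plucker i F p q r s
  rcases hp.lt_or_gt with hp | hp <;> rcases hq.lt_or_gt with hq | hq <;>
    rcases hr.lt_or_gt with hr | hr <;> simp only [hp, hq, hr, and_self, true_or, or_true]
  · nlinarith [mul_pos hpq (neg_pos.2 hr), mul_pos hqr (neg_pos.2 hp), mul_pos hrp (neg_pos.2 hq)]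
  · nlinarith [mul_pos hpq hr, mul_pos hqr hp, mul_pos hrp hq]

end IsAround

/-- A triangle around `F` with vertices in `S` whose convex hull contains no further point
of `S`. -/
structure IsEmptyTriangle (i : Fin 2) (F : Plane) (S : Finset Plane) (p q r : Plane) : Prop
    extends IsAround i F p q r where
  mem_p : p ∈ S
  mem_q : q ∈ S
  mem_r : r ∈ S
  empty : ∀ s ∈ S, s ≠ p → s ≠ q → s ≠ r →
    orient i p q s < 0 ∨ orient i q r s < 0 ∨ orient i r p s < 0

theorem IsEmptyTriangle.rotate (h : IsEmptyTriangle i F S p q r) : IsEmptyTriangle i F S q r p where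
  toIsAround := h.toIsAround.rotate
  mem_p := h.mem_q
  mem_q := h.mem_r
  mem_r := h.mem_p
  empty s hs hsq hsr hsp := by
    have := h.empty s hs hsp hsq hsr
    tauto

theorem IsAround.convexHull_inter_ssubset (h : IsAround i F p q r)
    (hgen : InGeneralPosition (S : Set Plane)) (hq : q ∈ S) (hr : r ∈ S) (hs : s ∈ S)
    (hsq : s ≠ q) (hsr : s ≠ r) (hmem : s ∈ convexHull ℝ {p, q, r}) (hps : orient i F p s < 0)
    (hqs : 0 < orient i F q s) :
    (S : Set Plane) ∩ convexHull ℝ {p, q, s} ⊂ S ∩ convexHull ℝ {p, q, r} := by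
  have htri : 0 < orient i p q s :=
    IsAround.pos (F := F) ⟨h.pos_pq, hqs, by rw [orient_swap_right]; linarith⟩
  refine (Set.ssubset_iff_of_subset (Set.inter_subset_inter_right _ ?_)).2
    ⟨r, ⟨hr, subset_convexHull ℝ _ (by simp)⟩, fun hr' => ?_⟩
  · refine convexHull_min ?_ (convex_convexHull ℝ _)
    rintro x (rfl | rfl | rfl)
    exacts [subset_convexHull ℝ _ (by simp), subset_convexHull ℝ _ (by simp), hmem]
  · have hqsr := ((mem_triangle_iff htri).1 hr'.2).2.1
    have hqrs := ((mem_triangle_iff h.pos).1 hmem).2.1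
    rw [orient_swap_right] at hqsr
    have hqr : q ≠ r := by rintro rfl; simpa only [orient_right, lt_irrefl] using h.pos_qr
    exact hgen.orient_ne_zero i hq hr hs hqr hsr.symm hsq.symm (by linarith)

theorem exists_isEmptyTriangle (hF : F ∉ S) (hgen : InGeneralPosition (insert F (S : Set Plane)))
    (hx : x ∈ S) (hy : y ∈ S) (hz : z ∈ S) (h : IsAround i F x y z) :
    ∃ p q r, IsEmptyTriangle i F S p q r := by
  classical
  let N : Plane × Plane × Plane → ℕ := fun e =>
    ((S : Set Plane) ∩ convexHull ℝ {e.1, e.2.1, e.2.2}).ncard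
  obtain ⟨⟨p, q, r⟩, hmem, hmin⟩ := Finset.exists_min_image
    {e ∈ S ×ˢ S ×ˢ S | IsAround i F e.1 e.2.1 e.2.2} N ⟨(x, y, z), by simp [hx, hy, hz, h]⟩
  simp only [Finset.mem_filter, Finset.mem_product, and_imp, Prod.forall] at hmem hmin
  obtain ⟨⟨hp, hq, hr⟩, haround⟩ := hmem
  refine ⟨p, q, r, haround, hp, hq, hr, fun s hs hsp hsq hsr => ?_⟩
  by_contra! hcon
  have hsmem := (mem_triangle_iff haround.pos).2 hcon
  have not_smaller : ∀ p' ∈ S, ∀ q' ∈ S, ∀ r' ∈ S, IsAround i F p' q' r' →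
      ({p', q', r'} : Set Plane) = {p, q, r} → s ≠ q' → s ≠ r' →
      ¬(orient i F p' s < 0 ∧ 0 < orient i F q' s) := by
    rintro p' hp' q' hq' r' hr' haround' heq hsq' hsr' ⟨hps, hqs⟩
    refine (hmin p' q' s hp' hq' hs
      ⟨haround'.pos_pq, hqs, by rw [orient_swap_right]; linarith⟩).not_gt ?_
    have hss := haround'.convexHull_inter_ssubset (hgen.mono (Set.subset_insert _ _)) hq' hr' hs
      hsq' hsr' (heq ▸ hsmem) hps hqs
    rw [heq] at hss
    exact Set.ncard_lt_ncard hss (S.finite_toSet.inter_of_left _)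
  have F_ne : ∀ u ∈ S, F ≠ u := fun u hu hFu => hF (hFu ▸ hu)
  have ne_zero : ∀ u ∈ S, s ≠ u → orient i F u s ≠ 0 := fun u hu hsu =>
    hgen.orient_ne_zero i (by simp) (by simp [hu]) (by simp [hs]) (F_ne u hu) hsu.symm (F_ne s hs)
  rcases haround.exists_neg_of_ne_zero (ne_zero p hp hsp) (ne_zero q hq hsq) (ne_zero r hr hsr)
    with hneg | hneg | hneg
  · exact not_smaller p hp q hq r hr haround rfl hsq hsr hneg
  · exact not_smaller q hq r hr p hp haround.rotate (insert_pair_rotate p q r).symm hsr hsp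
      hneg
  · exact not_smaller r hr p hp q hq haround.rotate.rotate (insert_pair_rotate r p q) hsp hsq
      hneg

theorem IsEmptyTriangle.pos_of_sector (h : IsEmptyTriangle i F S c a b) (hs : s ∈ S)
    (hcs : 0 < orient i F c s) (hsa : 0 < orient i F s a) : 0 < orient i a c s := by
  have hsc : s ≠ c := by rintro rfl; simp only [orient_right, lt_irrefl] at hcs
  have hsa' : s ≠ a := by rintro rfl; simp only [orient_right, lt_irrefl] at hsa
  have hsb : s ≠ b := by
    rintro rfl
    rw [orient_swap_right] at hcs
    linarith [h.pos_rp]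
  have affine_ab := orient_affine i a b F c a s
  have affine_bc := orient_affine i b c F c a s
  rw [orient_left, mul_zero, add_zero, ← orient_rotate i s a F, ← orient_rotate i F s a,
    ← orient_rotate i F a b, orient_rotate i a b c, orient_rotate i b c a] at affine_ab
  rw [orient_right, mul_zero, add_zero, ← orient_rotate i F b c, orient_rotate i b c a]
    at affine_bc
  rw [orient_swap]
  by_contra hcon
  have hcas : 0 ≤ orient i c a s := by linarith
  rcases h.empty s hs hsc hsa' hsb with hneg | hneg | hneg
  · linarith
  · nlinarith [mul_nonneg hcas h.pos_qr.le, mul_pos hsa h.pos, mul_pos (neg_pos.2 hneg) h.pos_pq]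
  · nlinarith [mul_nonneg hcas h.pos_rp.le, mul_pos hcs h.pos, mul_pos (neg_pos.2 hneg) h.pos_pq]

end EmptyTriangle

section Rainbow

variable {i : Fin 2} {F X Y Z Q R a b c q q' r s : Plane} {A B C K K' S : Finset Plane}

/-- The points of `S` in the convex cone with apex `F` spanned by the rays through `p` and `q`. -/
noncomputable def sector (i : Fin 2) (F p q : Plane) (S : Finset Plane) : Finset Plane :=
  {s ∈ S | 0 < orient i F p s ∧ 0 < orient i F s q}

theorem TriangleConfig.left_of_mem_A (h : TriangleConfig i F X Y Z A B C) (hc : c ∈ C)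
    (ha : a ∈ A) (hca : 0 < orient i F c a) (hs : s ∈ A) (hsa : 0 < orient i F s a) :
    0 < orient i F c s := by
  have plucker := orient_plucker i F c Y s a
  rw [orient_swap_right i F s c] at plucker
  by_contra hcon
  nlinarith [mul_pos (h.inside_C c hc).right hsa, mul_pos (h.inside_A s hs).left hca,
    (h.inside_A a ha).left]

theorem TriangleConfig.right_of_mem_A (h : TriangleConfig i F X Y Z A B C) (ha : a ∈ A)
    (hb : b ∈ B) (hab : 0 < orient i F a b) (hs : s ∈ A) (has : 0 < orient i F a s) :
    0 < orient i F s b := by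
  rw [orient_swap_right, ← orient_add_one] at hab has ⊢
  exact h.reflect.left_of_mem_A hb ha hab hs has

theorem TriangleConfig.mem_sector_of_mem_A (h : TriangleConfig i F X Y Z A B C) (ha : a ∈ A)
    (hb : b ∈ B) (hc : c ∈ C) (hca : 0 < orient i F c a) (hab : 0 < orient i F a b) (hs : s ∈ A) :
    s = a ∨ s ∈ sector i F c a (C ∪ A) ∨ s ∈ sector i F a b (A ∪ B) := by
  refine or_iff_not_imp_left.2 fun hsa => ?_
  simp only [sector, Finset.mem_filter, Finset.mem_union, hs, true_or, or_true, true_and]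
  rcases (h.orient_F_ne_zero_of_mem_A hs ha hsa).lt_or_gt with hneg | hpos
  · rw [orient_swap_right, Left.neg_neg_iff] at hneg
    exact Or.inr ⟨hneg, h.right_of_mem_A ha hb hab hs hneg⟩
  · exact Or.inl ⟨h.left_of_mem_A hc ha hca hs hpos, hpos⟩

theorem TriangleConfig.mem_sectors (h : TriangleConfig i F X Y Z A B C) (ha : a ∈ A) (hb : b ∈ B)
    (hc : c ∈ C) (hF : IsAround i F c a b) (hs : s ∈ A ∪ B ∪ C) :
    s = a ∨ s = b ∨ s = c ∨ s ∈ sector i F b c (B ∪ C) ∨ s ∈ sector i F c a (C ∪ A) ∨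
      s ∈ sector i F a b (A ∪ B) := by
  simp only [Finset.mem_union] at hs
  rcases hs with (hs | hs) | hs
  · have := h.mem_sector_of_mem_A ha hb hc hF.pos_pq hF.pos_qr hs
    tauto
  · have := h.rotate.mem_sector_of_mem_A hb hc ha hF.pos_qr hF.pos_rp hs
    tauto
  · have := h.rotate.rotate.mem_sector_of_mem_A hc ha hb hF.pos_rp hF.pos_pq hs
    tauto

theorem IsEmptyTriangle.forall_mem_sector (h : IsEmptyTriangle i F S c a b) (hK : K ⊆ S)
    (hQ : Q ∈ sector i F c a S) : ∀ s ∈ insert Q (sector i F c a K), 0 < orient i a c s := by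
  refine (Finset.forall_mem_insert ..).2 ⟨?_, fun s hs => ?_⟩
  · obtain ⟨hQS, hcQ, hQa⟩ := Finset.mem_filter.1 hQ
    exact h.pos_of_sector hQS hcQ hQa
  · obtain ⟨hsK, hcs, hsa⟩ := Finset.mem_filter.1 hs
    exact h.pos_of_sector (hK hsK) hcs hsa

theorem convexHull_sector_inter_subset (hq' : 0 < orient i F q' q) (hr : 0 < orient i F q r)
    (hR : R ∈ sector i F q' q S) (hQ : Q ∈ sector i F q r S) :
    convexHull ℝ ({q', q, R} ∪ (sector i F q' q K : Set Plane)) ∩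
      convexHull ℝ ({r, q, Q} ∪ (sector i F q r K' : Set Plane)) ⊆ {q} := by
  rw [Set.inter_comm]
  refine inter_convexHull_subset_singleton (i := i) (g := F) (h := q) (by simp)
    (forall_mem_corner (Or.inl hr) (by simp) ((Finset.forall_mem_insert ..).2
      ⟨Or.inl (Finset.mem_filter.1 hQ).2.1, fun s hs => Or.inl (Finset.mem_filter.1 hs).2.1⟩))
    (forall_mem_corner ?_ (by simp) ((Finset.forall_mem_insert ..).2 ⟨?_, fun s hs => ?_⟩)) <;>
    rw [orient_swap_right, Left.neg_nonpos_iff]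
  exacts [hq'.le, (Finset.mem_filter.1 hR).2.2.le, (Finset.mem_filter.1 hs).2.2.le]

theorem TriangleConfig.mem_sector (h : TriangleConfig i F X Y Z A B C) (hY : Y ∈ S) (ha : a ∈ A)
    (hc : c ∈ C) : Y ∈ sector i F c a S :=
  Finset.mem_filter.2 ⟨hY, (h.inside_C c hc).right, (h.inside_A a ha).left⟩

/-- The corners are separated by the rays from `F` through `a`, `b` and `c`. -/
theorem TriangleConfig.exists_centralTriangle_of_rainbow (h : TriangleConfig i F X Y Z A B C)
    (hS : {X, Y, Z} ∪ (A ∪ B ∪ C) ⊆ S) (hempty : IsEmptyTriangle i F S c a b) (hc : c ∈ C)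
    (ha : a ∈ A) (hb : b ∈ B) :
    ∃ KX KY KZ, CentralTriangle i X Y Z A B C a b c KX KY KZ := by
  have hX := h.rotate.rotate.mem_sector (hS (by simp)) hc hb
  have hY := h.mem_sector (hS (by simp)) ha hc
  have hZ := h.rotate.mem_sector (hS (by simp)) hb ha
  have hA : A ⊆ S := fun s hs => hS (by simp [hs])
  have hB : B ⊆ S := fun s hs => hS (by simp [hs])
  have hC : C ⊆ S := fun s hs => hS (by simp [hs])
  have hcY : c ≠ Y := fun hcY => by
    simpa only [hcY, orient_right, lt_irrefl] using (h.inside_C c hc).right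
  have hbZ : b ≠ Z := fun hbZ => by
    simpa only [hbZ, orient_left, orient_right, lt_irrefl] using (h.inside_B b hb).left
  refine ⟨sector i F b c (B ∪ C), sector i F c a (C ∪ A), sector i F a b (A ∪ B), ha,
    Finset.mem_insert_of_mem hb, Finset.mem_insert_of_mem hc, fun hne => hbZ hne.1, hempty.pos,
    Finset.filter_subset _ _, Finset.filter_subset _ _, Finset.filter_subset _ _,
    fun s => h.mem_sectors ha hb hc hempty.toIsAround,
    hempty.rotate.rotate.forall_mem_sector (Finset.union_subset hB hC) hX,
    fun _ => hempty.forall_mem_sector (Finset.union_subset hC hA) hY,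
    fun _ => hempty.rotate.forall_mem_sector (Finset.union_subset hA hB) hZ,
    fun hne => absurd hne hcY, fun hne => absurd hne hbZ, ?_, ?_, ?_⟩
  · rw [Set.insert_comm c]
    exact convexHull_sector_inter_subset hempty.pos_rp hempty.pos_pq hX hY
  · rw [Set.insert_comm a]
    exact convexHull_sector_inter_subset hempty.pos_pq hempty.pos_qr hY hZ
  · rw [Set.insert_comm b]
    exact convexHull_sector_inter_subset hempty.pos_qr hempty.pos_rp hZ hX

end Rainbow

section CornerTilings

open Geometry

variable {i : Fin 2} {F X Y Z a b c s x z : Plane} {A B C K KX KY KZ : Finset Plane}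
  {T : SimplicialComplex ℝ Plane} {t : List Plane}

/-- The pairs of points that do not belong to a common chain, where the three chains consist of the
points of a group and of the two vertices of the triangle next to it. -/
def crossPairs (X Y Z : Plane) (A B C : Finset Plane) : Set (Sym2 Plane) :=
  {e | (¬∀ s ∈ e, s ∈ insert X (insert Y C)) ∧ (¬∀ s ∈ e, s ∈ insert Y (insert Z A)) ∧
    ¬∀ s ∈ e, s ∈ insert Z (insert X B)}

theorem crossPairs_rotate (X Y Z : Plane) (A B C : Finset Plane) :
    crossPairs Y Z X B C A = crossPairs X Y Z A B C := by
  ext e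
  exact and_rotate.symm

namespace TriangleConfig

theorem mem_crossPairs (h : TriangleConfig i F X Y Z A B C) (hx : x ∈ insert Y C)
    (hz : z ∈ insert Z B) (hne : ¬(x = Y ∧ z = Z)) : s(x, z) ∈ crossPairs X Y Z A B C := by
  have notMem_B : ∀ s ∈ insert Y C, s ∉ insert Z (insert X B) := fun s hs hsB => by
    rcases Finset.mem_insert.1 ((Finset.insert_comm Z X B) ▸ hsB) with rfl | hsB
    · simpa only [orient_right, lt_irrefl] using h.X_left hs
    · exact h.notMem_C_of_mem_B hsB hs
  have notMem_C : ∀ s ∈ insert Z B, s ∉ insert X (insert Y C) := fun s hs hsC => by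
    rcases Finset.mem_insert.1 hsC with rfl | hsC
    · simpa only [orient_right, lt_irrefl] using h.right_X hs
    · exact h.notMem_C_of_mem_B hs hsC
  have eq_Y : x ∈ insert Y (insert Z A) → x = Y := fun hxA => by
    rcases Finset.mem_insert.1 hxA with hxY | hxA
    · exact hxY
    · rcases Finset.mem_insert.1 hxA with rfl | hxA
      exacts [absurd hx (h.notMem_C_of_mem_B (Finset.mem_insert_self x B)),
        absurd hx (h.notMem_C_of_mem_A hxA)]
  have eq_Z : z ∈ insert Y (insert Z A) → z = Z := fun hzA => by
    rcases Finset.mem_insert.1 ((Finset.insert_comm Y Z A) ▸ hzA) with hzZ | hzA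
    · exact hzZ
    · rcases Finset.mem_insert.1 hzA with rfl | hzA
      exacts [absurd (Finset.mem_insert_self z C) (h.notMem_C_of_mem_B hz),
        absurd hz (h.notMem_B_of_mem_A hzA)]
  simp only [crossPairs, Set.mem_ofPred_eq, Sym2.ball]
  exact ⟨fun hC => notMem_C z hz hC.2, fun hA => hne ⟨eq_Y hA.1, eq_Z hA.2⟩,
    fun hB => notMem_B x hx hB.1⟩

theorem Y_notMem (h : TriangleConfig i F X Y Z A B C) : Y ∉ B ∪ C := fun hY => by
  rcases Finset.mem_union.1 hY with hYB | hYC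
  · exact h.notMem_C_of_mem_B (Finset.mem_insert_of_mem hYB) (Finset.mem_insert_self Y C)
  · simpa only [orient_right, lt_irrefl] using (h.inside_C Y hYC).right

theorem Z_notMem (h : TriangleConfig i F X Y Z A B C) : Z ∉ B ∪ C := by
  rw [Finset.union_comm]
  exact h.reflect.Y_notMem

theorem X_notMem (h : TriangleConfig i F X Y Z A B C) : X ∉ B ∪ C := fun hX => by
  rcases Finset.mem_union.1 hX with hXB | hXC
  · simpa only [orient_right, lt_irrefl] using (h.inside_B X hXB).right
  · simpa only [orient_right, lt_irrefl] using (h.inside_C X hXC).left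

theorem mem_C_iff (h : TriangleConfig i F X Y Z A B C) (hK : K ⊆ B ∪ C) (hs : s ∈ K) :
    s ∈ C ↔ 0 < orient i F X s := by
  refine ⟨fun hsC => (h.inside_C s hsC).left, fun hpos => ?_⟩
  refine (Finset.mem_union.1 (hK hs)).resolve_left fun hsB => ?_
  rw [orient_swap_right] at hpos
  linarith [(h.inside_B s hsB).right]

theorem mem_B_iff (h : TriangleConfig i F X Y Z A B C) (hK : K ⊆ B ∪ C) (hs : s ∈ K) :
    s ∈ B ↔ orient i F X s < 0 := by
  rw [orient_swap_right, Left.neg_neg_iff]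
  refine ⟨fun hsB => (h.inside_B s hsB).right, fun hpos => ?_⟩
  refine (Finset.mem_union.1 (hK hs)).resolve_right fun hsC => ?_
  rw [orient_swap_right] at hpos
  linarith [(h.inside_C s hsC).left]

theorem mem_left_of_pos (h : TriangleConfig i F X Y Z A B C) (hc : c ∈ insert Y C)
    (hK : K ⊆ B ∪ C) (hx : x ∈ insert c K) (hpos : 0 < orient i F X x) : x ∈ insert Y C := by
  rcases Finset.mem_insert.1 hx with rfl | hx
  exacts [hc, Finset.mem_insert_of_mem ((h.mem_C_iff hK hx).2 hpos)]

theorem mem_right_of_neg (h : TriangleConfig i F X Y Z A B C) (hb : b ∈ insert Z B)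
    (hK : K ⊆ B ∪ C) (hz : z ∈ insert b K) (hneg : orient i F X z < 0) : z ∈ insert Z B := by
  rcases Finset.mem_insert.1 hz with rfl | hz
  exacts [hb, Finset.mem_insert_of_mem ((h.mem_B_iff hK hz).2 hneg)]

theorem isStrip (h : TriangleConfig i F X Y Z A B C) (hc : c ∈ insert Y C) (hb : b ∈ insert Z B)
    (hK : K ⊆ B ∪ C) (hbeyond : ∀ s ∈ insert X K, 0 < orient i c b s) :
    IsStrip i F X c b K where
  beyond := hbeyond
  left_pos := h.X_left hc
  right_neg := by
    rw [orient_swap_right]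
    linarith [h.right_X hb]
  side_ne_zero s hs hzero := by
    rcases Finset.mem_union.1 (hK hs) with hsB | hsC
    · exact ((h.mem_B_iff hK hs).1 hsB).ne hzero
    · exact ((h.mem_C_iff hK hs).1 hsC).ne' hzero
  apex x hx z hz hpos hneg := by
    rw [← orient_rotate]
    exact h.orient_corner (h.mem_left_of_pos hc hK hx hpos) (h.mem_right_of_neg hb hK hz hneg)
  general := h.general.mono <| by
    rintro s ((rfl | rfl | rfl) | hs)
    · simp only [Finset.mem_insert] at hc
      rcases hc with rfl | hc <;> simp [*]
    · simp only [Finset.mem_insert] at hb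
      rcases hb with rfl | hb <;> simp [*]
    · simp
    · have := hK hs
      simp only [Finset.mem_union] at this
      rcases this with hs | hs <;> simp [hs]

theorem exists_corner_tiling (h : TriangleConfig i F X Y Z A B C) (hc : c ∈ insert Y C)
    (hb : b ∈ insert Z B) (hne : ¬(b = Z ∧ c = Y)) (hK : K ⊆ B ∪ C)
    (hbeyond : ∀ s ∈ insert X K, 0 < orient i c b s)
    (hT : IsPolygonTiling i (crossPairs X Y Z A B C) (b :: c :: t) T)
    (hinter : T.space ∩ convexHull ℝ ({c, b, X} ∪ K) ⊆ segment ℝ c b) :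
    ∃ v u T', (∀ s, s ∈ v ↔ s ∈ K ∧ s ∈ B) ∧ (∀ s, s ∈ u ↔ s ∈ K ∧ s ∈ C) ∧
      IsPolygonTiling i (crossPairs X Y Z A B C) (b :: v ++ X :: u ++ c :: t) T' ∧
      T'.space ⊆ T.space ∪ convexHull ℝ ({c, b, X} ∪ K) := by
  have eq_c : ∀ {x}, x ∈ insert c K → x = Y → c = Y := fun hx hxY =>
    (Finset.mem_insert.1 hx).elim (fun hxc => hxc ▸ hxY)
      fun hxK => absurd (hK (hxY ▸ hxK)) h.Y_notMem
  have eq_b : ∀ {z}, z ∈ insert b K → z = Z → b = Z := fun hz hzZ =>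
    (Finset.mem_insert.1 hz).elim (fun hzb => hzb ▸ hzZ)
      fun hzK => absurd (hK (hzZ ▸ hzK)) h.Z_notMem
  obtain ⟨v, u, T', hv, hu, hT', hspace⟩ := (h.isStrip hc hb hK hbeyond).exists_tiling hT
    (fun x hx z hz hpos hneg => h.mem_crossPairs (h.mem_left_of_pos hc hK hx hpos)
      (h.mem_right_of_neg hb hK hz hneg) fun hxz => hne ⟨eq_b hz hxz.2, eq_c hx hxz.1⟩) hinter
  refine ⟨v, u, T', fun s => (hv s).trans ?_, fun s => (hu s).trans ?_, hT', hspace⟩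
  exacts [and_congr_right fun hs => (h.mem_B_iff hK hs).symm,
    and_congr_right fun hs => (h.mem_C_iff hK hs).symm]

end TriangleConfig

/-- There is a triangulated polygon through `X`, all of `C`, `Y`, all of `A`, `Z` and all of `B`, in
this order of the groups, whose diagonals do not join two points of the same chain. -/
def HasChainTiling (i : Fin 2) (X Y Z : Plane) (A B C : Finset Plane) : Prop :=
  ∃ lA lB lC T, (∀ s, s ∈ lA ↔ s ∈ A) ∧ (∀ s, s ∈ lB ↔ s ∈ B) ∧ (∀ s, s ∈ lC ↔ s ∈ C) ∧
    IsPolygonTiling i (crossPairs X Y Z A B C) (X :: lC ++ Y :: lA ++ Z :: lB) T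

theorem HasChainTiling.rotate (h : HasChainTiling i X Y Z A B C) :
    HasChainTiling i Y Z X B C A := by
  obtain ⟨lA, lB, lC, T, hA, hB, hC, hT⟩ := h
  refine ⟨lB, lC, lA, T, hB, hC, hA, ?_⟩
  rw [crossPairs_rotate]
  exact hT.isRotated ⟨(X :: lC).length, by
    rw [List.append_assoc, List.rotate_append_length_eq, List.append_assoc]⟩

theorem inter_subset_of_subset_union {α : Type*} {S U V W R : Set α} (hS : S ⊆ U ∪ V)
    (hU : U ∩ W ⊆ R) (hV : V ∩ W ⊆ R) : S ∩ W ⊆ R := by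
  refine (Set.inter_subset_inter_left W hS).trans ?_
  rw [Set.union_inter_distrib_right]
  exact Set.union_subset hU hV

theorem triangle_inter_corner_subset_segment {q r Q : Plane} (hp : 0 < orient i q r a)
    (hK : ∀ s ∈ insert Q K, 0 < orient i r q s) :
    convexHull ℝ {q, r, a} ∩ convexHull ℝ ({r, q, Q} ∪ K) ⊆ segment ℝ r q := fun _ hs =>
  mem_of_mem_convexHull_of_orient_nonpos (i := i) (convex_segment r q)
    (fun _ => orient_eq_zero_of_mem_segment)
    (forall_mem_corner (Or.inr (left_mem_segment ℝ r q)) (Or.inr (right_mem_segment ℝ r q))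
      fun s hs => Or.inl (hK s hs)) hs.2
    (orient_nonpos_of_mem_convexHull (by
      rintro z (rfl | rfl | rfl)
      · rw [orient_right]
      · rw [orient_left]
      · rw [orient_swap, Left.neg_nonpos_iff]
        exact hp.le) hs.1)

namespace CentralTriangle

theorem exists_corner_Y (h : TriangleConfig i F X Y Z A B C)
    (hT₀ : CentralTriangle i X Y Z A B C a b c KX KY KZ)
    (hT : IsPolygonTiling i (crossPairs X Y Z A B C) (c :: a :: t) T)
    (hinter : c ≠ Y → T.space ∩ convexHull ℝ ({a, c, Y} ∪ KY) ⊆ segment ℝ a c) :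
    ∃ v u T', (∀ s, s ∈ v ↔ s ∈ insert c KY ∧ s ∈ C) ∧ (∀ s, s ∈ u ↔ s ∈ KY ∧ s ∈ A) ∧
      IsPolygonTiling i (crossPairs X Y Z A B C) (v ++ Y :: u ++ a :: t) T' ∧
      T'.space ⊆ T.space ∪ convexHull ℝ ({a, c, Y} ∪ KY) := by
  rcases eq_or_ne c Y with rfl | hcY
  · have hc := fun hc => h.Y_notMem (Finset.mem_union_right B hc)
    refine ⟨[], [], T, fun s => ?_, fun s => ?_, hT, Set.subset_union_left⟩ <;>
      simp only [hT₀.empty_Y rfl, List.not_mem_nil, Finset.notMem_empty, false_and, false_iff]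
    rintro ⟨hs, hsC⟩
    rcases Finset.mem_insert.1 hs with rfl | hs
    exacts [hc hsC, Finset.notMem_empty s hs]
  rw [← crossPairs_rotate] at hT ⊢
  have hc := (Finset.mem_insert.1 hT₀.mem_c).resolve_left hcY
  obtain ⟨v, u, T', hv, hu, hT', hspace⟩ := h.rotate.exists_corner_tiling
    (Finset.mem_insert_of_mem hT₀.mem_a) (Finset.mem_insert_of_mem hc)
    (fun hne => h.X_notMem (Finset.mem_union_right B (hne.1 ▸ hc))) hT₀.subset_Y
    (hT₀.beyond_Y hcY) hT (hinter hcY)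
  refine ⟨c :: v, u, T', fun s => ?_, hu, hT', hspace⟩
  rw [List.mem_cons, hv, Finset.mem_insert, or_and_right]
  exact or_congr_left (iff_self_and.2 fun hs => hs ▸ hc)

theorem exists_corner_Z (h : TriangleConfig i F X Y Z A B C)
    (hT₀ : CentralTriangle i X Y Z A B C a b c KX KY KZ)
    (hT : IsPolygonTiling i (crossPairs X Y Z A B C) (a :: b :: t) T)
    (hinter : b ≠ Z → T.space ∩ convexHull ℝ ({b, a, Z} ∪ KZ) ⊆ segment ℝ b a) :
    ∃ v u T', (∀ s, s ∈ v ↔ s ∈ KZ ∧ s ∈ A) ∧ (∀ s, s ∈ u ↔ s ∈ insert b KZ ∧ s ∈ B) ∧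
      IsPolygonTiling i (crossPairs X Y Z A B C) (a :: v ++ Z :: u ++ t) T' := by
  rcases eq_or_ne b Z with rfl | hbZ
  · have hb := fun hb => h.Z_notMem (Finset.mem_union_left C hb)
    refine ⟨[], [], T, fun s => ?_, fun s => ?_, hT⟩ <;>
      simp only [hT₀.empty_Z rfl, List.not_mem_nil, Finset.notMem_empty, false_and, false_iff]
    rintro ⟨hs, hsB⟩
    rcases Finset.mem_insert.1 hs with rfl | hs
    exacts [hb hsB, Finset.notMem_empty s hs]
  rw [← crossPairs_rotate, ← crossPairs_rotate] at hT ⊢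
  have hb := (Finset.mem_insert.1 hT₀.mem_b).resolve_left hbZ
  obtain ⟨v, u, T', hv, hu, hT', -⟩ := h.rotate.rotate.exists_corner_tiling
    (Finset.mem_insert_of_mem hb) (Finset.mem_insert_of_mem hT₀.mem_a)
    (fun hne => h.X_notMem (Finset.mem_union_left C (hne.2 ▸ hb))) hT₀.subset_Z
    (hT₀.beyond_Z hbZ) hT (hinter hbZ)
  refine ⟨v, u ++ [b], T', hv, fun s => ?_, by simpa using hT'⟩
  rw [List.mem_append, List.mem_singleton, hu, Finset.mem_insert, or_and_right, or_comm]
  exact or_congr_left (iff_self_and.2 fun hs => hs ▸ hb)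

theorem mem_chain_A (h : TriangleConfig i F X Y Z A B C)
    (hT₀ : CentralTriangle i X Y Z A B C a b c KX KY KZ) (hs : s ∈ A) :
    s ∈ KY ∨ s = a ∨ s ∈ KZ := by
  have hsY := h.notMem_C_of_mem_A hs
  have hsZ := h.notMem_B_of_mem_A hs
  rcases hT₀.cover s (Finset.mem_union_left C (Finset.mem_union_left B hs)) with
    hsa | rfl | rfl | hsX | hsKY | hsKZ
  · exact Or.inr (Or.inl hsa)
  · exact absurd hT₀.mem_b hsZ
  · exact absurd hT₀.mem_c hsY
  · rcases Finset.mem_union.1 (hT₀.subset_X hsX) with hsB | hsC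
    exacts [absurd (Finset.mem_insert_of_mem hsB) hsZ, absurd (Finset.mem_insert_of_mem hsC) hsY]
  · exact Or.inl hsKY
  · exact Or.inr (Or.inr hsKZ)

theorem mem_chain_B (h : TriangleConfig i F X Y Z A B C)
    (hT₀ : CentralTriangle i X Y Z A B C a b c KX KY KZ) (hs : s ∈ B) :
    s ∈ insert b KZ ∨ s ∈ KX := by
  have hsC := h.notMem_C_of_mem_B (Finset.mem_insert_of_mem hs)
  have hsA := fun hsA => h.notMem_B_of_mem_A (s := s) hsA (Finset.mem_insert_of_mem hs)
  rcases hT₀.cover s (Finset.mem_union_left C (Finset.mem_union_right A hs)) with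
    rfl | rfl | rfl | hsX | hsKY | hsKZ
  · exact absurd hT₀.mem_a hsA
  · exact Or.inl (Finset.mem_insert_self s KZ)
  · exact absurd hT₀.mem_c hsC
  · exact Or.inr hsX
  · rcases Finset.mem_union.1 (hT₀.subset_Y hsKY) with hsC' | hsA'
    exacts [absurd (Finset.mem_insert_of_mem hsC') hsC, absurd hsA' hsA]
  · exact Or.inl (Finset.mem_insert_of_mem hsKZ)

theorem mem_chain_C (h : TriangleConfig i F X Y Z A B C)
    (hT₀ : CentralTriangle i X Y Z A B C a b c KX KY KZ) (hs : s ∈ C) :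
    s ∈ KX ∨ s ∈ insert c KY := by
  have hsB := fun hsB => h.notMem_C_of_mem_B (s := s) hsB (Finset.mem_insert_of_mem hs)
  have hsA := fun hsA => h.notMem_C_of_mem_A (s := s) hsA (Finset.mem_insert_of_mem hs)
  rcases hT₀.cover s (Finset.mem_union_right (A ∪ B) hs) with
    rfl | rfl | rfl | hsX | hsKY | hsKZ
  · exact absurd hT₀.mem_a hsA
  · exact absurd hT₀.mem_b hsB
  · exact Or.inr (Finset.mem_insert_self s KY)
  · exact Or.inl hsX
  · exact Or.inr (Finset.mem_insert_of_mem hsKY)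
  · rcases Finset.mem_union.1 (hT₀.subset_Z hsKZ) with hsA' | hsB'
    exacts [absurd hsA' hsA, absurd (Finset.mem_insert_of_mem hsB') hsB]

theorem exists_tiling (h : TriangleConfig i F X Y Z A B C)
    (hT₀ : CentralTriangle i X Y Z A B C a b c KX KY KZ) :
    ∃ uX vX uY vY uZ vZ T, (∀ s, s ∈ uX ↔ s ∈ KX ∧ s ∈ C) ∧ (∀ s, s ∈ vX ↔ s ∈ KX ∧ s ∈ B) ∧
      (∀ s, s ∈ uY ↔ s ∈ KY ∧ s ∈ A) ∧ (∀ s, s ∈ vY ↔ s ∈ insert c KY ∧ s ∈ C) ∧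
      (∀ s, s ∈ uZ ↔ s ∈ insert b KZ ∧ s ∈ B) ∧ (∀ s, s ∈ vZ ↔ s ∈ KZ ∧ s ∈ A) ∧
      IsPolygonTiling i (crossPairs X Y Z A B C)
        (X :: (uX ++ vY) ++ Y :: (uY ++ a :: vZ) ++ Z :: (uZ ++ vX)) T := by
  have pos_abc : 0 < orient i a b c := orient_rotate i c a b ▸ hT₀.pos
  have pos_bca : 0 < orient i b c a := orient_rotate i a b c ▸ pos_abc
  obtain ⟨T, hT, hspace⟩ := IsPolygonTiling.exists_triangle (i := i) pos_bca
  obtain ⟨vX, uX, TX, hvX, huX, hTX, hspaceX⟩ := h.exists_corner_tiling hT₀.mem_c hT₀.mem_b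
    hT₀.not_both hT₀.subset_X hT₀.beyond_X hT
    (hspace ▸ triangle_inter_corner_subset_segment pos_bca hT₀.beyond_X)
  rw [hspace] at hspaceX
  obtain ⟨vY, uY, TY, hvY, huY, hTY, hspaceY⟩ := hT₀.exists_corner_Y h
    (t := b :: vX ++ X :: uX) (hTX.isRotated ⟨(b :: vX ++ X :: uX).length, by
      rw [List.rotate_append_length_eq]; rfl⟩) fun hcY => inter_subset_of_subset_union hspaceX
    (insert_pair_rotate b c a ▸ triangle_inter_corner_subset_segment hT₀.pos (hT₀.beyond_Y hcY))
    (hT₀.inter_XY.trans (Set.singleton_subset_iff.2 (right_mem_segment ℝ a c)))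
  obtain ⟨vZ, uZ, TZ, hvZ, huZ, hTZ⟩ := hT₀.exists_corner_Z h
    (t := vX ++ X :: uX ++ (vY ++ Y :: uY)) (hTY.isRotated ⟨(vY ++ Y :: uY).length, by
      rw [List.rotate_append_length_eq]; simp⟩) fun hbZ => inter_subset_of_subset_union hspaceY
    (inter_subset_of_subset_union hspaceX
      (insert_pair_rotate a b c ▸ triangle_inter_corner_subset_segment pos_abc (hT₀.beyond_Z hbZ))
      (Set.inter_comm _ _ ▸ hT₀.inter_ZX.trans
        (Set.singleton_subset_iff.2 (left_mem_segment ℝ b a))))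
    (hT₀.inter_YZ.trans (Set.singleton_subset_iff.2 (right_mem_segment ℝ b a)))
  refine ⟨uX, vX, uY, vY, uZ, vZ, TZ, huX, hvX, huY, hvY, huZ, hvZ,
    hTZ.isRotated ⟨(a :: vZ ++ Z :: uZ ++ vX).length, ?_⟩⟩
  have := List.rotate_append_length_eq (a :: vZ ++ Z :: uZ ++ vX) (X :: uX ++ (vY ++ Y :: uY))
  simpa only [List.append_assoc, List.cons_append] using this

theorem hasChainTiling (h : TriangleConfig i F X Y Z A B C)
    (hT₀ : CentralTriangle i X Y Z A B C a b c KX KY KZ) : HasChainTiling i X Y Z A B C := by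
  obtain ⟨uX, vX, uY, vY, uZ, vZ, T, huX, hvX, huY, hvY, huZ, hvZ, hT⟩ := hT₀.exists_tiling h
  refine ⟨uY ++ a :: vZ, uZ ++ vX, uX ++ vY, T, fun s => ?_, fun s => ?_, fun s => ?_, hT⟩
  · rw [List.mem_append, List.mem_cons, huY, hvZ]
    refine ⟨?_, fun hs => ?_⟩
    · rintro (hs | rfl | hs)
      exacts [hs.2, hT₀.mem_a, hs.2]
    · exact (hT₀.mem_chain_A h hs).imp (⟨·, hs⟩) (Or.imp_right (⟨·, hs⟩))
  · rw [List.mem_append, huZ, hvX, ← or_and_right]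
    exact ⟨And.right, fun hs => ⟨hT₀.mem_chain_B h hs, hs⟩⟩
  · rw [List.mem_append, huX, hvY, ← or_and_right]
    exact ⟨And.right, fun hs => ⟨hT₀.mem_chain_C h hs, hs⟩⟩

end CentralTriangle

end CornerTilings

section Classification

variable {i : Fin 2} {F X Y Z Q b c p q r s : Plane} {A B C S : Finset Plane}

theorem IsAround.not_forall_right (h : IsAround i F p q r) :
    ¬(0 < orient i F p Q ∧ 0 < orient i F q Q ∧ 0 < orient i F r Q) := fun ⟨hp, hq, hr⟩ => by
  rcases h.exists_neg_of_ne_zero hp.ne' hq.ne' hr.ne' with hneg | hneg | hneg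
  exacts [hneg.1.not_gt hp, hneg.1.not_gt hq, hneg.1.not_gt hr]

theorem IsEmptyTriangle.isFront (hempty : IsEmptyTriangle i F S c b r)
    (h : TriangleConfig i F X Y Z A B C) (hA : A ⊆ S) (hc : c ∈ insert Y C)
    (hb : b ∈ insert Z B) : IsFront i F Y Z A B C c b where
  mem_c := hc
  mem_b := hb
  pos := hempty.pos_pq
  beyond s hs := by
    have front : IsFront i F Y Z ∅ B C c b :=
      ⟨hc, hb, hempty.pos_pq, fun s hs => absurd hs (Finset.notMem_empty s)⟩
    rw [orient_swap, Left.neg_neg_iff]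
    exact hempty.pos_of_sector (hA hs) (front.pos_c_of_mem_A h hs) (front.pos_b_of_mem_A h hs)

/-- One of the three groups is separated from `F` by a front. -/
def HasFront (i : Fin 2) (F X Y Z : Plane) (A B C : Finset Plane) : Prop :=
  (∃ c b, IsFront i F Y Z A B C c b) ∨ (∃ c b, IsFront i F Z X B C A c b) ∨
    ∃ c b, IsFront i F X Y C A B c b

theorem hasFront_rotate : HasFront i F Y Z X B C A ↔ HasFront i F X Y Z A B C := or_rotate.symm

theorem points_rotate (X Y Z : Plane) (A B C : Finset Plane) :
    ({Y, Z, X} ∪ (B ∪ C ∪ A) : Finset Plane) = {X, Y, Z} ∪ (A ∪ B ∪ C) := by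
  ext s
  simp only [Finset.mem_union, Finset.mem_insert, Finset.mem_singleton]
  tauto

namespace TriangleConfig

theorem notMem_insert_Y (h : TriangleConfig i F X Y Z A B C) (hs : s ∈ insert X C) :
    s ∉ insert Y A := fun hsA => by
  have hY := h.rotate.rotate.Z_left hsA
  rw [orient_swap_right] at hY
  linarith [h.rotate.right_X hs]

theorem mem_insert_X_or (h : TriangleConfig i F X Y Z A B C)
    (hfront : ¬HasFront i F X Y Z A B C) (hS : S = {X, Y, Z} ∪ (A ∪ B ∪ C))
    (hempty : IsEmptyTriangle i F S p q r) (hp : p ∈ insert X C) :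
    q ∈ insert X C ∨ p ∈ C ∧ q ∈ insert Y A := by
  have hAS : A ⊆ S := fun s hs => by simp [hS, hs]
  have hCS : C ⊆ S := fun s hs => by simp [hS, hs]
  have hq : q ∈ insert X C ∨ q ∈ insert Y A ∨ q ∈ insert Z B := by
    have := hempty.mem_q
    simp only [hS, Finset.mem_union, Finset.mem_insert, Finset.mem_singleton] at this ⊢
    tauto
  rcases hq with hqX | hqY | hqZ
  · exact Or.inl hqX
  · refine Or.inr ⟨(Finset.mem_insert.1 hp).resolve_left ?_, hqY⟩
    rintro rfl
    exact hfront (Or.inr (Or.inr ⟨p, q, hempty.isFront h.rotate.rotate hCS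
      (Finset.mem_insert_self p B) hqY⟩))
  · rcases Finset.mem_insert.1 hp with rfl | hpC
    · have hqp := h.right_X hqZ
      rw [orient_swap_right] at hqp
      linarith [hempty.pos_pq]
    · exact absurd (Or.inl ⟨p, q, hempty.isFront h hAS (Finset.mem_insert_of_mem hpC) hqZ⟩) hfront

theorem rainbow_of_mem_insert_X (h : TriangleConfig i F X Y Z A B C)
    (hfront : ¬HasFront i F X Y Z A B C) (hS : S = {X, Y, Z} ∪ (A ∪ B ∪ C))
    (hempty : IsEmptyTriangle i F S p q r) (hp : p ∈ insert X C) : p ∈ C ∧ q ∈ A ∧ r ∈ B := by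
  have hfront' := mt hasFront_rotate.1 hfront
  have hfront'' := mt hasFront_rotate.1 hfront'
  have hS' : S = {Y, Z, X} ∪ (B ∪ C ∪ A) := hS.trans (points_rotate X Y Z A B C).symm
  have hS'' : S = {Z, X, Y} ∪ (C ∪ A ∪ B) := hS'.trans (points_rotate Y Z X B C A).symm
  have not_r_mem_Y : r ∉ insert Y A := fun hr =>
    (h.rotate.mem_insert_X_or hfront' hS' hempty.rotate.rotate hr).elim
      (h.notMem_insert_Y hp) fun hpB => h.rotate.rotate.notMem_insert_Y hpB.2 hp
  rcases h.mem_insert_X_or hfront hS hempty hp with hq | ⟨hpC, hq⟩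
  · rcases h.mem_insert_X_or hfront hS hempty.rotate hq with hr | ⟨-, hr⟩
    · exact absurd ⟨h.rotate.right_X hp, h.rotate.right_X hq, h.rotate.right_X hr⟩
        hempty.not_forall_right
    · exact absurd hr not_r_mem_Y
  · rcases h.rotate.mem_insert_X_or hfront' hS' hempty.rotate hq with hr | ⟨hqA, hr⟩
    · exact absurd hr not_r_mem_Y
    · rcases h.rotate.rotate.mem_insert_X_or hfront'' hS'' hempty.rotate.rotate hr with
        hpZ | ⟨hrB, -⟩
      · exact absurd hp (h.rotate.rotate.notMem_insert_Y hpZ)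
      · exact ⟨hpC, hqA, hrB⟩

theorem hasChainTiling_of_hasFront (h : TriangleConfig i F X Y Z A B C) (hA : A.Nonempty)
    (hB : B.Nonempty) (hC : C.Nonempty) (hfront : HasFront i F X Y Z A B C) :
    HasChainTiling i X Y Z A B C := by
  have of_isFront : ∀ {X Y Z c b A B C}, TriangleConfig i F X Y Z A B C → A.Nonempty →
      IsFront i F Y Z A B C c b → HasChainTiling i X Y Z A B C := fun h hA hf => by
    obtain ⟨a, b, c, KX, KY, KZ, central⟩ := hf.exists_centralTriangle h hA
    exact central.hasChainTiling h
  rcases hfront with ⟨c, b, hf⟩ | ⟨c, b, hf⟩ | ⟨c, b, hf⟩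
  exacts [of_isFront h hA hf, (of_isFront h.rotate hB hf).rotate.rotate,
    (of_isFront h.rotate.rotate hC hf).rotate]

theorem hasChainTiling_of_mem_insert_X (h : TriangleConfig i F X Y Z A B C)
    (hfront : ¬HasFront i F X Y Z A B C) (hS : S = {X, Y, Z} ∪ (A ∪ B ∪ C))
    (hempty : IsEmptyTriangle i F S p q r) (hp : p ∈ insert X C) :
    HasChainTiling i X Y Z A B C := by
  obtain ⟨hpC, hqA, hrB⟩ := h.rainbow_of_mem_insert_X hfront hS hempty hp
  obtain ⟨KX, KY, KZ, central⟩ :=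
    h.exists_centralTriangle_of_rainbow hS.ge hempty hpC hqA hrB
  exact central.hasChainTiling h

theorem exists_isEmptyTriangle_points (h : TriangleConfig i F X Y Z A B C) :
    ∃ p q r, IsEmptyTriangle i F ({X, Y, Z} ∪ (A ∪ B ∪ C)) p q r := by
  refine exists_isEmptyTriangle (fun hF => ?_) ?_ (x := X) (y := Y) (z := Z) (by simp) (by simp)
    (by simp) ⟨h.pos_XY, h.pos_YZ, h.pos_ZX⟩
  · simp only [Finset.mem_union, Finset.mem_insert, Finset.mem_singleton] at hF
    rcases hF with (rfl | rfl | rfl) | (hFA | hFB) | hFC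
    · simpa using h.pos_XY
    · simpa using h.pos_YZ
    · simpa using h.pos_ZX
    · simpa using (h.inside_A F hFA).left
    · simpa using (h.inside_B F hFB).left
    · simpa using (h.inside_C F hFC).left
  · convert h.general using 1
    simp only [Finset.coe_union, Finset.coe_insert, Finset.coe_singleton, Set.insert_union]

theorem hasChainTiling (h : TriangleConfig i F X Y Z A B C) (hA : A.Nonempty) (hB : B.Nonempty)
    (hC : C.Nonempty) : HasChainTiling i X Y Z A B C := by
  by_cases hfront : HasFront i F X Y Z A B C
  · exact h.hasChainTiling_of_hasFront hA hB hC hfront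
  obtain ⟨p, q, r, hempty⟩ := h.exists_isEmptyTriangle_points
  have hp : p ∈ insert X C ∨ p ∈ insert Y A ∨ p ∈ insert Z B := by
    have := hempty.mem_p
    simp only [Finset.mem_union, Finset.mem_insert, Finset.mem_singleton] at this ⊢
    tauto
  have hfront' := mt hasFront_rotate.1 hfront
  rcases hp with hpX | hpY | hpZ
  · exact h.hasChainTiling_of_mem_insert_X hfront rfl hempty hpX
  · exact (h.rotate.hasChainTiling_of_mem_insert_X hfront'
      (points_rotate X Y Z A B C).symm hempty hpY).rotate.rotate
  · exact (h.rotate.rotate.hasChainTiling_of_mem_insert_X (mt hasFront_rotate.1 hfront')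
      ((points_rotate Y Z X B C A).trans (points_rotate X Y Z A B C)).symm hempty hpZ).rotate

end TriangleConfig

end Classification

section Sorting

variable {i : Fin 2} {F X Y Z P Q p q r s : Plane} {A : Finset Plane}

open Classical in
/-- The points of `A` that lie in the triangle `F P Q`. -/
noncomputable def pointsIn (A : Finset Plane) (F P Q : Plane) : Finset Plane :=
  {s ∈ A | s ∈ convexHull ℝ {F, P, Q}}

theorem mem_pointsIn : s ∈ pointsIn A F P Q ↔ s ∈ A ∧ s ∈ convexHull ℝ {F, P, Q} := by
  simp only [pointsIn, Finset.mem_filter]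

theorem card_pointsIn (A : Finset Plane) (F P Q : Plane) :
    (pointsIn A F P Q).card = ((A : Set Plane) ∩ convexHull ℝ {F, P, Q}).ncard := by
  rw [← Set.ncard_coe_finset]
  congr 1
  ext s
  exact mem_pointsIn

theorem IsAround.exists_sector_of_ne_zero (h : IsAround i F p q r) (hp : orient i F p s ≠ 0)
    (hq : orient i F q s ≠ 0) (hr : orient i F r s ≠ 0) :
    (0 < orient i F p s ∧ orient i F q s < 0) ∨ (0 < orient i F q s ∧ orient i F r s < 0) ∨
      (0 < orient i F r s ∧ orient i F p s < 0) := by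
  rcases h.exists_neg_of_ne_zero hp hq hr with ⟨hneg, hpos⟩ | ⟨hneg, hpos⟩ | ⟨hneg, hpos⟩
  · exact Or.inr (hr.lt_or_gt.imp (⟨hpos, ·⟩) (⟨·, hneg⟩))
  · rcases hp.lt_or_gt with hp | hp
    exacts [Or.inr (Or.inr ⟨hpos, hp⟩), Or.inl ⟨hp, hneg⟩]
  · rcases hq.lt_or_gt with hq | hq
    exacts [Or.inl ⟨hpos, hq⟩, Or.inr (Or.inl ⟨hq, hneg⟩)]

/-- A finite set `A` of points of the positively oriented triangle `X Y Z`, in general position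
together with the vertices and a further point `F`, such that all three subtriangles at `F` contain
points of `A`. -/
structure PointsInTriangle (i : Fin 2) (F X Y Z : Plane) (A : Finset Plane) : Prop where
  pos : 0 < orient i X Y Z
  mem_F : F ∈ convexHull ℝ {X, Y, Z}
  subset : (A : Set Plane) ⊆ convexHull ℝ {X, Y, Z}
  disjoint : Disjoint {X, Y, Z, F} (A : Set Plane)
  general : InGeneralPosition ({X, Y, Z, F} ∪ (A : Set Plane))
  nonempty_XY : (pointsIn A F X Y).Nonempty
  nonempty_YZ : (pointsIn A F Y Z).Nonempty
  nonempty_ZX : (pointsIn A F Z X).Nonempty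

namespace PointsInTriangle

theorem rotate (h : PointsInTriangle i F X Y Z A) : PointsInTriangle i F Y Z X A := by
  have quadruple_rotate : ({Y, Z, X, F} : Set Plane) = {X, Y, Z, F} := by
    rw [Set.insert_comm Z, Set.insert_comm Y]
  obtain ⟨pos, mem_F, subset, disjoint, general, nonempty_XY, nonempty_YZ, nonempty_ZX⟩ := h
  rw [orient_rotate] at pos
  rw [insert_pair_rotate] at mem_F subset
  rw [← quadruple_rotate] at disjoint general
  exact ⟨pos, mem_F, subset, disjoint, general, nonempty_YZ, nonempty_ZX, nonempty_XY⟩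

theorem X_ne_Y (h : PointsInTriangle i F X Y Z A) : X ≠ Y := by
  rintro rfl
  simpa only [orient_self, lt_irrefl] using h.pos

theorem ne_of_mem (h : PointsInTriangle i F X Y Z A) (hs : s ∈ A) : X ≠ s ∧ F ≠ s :=
  ⟨h.disjoint.ne_of_mem (by simp) hs, h.disjoint.ne_of_mem (by simp) hs⟩

theorem orient_X_Y_ne_zero (h : PointsInTriangle i F X Y Z A) (hs : s ∈ A) :
    orient i X Y s ≠ 0 :=
  h.general.orient_ne_zero i (by simp) (by simp) (by simp [hs]) h.X_ne_Y
    (h.rotate.ne_of_mem hs).1 (h.ne_of_mem hs).1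

theorem F_ne_X (h : PointsInTriangle i F X Y Z A) : F ≠ X := by
  rintro rfl
  obtain ⟨s, hs⟩ := h.nonempty_XY
  obtain ⟨hsA, hs⟩ := mem_pointsIn.1 hs
  rw [Set.insert_eq_of_mem (Set.mem_insert F {Y}), convexHull_pair] at hs
  exact h.orient_X_Y_ne_zero hsA (orient_eq_zero_of_mem_segment hs)

theorem pos_XY (h : PointsInTriangle i F X Y Z A) : 0 < orient i F X Y := by
  rw [orient_rotate]
  exact ((mem_triangle_iff h.pos).1 h.mem_F).1.lt_of_ne' (h.general.orient_ne_zero i (by simp)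
    (by simp) (by simp) h.X_ne_Y h.rotate.F_ne_X.symm h.F_ne_X.symm)

theorem isAround (h : PointsInTriangle i F X Y Z A) : IsAround i F X Y Z :=
  ⟨h.pos_XY, h.rotate.pos_XY, h.rotate.rotate.pos_XY⟩

theorem orient_F_X_ne_zero (h : PointsInTriangle i F X Y Z A) (hs : s ∈ A) :
    orient i F X s ≠ 0 :=
  h.general.orient_ne_zero i (by simp) (by simp) (by simp [hs]) h.F_ne_X (h.ne_of_mem hs).1
    (h.ne_of_mem hs).2

theorem side_XY (h : PointsInTriangle i F X Y Z A) (hs : s ∈ A) : 0 < orient i X Y s :=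
  ((mem_triangle_iff h.pos).1 (h.subset hs)).1.lt_of_ne' (h.orient_X_Y_ne_zero hs)

theorem mem_pointsIn_iff (h : PointsInTriangle i F X Y Z A) :
    s ∈ pointsIn A F X Y ↔ s ∈ A ∧ 0 < orient i F X s ∧ orient i F Y s < 0 := by
  rw [mem_pointsIn, mem_triangle_iff h.pos_XY]
  refine and_congr_right fun hs => ?_
  rw [orient_swap i Y F s, Left.nonneg_neg_iff]
  exact ⟨fun hnonneg => ⟨hnonneg.1.lt_of_ne' (h.orient_F_X_ne_zero hs),
    hnonneg.2.2.lt_of_ne (h.rotate.orient_F_X_ne_zero hs)⟩,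
    fun hpos => ⟨hpos.1.le, (h.side_XY hs).le, hpos.2.le⟩⟩

theorem isInside (h : PointsInTriangle i F X Y Z A) (hs : s ∈ pointsIn A F X Y) :
    IsInside i F X Y s := by
  obtain ⟨hsA, left, right⟩ := h.mem_pointsIn_iff.1 hs
  rw [orient_swap_right, Left.neg_neg_iff] at right
  exact ⟨left, right, h.side_XY hsA⟩

theorem mem_iff (h : PointsInTriangle i F X Y Z A) :
    s ∈ A ↔ s ∈ pointsIn A F X Y ∨ s ∈ pointsIn A F Y Z ∨ s ∈ pointsIn A F Z X := by
  rw [h.mem_pointsIn_iff, h.rotate.mem_pointsIn_iff, h.rotate.rotate.mem_pointsIn_iff,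
    ← and_or_left, ← and_or_left]
  exact iff_self_and.2 fun hs => h.isAround.exists_sector_of_ne_zero (h.orient_F_X_ne_zero hs)
    (h.rotate.orient_F_X_ne_zero hs) (h.rotate.rotate.orient_F_X_ne_zero hs)

theorem triangleConfig (h : PointsInTriangle i F X Y Z A) :
    TriangleConfig i F X Y Z (pointsIn A F Y Z) (pointsIn A F Z X) (pointsIn A F X Y) where
  pos_XY := h.pos_XY
  pos_YZ := h.rotate.pos_XY
  pos_ZX := h.rotate.rotate.pos_XY
  inside_A _ := h.rotate.isInside
  inside_B _ := h.rotate.rotate.isInside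
  inside_C _ := h.isInside
  general := h.general.mono <| by
    rintro s ((rfl | rfl | rfl | rfl) | (hs | hs) | hs)
    · simp
    · simp
    · simp
    · simp
    all_goals exact Or.inr (mem_pointsIn.1 hs).1

theorem perm_toList (h : PointsInTriangle i F X Y Z A) {lA lB lC : List Plane}
    (hA : ∀ s, s ∈ lA ↔ s ∈ pointsIn A F Y Z) (hB : ∀ s, s ∈ lB ↔ s ∈ pointsIn A F Z X)
    (hC : ∀ s, s ∈ lC ↔ s ∈ pointsIn A F X Y)
    (hnodup : (X :: lC ++ Y :: lA ++ Z :: lB).Nodup) : (lC ++ lA ++ lB).Perm A.toList := by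
  have hsub : (lC ++ lA ++ lB).Sublist (X :: lC ++ Y :: lA ++ Z :: lB) :=
    ((List.sublist_cons_self X lC).append (List.sublist_cons_self Y lA)).append
      (List.sublist_cons_self Z lB)
  refine (List.perm_ext_iff_of_nodup (hnodup.sublist hsub) A.nodup_toList).2 fun s => ?_
  rw [Finset.mem_toList, h.mem_iff, List.mem_append, List.mem_append, hA, hB, hC, or_assoc]

end PointsInTriangle

theorem polylineCarrier_subset {l : List Plane} {K : Set Plane} (hK : Convex ℝ K)
    (hl : ∀ p ∈ l, p ∈ K) : polylineCarrier l ⊆ K := by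
  rintro x ⟨p, q, hpq, hx⟩
  exact hK.segment_subset (hl p (hpq.subset (by simp))) (hl q (hpq.subset (by simp))) hx

theorem mem_chain_iff {l : List Plane} {S : Finset Plane} (hl : ∀ s, s ∈ l ↔ s ∈ S) :
    s ∈ p :: (l ++ [q]) ↔ s ∈ insert p (insert q S) := by
  rw [List.mem_cons, List.mem_append, List.mem_singleton, hl, Finset.mem_insert,
    Finset.mem_insert, or_comm (a := s ∈ S)]

theorem polylineCarrier_chain_subset {l : List Plane}
    (hl : ∀ s, s ∈ l ↔ s ∈ pointsIn A F p q) :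
    polylineCarrier (p :: (l ++ [q])) ⊆ convexHull ℝ {F, p, q} := by
  refine polylineCarrier_subset (convex_convexHull ℝ _) fun s hs => ?_
  rcases Finset.mem_insert.1 ((mem_chain_iff hl).1 hs) with rfl | hs
  · exact subset_convexHull ℝ _ (by simp)
  · rcases Finset.mem_insert.1 hs with rfl | hs
    exacts [subset_convexHull ℝ _ (by simp), (mem_pointsIn.1 hs).2]

theorem length_eq_card {α : Type*} {l : List α} {S : Finset α} (hl : l.Nodup)
    (h : ∀ s, s ∈ l ↔ s ∈ S) : l.length = S.card := by
  classical
  rw [← List.toFinset_card_of_nodup hl]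
  congr 1
  ext s
  rw [List.mem_toFinset, h]

theorem exists_orient_pos (h : AffineIndependent ℝ ![X, Y, Z]) : ∃ i, 0 < orient i X Y Z := by
  rcases ((affineIndependent_iff_orient_ne_zero 0 X Y Z).1 h).lt_or_gt with hneg | hpos
  · exact ⟨0 + 1, by rwa [orient_add_one, Left.neg_pos_iff]⟩
  · exact ⟨0, hpos⟩

end Sorting

theorem mainTheorem10 (X Y Z F : Plane) (A : Finset Plane)
    (hXYZ : AffineIndependent ℝ ![X, Y, Z])
    (hF : F ∈ convexHull ℝ {X, Y, Z})
    (hA : (A : Set Plane) ⊆ convexHull ℝ {X, Y, Z})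
    (hdisj : Disjoint {X, Y, Z, F} (A : Set Plane))
    (hgen : InGeneralPosition ({X, Y, Z, F} ∪ (A : Set Plane)))
    (P : Fin 3 → Plane) (hP : P = ![X, Y, Z])
    (c : Fin 3 → ℕ)
    (hc : ∀ i, c i = ((A : Set Plane) ∩ convexHull ℝ {F, P i, P (i + 1)}).ncard)
    (hpos : ∀ i, 0 < c i) :
    ∃ l : Fin 3 → List Plane,
      (∀ i, (l i).length = c i) ∧
      (l 0 ++ l 1 ++ l 2).Perm A.toList ∧
      (∀ i, polylineCarrier (P i :: (l i ++ [P (i + 1)])) ⊆ convexHull ℝ {F, P i, P (i + 1)}) ∧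
      (closedPolyline (P 0 :: l 0 ++ P 1 :: l 1 ++ P 2 :: l 2)).IsSimple ∧
      ∃ K : Geometry.SimplicialComplex ℝ Plane,
        (closedPolyline (P 0 :: l 0 ++ P 1 :: l 1 ++ P 2 :: l 2)).IsTriangulation K ∧
        ∀ a b : Plane,
          (closedPolyline (P 0 :: l 0 ++ P 1 :: l 1 ++ P 2 :: l 2)).IsDiagonalOf K a b →
            ∀ i, ¬ (a ∈ P i :: (l i ++ [P (i + 1)]) ∧ b ∈ P i :: (l i ++ [P (i + 1)])) := by
  subst hP
  obtain ⟨i, hi⟩ := exists_orient_pos hXYZ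
  have card : ∀ k, c k = (pointsIn A F (![X, Y, Z] k) (![X, Y, Z] (k + 1))).card := fun k =>
    (hc k).trans (card_pointsIn A F _ _).symm
  have nonempty := fun k => Finset.card_pos.1 (card k ▸ hpos k)
  have points : PointsInTriangle i F X Y Z A :=
    ⟨hi, hF, hA, hdisj, hgen, nonempty 0, nonempty 1, nonempty 2⟩
  obtain ⟨lA, lB, lC, T, hlA, hlB, hlC, hT⟩ :=
    points.triangleConfig.hasChainTiling (nonempty 1) (nonempty 2) (nonempty 0)
  have perm := points.perm_toList hlA hlB hlC hT.nodup
  have hnodup := perm.nodup_iff.2 A.nodup_toList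
  refine ⟨![lC, lA, lB], fun k => (card k).symm ▸ ?_, perm, fun k => ?_, hT.isSimple, T,
    hT.isTriangulation, fun a b hab k => ?_⟩
  · fin_cases k
    exacts [length_eq_card hnodup.of_append_left.of_append_left hlC,
      length_eq_card hnodup.of_append_left.of_append_right hlA,
      length_eq_card hnodup.of_append_right hlB]
  · fin_cases k
    exacts [polylineCarrier_chain_subset hlC, polylineCarrier_chain_subset hlA,
      polylineCarrier_chain_subset hlB]
  · obtain ⟨not_C, not_A, not_B⟩ := hT.mem_of_isDiagonalOf hab
    rw [Sym2.ball] at not_C not_A not_B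
    fin_cases k
    exacts [mt (and_congr (mem_chain_iff hlC) (mem_chain_iff hlC)).1 not_C,
      mt (and_congr (mem_chain_iff hlA) (mem_chain_iff hlA)).1 not_A,
      mt (and_congr (mem_chain_iff hlB) (mem_chain_iff hlB)).1 not_B]
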